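/- Let $r\in\{2,3,\dots\}\cup\{\infty\}$ and $\mathbb S^1=\mathbb R/\mathbb Z$. Let $E^r(\mathbb S^1)$ be the space of $C^r$ maps $f:\mathbb S^1\to\mathbb S^1$ with $|f'(x)|>1$ for all $x$, with the $C^r$ topology; let $\deg(f)\in\mathbb Z$ be the degree of $f$ and $\|f\|_{C^2}=\sup_x\max\{|f'(x)|,|f''(x)|\}$. Let $\nu$ be a Borel probability measure on $E^r(\mathbb S^1)$ with $$\int\log\|f\|_{C^2}\,d\nu(f)<\infty .$$ A Borel probability measure $\mu$ on $\mathbb S^1$ is $\nu$-stationary if $\int\mu(f^{-1}(A))\,d\nu(f)=\mu(A)$ for all Borel sets $A$. For $\omega=(f_{\omega_0},f_{\omega_1},\dots)\in E^r(\mathbb S^1)^{\mathbb N}$ write $f_\omega^n=f_{\omega_{n-1}}\circ\cdots\circ f_{\omega_0}$. There is exactly one $\nu$-stationary probability measure $\mu_{\rm SRB}$ that is absolutely continuous with respect to Lebesgue measure. It has a Lyapunov exponent, that is, a real number $\lambda(\mu_{\rm SRB})$ with $$\lim_{n\to\infty}\frac1n\log|(f_\omega^n)'(x)|=\lambda(\mu_{\rm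 SRB})\quad\text{for }\nu^{\mathbb N}\times\mu_{\rm SRB}\text{-a.e. }(\omega,x).$$ The function $f\mapsto\log|\deg(f)|$ is $\nu$-integrable, and $$\lambda(\mu_{\rm SRB})\le\int\log|\deg(f)|\,d\nu(f).$$ Moreover, equality holds if and only if there is a $C^r$ diffeomorphism $h$ of $\mathbb S^1$ such that for every $f$ in the support of $\nu$ there is $\rho_f\in\mathbb S^1$ with $$h\circ f\circ h^{-1}(x)=\deg(f)\cdot x+\rho_f\qquad\text{for all }x\in\mathbb S^1 .$$ -/

import Mathlib

open MeasureTheory Filter Topology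
open scoped ENNReal

noncomputable section

namespace RandomCircle

/-- A self-map `g` of the circle `ℝ/ℤ` is of class `C^r` if it is covered by a `C^r` map of the
real line (equivalently, it is `C^r` in the charts given by the covering `ℝ → ℝ/ℤ`). -/
def IsCr (r : ℕ∞) (g : UnitAddCircle → UnitAddCircle) : Prop :=
  ∃ G : ℝ → ℝ, ContDiff ℝ r G ∧ ∀ x : ℝ, (G x : UnitAddCircle) = g x

theorem IsCr.continuous {r : ℕ∞} {g : UnitAddCircle → UnitAddCircle} (hg : IsCr r g) :
    Continuous g := by
  obtain ⟨G, hG, h⟩ := hg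
  have : Continuous (g ∘ ((↑) : ℝ → UnitAddCircle)) := by
    have h' : g ∘ ((↑) : ℝ → UnitAddCircle) = fun x => (G x : UnitAddCircle) :=
      funext fun x => (h x).symm
    rw [h']
    exact (AddCircle.continuous_mk' 1).comp hG.continuous
  exact (QuotientAddGroup.isQuotientMap_mk (N := AddSubgroup.zmultiples (1 : ℝ))).continuous_iff.2
    this

/-- The space `C^r(S¹)` of `C^r` self-maps of the circle `S¹ = ℝ/ℤ`. -/
@[ext]
structure CrMap (r : ℕ∞) where
  toFun : UnitAddCircle → UnitAddCircle
  isCr : IsCr r toFun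

namespace CrMap

variable {r : ℕ∞}

instance : CoeFun (CrMap r) (fun _ => UnitAddCircle → UnitAddCircle) := ⟨CrMap.toFun⟩

/-- A `C^r` lift `ℝ → ℝ` of a `C^r` circle map. It is unique up to an additive integer constant,
so the degree and the derivatives below do not depend on the choice. -/
def lift (f : CrMap r) : ℝ → ℝ := f.isCr.choose

theorem contDiff_lift (f : CrMap r) : ContDiff ℝ r f.lift := f.isCr.choose_spec.1

theorem coe_lift (f : CrMap r) (x : ℝ) : (f.lift x : UnitAddCircle) = f x :=
  f.isCr.choose_spec.2 x

/-- Two continuous lifts of one function to the circle differ by an integer constant. -/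
theorem exists_int_of_lifts {F G : ℝ → ℝ} (hF : Continuous F) (hG : Continuous G)
    (h : ∀ x, (F x : UnitAddCircle) = G x) : ∃ d : ℤ, ∀ x, F x = G x + d := by
  have hint : ∀ x, ∃ d : ℤ, F x - G x = d := by
    intro x
    have h1 : ((F x - G x : ℝ) : UnitAddCircle) = 0 := by
      rw [AddCircle.coe_sub, h x, sub_self]
    obtain ⟨n, hn⟩ := (AddCircle.coe_eq_zero_iff (1 : ℝ)).1 h1
    exact ⟨n, by rw [← hn]; simp⟩
  choose d hd using hint
  have hcont : Continuous (fun x => ((d x : ℤ) : ℝ)) := by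
    have : (fun x => ((d x : ℤ) : ℝ)) = fun x => F x - G x := funext fun x => (hd x).symm
    rw [this]
    exact hF.sub hG
  have hdc : Continuous d := Int.isClosedEmbedding_coe_real.isInducing.continuous_iff.2 hcont
  refine ⟨d 0, fun x => ?_⟩
  have : d x = d 0 := PreconnectedSpace.constant inferInstance hdc
  rw [← this, ← hd x]
  ring

/-- The (signed) topological degree: the integer `F 1 - F 0` for a lift `F`. -/
def degree (f : CrMap r) : ℤ := ⌊f.lift 1 - f.lift 0⌋

theorem lift_add_one (f : CrMap r) (x : ℝ) : f.lift (x + 1) = f.lift x + f.degree := by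
  have hc := f.contDiff_lift.continuous
  obtain ⟨d, hd⟩ := exists_int_of_lifts (F := fun x => f.lift (x + 1)) (G := f.lift)
    (by fun_prop) hc (fun x => by
      rw [f.coe_lift, f.coe_lift, AddCircle.coe_add]
      simp [AddCircle.coe_period])
  have h0 : f.lift 1 - f.lift 0 = (d : ℝ) := by
    have := hd 0
    simp only [zero_add] at this
    rw [this]
    ring
  have : f.degree = d := by rw [degree, h0, Int.floor_intCast]
  rw [this]
  exact hd x

/-- The `k`-th derivative `f^{(k)} : S¹ → ℝ`, `k ≥ 1`, with respect to arc length: it is computed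
with a lift, and descends to the circle because the derivatives of a lift are `1`-periodic. -/
def iterDeriv (f : CrMap r) (k : ℕ) : UnitAddCircle → ℝ :=
  AddCircle.liftIco 1 0 (iteratedDeriv k f.lift)

theorem periodic_iteratedDeriv_lift (f : CrMap r) {k : ℕ} (hk : 1 ≤ k) :
    Function.Periodic (iteratedDeriv k f.lift) 1 := by
  obtain ⟨k, rfl⟩ : ∃ j, k = j + 1 := ⟨k - 1, by omega⟩
  intro x
  have h1 : deriv (fun y => f.lift (y + 1)) = deriv f.lift := by
    have : (fun y => f.lift (y + 1)) = fun y => f.lift y + f.degree :=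
      funext fun y => f.lift_add_one y
    rw [this]
    funext y
    exact deriv_add_const _
  have h2 := congrFun (iteratedDeriv_comp_add_const (k + 1) f.lift 1) x
  rw [← h2, iteratedDeriv_succ', h1, ← iteratedDeriv_succ']

theorem iterDeriv_coe (f : CrMap r) {k : ℕ} (hk : 1 ≤ k) (x : ℝ) :
    f.iterDeriv k (x : UnitAddCircle) = iteratedDeriv k f.lift x := by
  have hp := f.periodic_iteratedDeriv_lift hk
  have hx : ((Int.fract x : ℝ) : UnitAddCircle) = (x : UnitAddCircle) := by
    have : x = Int.fract x + (⌊x⌋ : ℤ) • (1 : ℝ) := by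
      simp [Int.fract_add_floor]
    conv_rhs => rw [this]
    rw [AddCircle.coe_add, AddCircle.coe_zsmul, AddCircle.coe_period, smul_zero, add_zero]
  rw [← hx, iterDeriv, AddCircle.liftIco_coe_apply
    ⟨Int.fract_nonneg x, by simpa using Int.fract_lt_one x⟩]
  rw [← hp.sub_zsmul_eq (x := x) ⌊x⌋, zsmul_eq_mul, mul_one, Int.self_sub_floor]

theorem continuous_iterDeriv (f : CrMap r) {k : ℕ} (hk : 1 ≤ k) (hkr : (k : ℕ∞) ≤ r) :
    Continuous (f.iterDeriv k) := by
  have h : Continuous (f.iterDeriv k ∘ ((↑) : ℝ → UnitAddCircle)) := by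
    have h' : f.iterDeriv k ∘ ((↑) : ℝ → UnitAddCircle) = iteratedDeriv k f.lift :=
      funext fun x => f.iterDeriv_coe hk x
    rw [h']
    exact f.contDiff_lift.continuous_iteratedDeriv k (by exact_mod_cast hkr)
  exact (QuotientAddGroup.isQuotientMap_mk (N := AddSubgroup.zmultiples (1 : ℝ))).continuous_iff.2 h

/-- The map itself together with all its derivatives up to order `r`. -/
def jet (f : CrMap r) :
    C(UnitAddCircle, UnitAddCircle) ×
      ({k : ℕ // 1 ≤ k ∧ (k : ℕ∞) ≤ r} → C(UnitAddCircle, ℝ)) :=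
  (⟨f, f.isCr.continuous⟩, fun k => ⟨f.iterDeriv k, f.continuous_iterDeriv k.2.1 k.2.2⟩)

/-- The `C^r` topology: uniform convergence of the maps and of all derivatives up to order `r`
(of all derivatives, if `r = ∞`). -/
instance : TopologicalSpace (CrMap r) := TopologicalSpace.induced jet inferInstance

instance : MeasurableSpace (CrMap r) := borel _

instance : BorelSpace (CrMap r) := ⟨rfl⟩

/-- `‖f‖_{C²} = sup_x max {|f'(x)|, |f''(x)|}`. -/
def c2Norm (f : CrMap r) : ℝ :=
  ⨆ x : UnitAddCircle, max |f.iterDeriv 1 x| |f.iterDeriv 2 x|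

/-- The identity of the circle. -/
protected def id (r : ℕ∞) : CrMap r := ⟨fun x => x, fun x => x, contDiff_id, fun _ => rfl⟩

/-- Composition `g ∘ f`. -/
def comp (g f : CrMap r) : CrMap r :=
  ⟨fun x => g (f x), fun x => g.lift (f.lift x), g.contDiff_lift.comp f.contDiff_lift,
    fun x => by rw [g.coe_lift, f.coe_lift]⟩

end CrMap

/-- The space `E^r(S¹)` of `C^r` expanding maps, `|f'(x)| > 1` for all `x`, with the (subspace)
`C^r` topology and its Borel `σ`-algebra. -/
abbrev Expanding (r : ℕ∞) : Type :=
  {f : CrMap r // ∀ x : UnitAddCircle, 1 < |f.iterDeriv 1 x|}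

/-- A diffeomorphism of the circle of class `C^r` (with inverse of class `C^r`). -/
structure CrDiffeo (r : ℕ∞) extends UnitAddCircle ≃ₜ UnitAddCircle where
  isCr : IsCr r toHomeomorph
  isCr_symm : IsCr r toHomeomorph.symm

variable {r : ℕ∞}

/-- The random composition `f_ω^n = f_{ω_{n-1}} ∘ ⋯ ∘ f_{ω_0}`. -/
def randomIterate (ω : ℕ → Expanding r) : ℕ → CrMap r
  | 0 => CrMap.id r
  | n + 1 => (ω n).1.comp (randomIterate ω n)

/-- `μ` is a `ν`-stationary Borel probability measure: `μ = ∫ f_* μ dν(f)`. -/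
structure IsStationary (ν : Measure (Expanding r)) (μ : Measure UnitAddCircle) : Prop where
  isProbabilityMeasure : IsProbabilityMeasure μ
  lintegral_preimage : ∀ A : Set UnitAddCircle, MeasurableSet A →
    ∫⁻ f, μ (f.1 ⁻¹' A) ∂ν = μ A

/-- `μ` is a stationary SRB measure: it is `ν`-stationary and absolutely continuous with respect to
arc length. -/
structure IsStationarySRB (ν : Measure (Expanding r)) (μ : Measure UnitAddCircle) : Prop
    extends IsStationary ν μ where
  absolutelyContinuous : μ ≪ volume

/-- `l` is the Lyapunov exponent of the random walk driven by `ν` with respect to `μ`: for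
`ν^ℕ × μ`-almost every `(ω, x)`, `(1/n) log |(f_ω^n)'(x)| → l`. -/
def IsLyapunovExponent (ν : Measure (Expanding r)) (μ : Measure UnitAddCircle) (l : ℝ) : Prop :=
  ∀ᵐ p : (ℕ → Expanding r) × UnitAddCircle ∂((Measure.infinitePi fun _ : ℕ => ν).prod μ),
    Tendsto (fun n : ℕ => (1 / (n : ℝ)) * Real.log |(randomIterate p.1 n).iterDeriv 1 p.2|)
      atTop (𝓝 l)

/-- `h` conjugates `f` to an affine map: `h ∘ f ∘ h⁻¹ (x) = deg(f) x + ρ` for some `ρ ∈ S¹`. -/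
def ConjugatesToAffine (h : CrDiffeo r) (f : CrMap r) : Prop :=
  ∃ ρ : UnitAddCircle, ∀ x : UnitAddCircle,
    h.toHomeomorph (f (h.toHomeomorph.symm x)) = f.degree • x + ρ

end RandomCircle

end

open RandomCircle

set_option linter.unusedSectionVars false

/-! The argument has three layers.

Loss of memory. If a positive density has an `a`-Lipschitz logarithm, its image under the transfer
operator of `f` has a logarithm with Lipschitz constant at most `a / min|f'| + ‖f‖_{C²}`
(`Expanding.exists_transfer`). Under random composition the constant therefore follows a random
affine recursion `a ↦ κ a + K` with `κ < 1` and with `log κ` and `log K` integrable. The law of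
large numbers keeps such a recursion tight, with an asymptotic bound independent of the starting
value. Two densities with the same constant `a` are both at least `exp (-a)`. Half of this common
part can be cancelled, and the normalised remainders have constant `2 a`. Because the constant
returns to a fixed bounded range with probability at least one half, this cancellation recurs, and
the distance between the two laws, tested against all measurable functions bounded by `1`, tends to
`0` (`limsup_coneGap_eq_zero`). Consequently the laws started from Lebesgue measure are Cauchy in
total variation, which gives existence, and every integrable function of mean zero is contracted to
zero. That decay gives uniqueness and the ergodicity of the skew product; Birkhoff's theorem then
identifies the exponent as `∫∫ log|f'| dμ dν`.

The inequality. With `ρ` the density of `μ`, put `w(f, y) = |f'(y)| ρ(f y) / (|deg f| ρ(y))`. Since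
`f` covers the circle `|deg f|` times, `∫∫ w dμ dν ≤ 1`, and so `∫∫ log w ≤ ∫∫ (w - 1) ≤ 0`. The
terms `log ρ(f y) - log ρ(y)` form a coboundary over a measure-preserving system and integrate to
`0`; `log ρ` need not be known integrable, because a coboundary with an integrable upper bound is
integrable with mean zero. Hence `∫∫ log w` is the exponent minus the mean logarithm of the degree.

Equality. It forces `w = 1`, that is `|f'| · ρ ∘ f = |deg f| · ρ` for almost every `f`. A single
such `f` preserves `μ`, so `ρ` is the limit of the images of Lebesgue measure under `f^n` and is
log-Lipschitz, in particular positive. On the line, `log ρ` then solves `u = v + u ∘ G` with `G` the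
contracting inverse of a lift, and differentiating this equation repeatedly shows that `u` loses
only one derivative with respect to `f`. The primitive of `ρ` is a `C^r` diffeomorphism that makes
almost every map affine, and being conjugated to an affine map by a fixed diffeomorphism is a closed
condition, so the whole support is covered. Conversely, a conjugacy `h` makes `log|f'| - log|deg f|`
the coboundary of the bounded function `-log|h'|`. -/

noncomputable section

/-! ### Birkhoff's ergodic theorem, and coboundaries with an integrable upper bound. -/

section ErgodicTheory

variable {α : Type*} [MeasurableSpace α] {μ : Measure α} {T : α → α}

/-- The running maximum `max_{0 ≤ k ≤ n} ∑_{j < k} g (T^j x)` of the Birkhoff sums. -/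
def birkhoffMax (T : α → α) (g : α → ℝ) : ℕ → α → ℝ
  | 0 => fun _ => 0
  | n + 1 => fun x => max 0 (g x + birkhoffMax T g n (T x))

theorem birkhoffMax_nonneg (g : α → ℝ) (n : ℕ) (x : α) : 0 ≤ birkhoffMax T g n x := by
  cases n with
  | zero => exact le_rfl
  | succ n => exact le_max_left _ _

theorem birkhoffMax_le_succ (g : α → ℝ) (n : ℕ) (x : α) :
    birkhoffMax T g n x ≤ birkhoffMax T g (n + 1) x := by
  induction n generalizing x with
  | zero => exact birkhoffMax_nonneg _ _ _
  | succ n ih => exact max_le_max le_rfl (by have := ih (T x); linarith)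

theorem birkhoffSum_le_birkhoffMax (g : α → ℝ) (n : ℕ) (x : α) :
    birkhoffSum T g n x ≤ birkhoffMax T g n x := by
  induction n generalizing x with
  | zero => simp [birkhoffMax]
  | succ n ih =>
    rw [birkhoffSum_succ']
    exact le_trans (by have := ih (T x); linarith) (le_max_right _ _)

theorem measurable_birkhoffMax {g : α → ℝ} (hT : Measurable T) (hg : Measurable g) (n : ℕ) :
    Measurable (birkhoffMax T g n) := by
  induction n with
  | zero => exact measurable_const
  | succ n ih => exact measurable_const.max (hg.add (ih.comp hT))

theorem integrable_birkhoffMax {g : α → ℝ} (hT : MeasurePreserving T μ μ)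
    (hg : Integrable g μ) (n : ℕ) : Integrable (birkhoffMax T g n) μ := by
  induction n with
  | zero => exact integrable_zero _ _ _
  | succ n ih =>
    exact (integrable_zero _ _ _).sup (hg.add (hT.integrable_comp_of_integrable ih))

/-- By the recursion, a bound for the maxima at `T x` yields one at `x` and conversely. The set is
strictly invariant, so ergodicity leaves only measure zero or full measure. -/
theorem preimage_unbounded_birkhoffMax (g : α → ℝ) :
    T ⁻¹' {x | ¬ BddAbove (Set.range fun n => birkhoffMax T g n x)} =
      {x | ¬ BddAbove (Set.range fun n => birkhoffMax T g n x)} := by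
  ext x
  refine not_congr ⟨?_, ?_⟩
  · rintro ⟨C, hC⟩
    have hC' : ∀ n, birkhoffMax T g n (T x) ≤ C := fun n => hC ⟨n, rfl⟩
    refine ⟨max 0 (g x + C), ?_⟩
    rintro _ ⟨n, rfl⟩
    cases n with
    | zero => exact le_max_left _ _
    | succ n => exact max_le_max le_rfl (by have := hC' n; linarith)
  · rintro ⟨C, hC⟩
    have hC' : ∀ n, birkhoffMax T g n x ≤ C := fun n => hC ⟨n, rfl⟩
    refine ⟨C - g x, ?_⟩
    rintro _ ⟨n, rfl⟩
    have := (le_max_right 0 (g x + birkhoffMax T g n (T x))).trans (hC' (n + 1))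
    show birkhoffMax T g n (T x) ≤ _
    linarith

/-- If `∫ g < 0`, the Birkhoff sums of `g` are almost surely bounded above. -/
theorem Ergodic.ae_bddAbove_birkhoffMax (hT : Ergodic T μ) {g : α → ℝ} (hgm : Measurable g)
    (hg : Integrable g μ) (hneg : ∫ x, g x ∂μ < 0) :
    ∀ᵐ x ∂μ, BddAbove (Set.range fun n => birkhoffMax T g n x) := by
  have hmeas : MeasurableSet {x | ¬ BddAbove (Set.range fun n => birkhoffMax T g n x)} :=
    (measurableSet_bddAbove_range
      (fun n => measurable_birkhoffMax hT.measurable hgm n)).compl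
  rcases hT.toPreErgodic.ae_mem_or_ae_notMem hmeas (preimage_unbounded_birkhoffMax g) with h | h
  · exfalso
    have hMT : ∀ n, Integrable (fun x => birkhoffMax T g n (T x)) μ := fun n =>
      hT.toMeasurePreserving.integrable_comp_of_integrable
        (integrable_birkhoffMax hT.toMeasurePreserving hg n)
    -- If the maxima were unbounded almost everywhere, `M (n+1) - M n ∘ T` would converge to `g`,
    -- dominated by `|g|`. Its integrals are nonnegative because `M n` increases and `T` preserves
    -- `μ`, contradicting `∫ g < 0`.
    have hnn : ∀ n, 0 ≤ ∫ x, birkhoffMax T g (n + 1) x - birkhoffMax T g n (T x) ∂μ := by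
      intro n
      rw [integral_sub (integrable_birkhoffMax hT.toMeasurePreserving hg _) (hMT n)]
      have h1 : ∫ x, birkhoffMax T g n (T x) ∂μ = ∫ x, birkhoffMax T g n x ∂μ := by
        rw [← integral_map hT.measurable.aemeasurable, hT.map_eq]
        rw [hT.map_eq]
        exact (measurable_birkhoffMax hT.measurable hgm n).aestronglyMeasurable
      rw [h1, sub_nonneg]
      exact integral_mono (integrable_birkhoffMax hT.toMeasurePreserving hg _)
        (integrable_birkhoffMax hT.toMeasurePreserving hg _) (birkhoffMax_le_succ g n)
    have hlim : Tendsto (fun n => ∫ x, birkhoffMax T g (n + 1) x - birkhoffMax T g n (T x) ∂μ)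
        atTop (𝓝 (∫ x, g x ∂μ)) := by
      refine tendsto_integral_of_dominated_convergence (fun x => |g x|)
        (fun n => ((integrable_birkhoffMax hT.toMeasurePreserving hg _).sub
          (hMT n)).aestronglyMeasurable) hg.abs (fun n => ae_of_all _ fun x => ?_) ?_
      · have h0 := birkhoffMax_nonneg (T := T) g n (T x)
        rw [Real.norm_eq_abs]
        simp only [birkhoffMax]
        rcases max_cases 0 (g x + birkhoffMax T g n (T x)) with ⟨h1, h2⟩ | ⟨h1, h2⟩ <;> rw [h1]
        · rw [zero_sub, abs_neg, abs_of_nonneg h0]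
          have := neg_abs_le (g x)
          linarith
        · simp
      · filter_upwards [h] with x hx
        have hx' : ¬ BddAbove (Set.range fun n => birkhoffMax T g n (T x)) := by
          exact (Set.ext_iff.1 (preimage_unbounded_birkhoffMax (T := T) g) x).2 hx
        obtain ⟨N, hN⟩ : ∃ N, -g x < birkhoffMax T g N (T x) := by
          by_contra! hc
          exact hx' ⟨_, by rintro _ ⟨n, rfl⟩; exact hc n⟩
        refine tendsto_const_nhds.congr' ?_
        filter_upwards [eventually_ge_atTop N] with n hn
        have hmono := monotone_nat_of_le_succ (fun n => birkhoffMax_le_succ (T := T) g n (T x)) hn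
        simp only [birkhoffMax]
        rw [max_eq_right (by linarith)]
        ring
    have := ge_of_tendsto' hlim hnn
    linarith
  · filter_upwards [h] with x hx
    simpa using hx

theorem Ergodic.ae_eventually_birkhoffSum_le (hT : Ergodic T μ) [IsProbabilityMeasure μ]
    {g : α → ℝ} (hgm : Measurable g) (hg : Integrable g μ) {c : ℝ} (hc : ∫ x, g x ∂μ < c) :
    ∀ᵐ x ∂μ, ∃ C, ∀ n, birkhoffSum T g n x ≤ C + n * c := by
  have := hT.ae_bddAbove_birkhoffMax (g := fun x => g x - c) (hgm.sub_const c)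
    (hg.sub (integrable_const c)) (by
      rw [integral_sub hg (integrable_const c)]; simpa using hc)
  filter_upwards [this] with x ⟨C, hC⟩
  refine ⟨C, fun n => ?_⟩
  have h1 := (birkhoffSum_le_birkhoffMax (T := T) (fun x => g x - c) n x).trans (hC ⟨n, rfl⟩)
  have h2 : birkhoffSum T (fun x => g x - c) n x = birkhoffSum T g n x - n * c := by
    simp [birkhoffSum]
  linarith

theorem eventually_mul_inv_le_of_linear_bound {S : ℕ → ℝ} {C c ε : ℝ} (hε : 0 < ε)
    (h : ∀ n : ℕ, S n ≤ C + n * c) : ∀ᶠ n : ℕ in atTop, 1 / (n : ℝ) * S n ≤ c + ε := by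
  have h1 : Tendsto (fun n : ℕ => C / (n : ℝ)) atTop (𝓝 0) :=
    tendsto_const_div_atTop_nhds_zero_nat C
  filter_upwards [h1.eventually_lt_const hε, eventually_gt_atTop 0] with n hn hn0
  have hn0' : (0 : ℝ) < n := by exact_mod_cast hn0
  calc 1 / (n : ℝ) * S n ≤ 1 / (n : ℝ) * (C + n * c) := by gcongr; exact h n
    _ = C / n + c := by field_simp
    _ ≤ c + ε := by linarith

/-- **Birkhoff's pointwise ergodic theorem** for an ergodic transformation of a probability
space. -/
theorem Ergodic.ae_tendsto_birkhoffAverage (hT : Ergodic T μ) [IsProbabilityMeasure μ]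
    {g : α → ℝ} (hgm : Measurable g) (hg : Integrable g μ) :
    ∀ᵐ x ∂μ, Tendsto (fun n : ℕ => 1 / (n : ℝ) * birkhoffSum T g n x) atTop
      (𝓝 (∫ x, g x ∂μ)) := by
  set I := ∫ x, g x ∂μ with hI
  have hup : ∀ᵐ x ∂μ, ∀ k : ℕ, ∃ C, ∀ n, birkhoffSum T g n x ≤ C + n * (I + 1 / (k + 1 : ℝ)) :=
    ae_all_iff.2 fun k => hT.ae_eventually_birkhoffSum_le hgm hg
      (lt_add_of_pos_right _ Nat.one_div_pos_of_nat)
  have hlo : ∀ᵐ x ∂μ, ∀ k : ℕ, ∃ C, ∀ n,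
      birkhoffSum T (-g) n x ≤ C + n * (-I + 1 / (k + 1 : ℝ)) :=
    ae_all_iff.2 fun k => hT.ae_eventually_birkhoffSum_le hgm.neg hg.neg (by
      simp only [Pi.neg_apply, integral_neg]
      exact lt_add_of_pos_right _ Nat.one_div_pos_of_nat)
  filter_upwards [hup, hlo] with x h1 h2
  rw [Metric.tendsto_nhds]
  intro ε hε
  obtain ⟨k, hk⟩ := exists_nat_one_div_lt (half_pos hε)
  obtain ⟨C1, hC1⟩ := h1 k
  obtain ⟨C2, hC2⟩ := h2 k
  filter_upwards [eventually_mul_inv_le_of_linear_bound (ε := ε / 4) (by linarith) hC1,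
    eventually_mul_inv_le_of_linear_bound (ε := ε / 4) (by linarith) hC2] with n a1 a2
  rw [birkhoffSum_neg, mul_neg] at a2
  rw [Real.dist_eq, abs_lt]
  constructor <;> linarith

/-- A measurable coboundary `u ∘ T - u` bounded above by an integrable function is integrable with
integral zero. -/
theorem MeasureTheory.MeasurePreserving.integral_coboundary_eq_zero [IsFiniteMeasure μ]
    (hT : MeasurePreserving T μ μ) {u w : α → ℝ} (hu : Measurable u) (hw : Integrable w μ)
    (hle : ∀ᵐ x ∂μ, u (T x) - u x ≤ w x) :
    Integrable (fun x => u (T x) - u x) μ ∧ ∫ x, (u (T x) - u x) ∂μ = 0 := by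
  -- `u` may fail to be integrable, so it is truncated to `[-M, M]`. The truncated coboundary has
  -- mean zero, and truncation, being monotone and `1`-Lipschitz, keeps the sign of the increments
  -- and does not enlarge them.
  let c : ℕ → α → ℝ := fun M x => max (-(M : ℝ)) (min (M : ℝ) (u x))
  have hcm : ∀ M, Measurable (c M) := fun M => measurable_const.max (measurable_const.min hu)
  have hcb : ∀ M x, |c M x| ≤ M := fun M x => by
    have : (0 : ℝ) ≤ M := Nat.cast_nonneg M
    rw [abs_le]
    exact ⟨le_max_left _ _, max_le (by linarith) (min_le_left _ _)⟩
  have hci : ∀ M, Integrable (c M) μ := fun M =>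
    Integrable.of_bound (hcm M).aestronglyMeasurable (M : ℝ) (ae_of_all _ fun x => hcb M x)
  have hciT : ∀ M, Integrable (fun x => c M (T x)) μ := fun M =>
    hT.integrable_comp_of_integrable (hci M)
  have hdm : ∀ M, Measurable fun x => c M (T x) - c M x := fun M =>
    ((hcm M).comp hT.measurable).sub (hcm M)
  have hint : ∀ M, ∫ x, (c M (T x) - c M x) ∂μ = 0 := fun M => by
    rw [integral_sub (hciT M) (hci M), ← integral_map hT.measurable.aemeasurable, hT.map_eq,
      sub_self]
    rw [hT.map_eq]
    exact (hcm M).aestronglyMeasurable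
  have habs : ∀ M x, |c M (T x) - c M x| ≤ |u (T x) - u x| := fun M x => by
    have h1 := abs_max_sub_max_le_max (-(M : ℝ)) (min (M : ℝ) (u (T x))) (-(M : ℝ))
      (min (M : ℝ) (u x))
    have h2 := abs_min_sub_min_le_max (M : ℝ) (u (T x)) (M : ℝ) (u x)
    simp only [sub_self, abs_zero, abs_nonneg, sup_of_le_right] at h1 h2
    exact h1.trans h2
  have hsgn : ∀ M x, 0 < c M (T x) - c M x → c M (T x) - c M x ≤ u (T x) - u x := fun M x h => by
    have h1 : u x < u (T x) := by
      by_contra! hc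
      have : c M (T x) ≤ c M x := max_le_max le_rfl (min_le_min le_rfl hc)
      linarith
    have := habs M x
    rwa [abs_of_pos h, abs_of_pos (by linarith)] at this
  have hlim : ∀ x, Tendsto (fun M => c M (T x) - c M x) atTop (𝓝 (u (T x) - u x)) := by
    have key : ∀ x, Tendsto (fun M => c M x) atTop (𝓝 (u x)) := fun x => by
      refine tendsto_const_nhds.congr' ?_
      obtain ⟨N, hN⟩ := exists_nat_ge |u x|
      filter_upwards [eventually_ge_atTop N] with M hM
      have : |u x| ≤ M := hN.trans (by exact_mod_cast hM)
      have := abs_le.1 this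
      simp only [c]
      rw [min_eq_right this.2, max_eq_right this.1]
    exact fun x => (key (T x)).sub (key x)
  have hL1 : ∀ M, ∫⁻ x, ‖c M (T x) - c M x‖ₑ ∂μ ≤ ENNReal.ofReal (2 * ∫ x, |w x| ∂μ) := by
    intro M
    have hi : Integrable (fun x => c M (T x) - c M x) μ := (hciT M).sub (hci M)
    have : ∫⁻ x, ‖c M (T x) - c M x‖ₑ ∂μ = ENNReal.ofReal (∫ x, |c M (T x) - c M x| ∂μ) :=
      (ofReal_integral_norm_eq_lintegral_enorm hi).symm
    rw [this]
    refine ENNReal.ofReal_le_ofReal ?_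
    -- With `d` the truncated coboundary, `d ≤ |w|` where `d > 0` gives `|d| ≤ 2|w| - d` everywhere.
    -- Since `∫ d = 0`, this bounds the `L¹` norm uniformly in `M`, and Fatou passes the bound to
    -- the limit.
    have h1 : ∫ x, |c M (T x) - c M x| ∂μ ≤ ∫ x, (2 * |w x| - (c M (T x) - c M x)) ∂μ := by
      refine integral_mono_ae hi.abs ((hw.abs.const_mul 2).sub hi) ?_
      filter_upwards [hle] with x hx
      rcases le_or_gt (c M (T x) - c M x) 0 with h | h
      · rw [abs_of_nonpos h]
        have := abs_nonneg (w x)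
        linarith
      · rw [abs_of_pos h]
        have := hsgn M x h
        have := le_abs_self (w x)
        linarith
    rw [integral_sub (hw.abs.const_mul 2) hi, hint M, integral_const_mul] at h1
    linarith
  have hD : Integrable (fun x => u (T x) - u x) μ := by
    refine ⟨((hu.comp hT.measurable).sub hu).aestronglyMeasurable, ?_⟩
    have hF : ∫⁻ x, ‖u (T x) - u x‖ₑ ∂μ ≤ ENNReal.ofReal (2 * ∫ x, |w x| ∂μ) := by
      calc ∫⁻ x, ‖u (T x) - u x‖ₑ ∂μ
          = ∫⁻ x, liminf (fun M => ‖c M (T x) - c M x‖ₑ) atTop ∂μ := by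
            refine lintegral_congr fun x => ?_
            exact ((hlim x).enorm.liminf_eq).symm
        _ ≤ liminf (fun M => ∫⁻ x, ‖c M (T x) - c M x‖ₑ ∂μ) atTop :=
            lintegral_liminf_le fun M => (hdm M).enorm
        _ ≤ _ := by
            refine (liminf_le_liminf (Eventually.of_forall hL1)).trans ?_
            simp
    exact hF.trans_lt ENNReal.ofReal_lt_top
  refine ⟨hD, ?_⟩
  have := tendsto_integral_of_dominated_convergence (fun x => |u (T x) - u x|)
    (fun M => (hdm M).aestronglyMeasurable) hD.abs
    (fun M => ae_of_all _ fun x => habs M x) (ae_of_all μ hlim)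
  simp only [hint] at this
  exact tendsto_nhds_unique this tendsto_const_nhds |>.symm ▸ rfl

end ErgodicTheory

/-! ### Splitting off the first letter of an i.i.d. sequence. -/

section InfiniteProduct

variable {X : Type*} [MeasurableSpace X]

/-- Prepend a letter to a sequence. -/
def consSeq (f : X) (ω : ℕ → X) : ℕ → X
  | 0 => f
  | n + 1 => ω n

@[simp] theorem consSeq_zero (f : X) (ω : ℕ → X) : consSeq f ω 0 = f := rfl

@[simp] theorem consSeq_succ (f : X) (ω : ℕ → X) (n : ℕ) : consSeq f ω (n + 1) = ω n := rfl

theorem measurable_consSeq : Measurable fun p : X × (ℕ → X) => consSeq p.1 p.2 := by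
  refine measurable_pi_lambda _ fun n => ?_
  cases n with
  | zero => exact measurable_fst
  | succ n => exact (measurable_pi_apply n).comp measurable_snd

/-- The law of an i.i.d. sequence is that of an independent letter followed by an i.i.d.
sequence. -/
theorem measurePreserving_consSeq (ν : Measure X) [IsProbabilityMeasure ν] :
    MeasurePreserving (fun p : X × (ℕ → X) => consSeq p.1 p.2)
      (ν.prod (Measure.infinitePi fun _ : ℕ => ν)) (Measure.infinitePi fun _ : ℕ => ν) := by
  refine ⟨measurable_consSeq, Measure.eq_infinitePi _ fun s t ht => ?_⟩
  classical
  rw [Measure.map_apply measurable_consSeq (MeasurableSet.pi s.countable_toSet fun i _ => ht i)]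
  -- A box over the coordinates `s` pulls back to a rectangle: the condition at coordinate `0`, if
  -- any, concerns the new letter, and all other coordinates move down by one.
  let t0 : Set X := if 0 ∈ s then t 0 else Set.univ
  let s' : Finset ℕ := (s.erase 0).image Nat.pred
  have hset : (fun p : X × (ℕ → X) => consSeq p.1 p.2) ⁻¹' (s : Set ℕ).pi t =
      t0 ×ˢ (s' : Set ℕ).pi fun i => t (i + 1) := by
    ext ⟨f, ω⟩
    simp only [Set.mem_preimage, Set.mem_pi, Set.mem_prod, Finset.mem_coe, s', t0]
    constructor
    · intro h
      refine ⟨?_, ?_⟩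
      · split_ifs with h0
        · exact h 0 h0
        · trivial
      · intro i hi
        obtain ⟨j, hj, rfl⟩ := Finset.mem_image.1 hi
        obtain ⟨hj0, hjs⟩ := Finset.mem_erase.1 hj
        obtain ⟨k, rfl⟩ := Nat.exists_eq_succ_of_ne_zero hj0
        exact h (k + 1) hjs
    · rintro ⟨h0, h1⟩ i hi
      cases i with
      | zero => simpa [hi] using h0
      | succ k => exact h1 k (Finset.mem_image.2 ⟨k + 1, Finset.mem_erase.2 ⟨by simp, hi⟩, rfl⟩)
  rw [hset, Measure.prod_prod, Measure.infinitePi_pi _ (fun i _ => ht (i + 1))]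
  have himg : ∏ i ∈ s', ν (t (i + 1)) = ∏ i ∈ s.erase 0, ν (t i) := by
    rw [Finset.prod_image]
    · refine Finset.prod_congr rfl fun i hi => ?_
      have : i ≠ 0 := (Finset.mem_erase.1 hi).1
      rw [Nat.pred_eq_sub_one, Nat.sub_add_cancel (Nat.one_le_iff_ne_zero.2 this)]
    · intro i hi j hj hij
      have hi0 : i ≠ 0 := (Finset.mem_erase.1 (Finset.mem_coe.1 hi)).1
      have hj0 : j ≠ 0 := (Finset.mem_erase.1 (Finset.mem_coe.1 hj)).1
      simp only [Nat.pred_eq_sub_one] at hij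
      omega
  rw [himg]
  by_cases h0 : 0 ∈ s
  · simp only [t0, h0, if_true]
    exact Finset.mul_prod_erase s (fun i => ν (t i)) h0
  · simp [t0, h0]

theorem lintegral_infinitePi_cons (ν : Measure X) [IsProbabilityMeasure ν]
    {F : (ℕ → X) → ℝ≥0∞} (hF : Measurable F) :
    ∫⁻ ω, F ω ∂(Measure.infinitePi fun _ : ℕ => ν) =
      ∫⁻ f, ∫⁻ ω, F (consSeq f ω) ∂(Measure.infinitePi fun _ : ℕ => ν) ∂ν := by
  rw [← (measurePreserving_consSeq ν).lintegral_comp hF]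
  exact lintegral_prod _ (hF.comp measurable_consSeq).aemeasurable

end InfiniteProduct

end

noncomputable section

/-! ### Tightness of random affine recursions with logarithmic moments. -/

section Perpetuity

variable {X : Type*}

/-- The value at `a` of the composition `A_{ω_0} ∘ ⋯ ∘ A_{ω_{m-1}}` of the random affine maps
`A_x(a) = κ(x) a + K(x)`. -/
def perpetuity (κ K : X → ℝ) : ℕ → (ℕ → X) → ℝ → ℝ
  | 0 => fun _ a => a
  | m + 1 => fun ω a => κ (ω 0) * perpetuity κ K m (fun i => ω (i + 1)) a + K (ω 0)

/-- With the newest letter innermost, the value at `0` is a partial sum of one fixed series, so it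
can converge pathwise. The opposite order of composition, which describes the actual evolution, has
the same law for each `m` but need not converge. -/
theorem perpetuity_eq_sum (κ K : X → ℝ) (m : ℕ) (ω : ℕ → X) (a : ℝ) :
    perpetuity κ K m ω a = ∑ k ∈ Finset.range m, K (ω k) * ∏ i ∈ Finset.range k, κ (ω i) +
      a * ∏ i ∈ Finset.range m, κ (ω i) := by
  induction m generalizing ω with
  | zero => simp [perpetuity]
  | succ m ih =>
    simp only [perpetuity]
    rw [ih, Finset.sum_range_succ', Finset.prod_range_succ']
    simp only [Finset.prod_range_succ', Finset.prod_range_zero, mul_one]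
    rw [mul_add, Finset.mul_sum]
    have : ∀ k, κ (ω 0) * (K (ω (k + 1)) * ∏ i ∈ Finset.range k, κ (ω (i + 1))) =
      K (ω (k + 1)) * ((∏ i ∈ Finset.range k, κ (ω (i + 1))) * κ (ω 0)) := fun k => by ring
    simp only [this]
    ring

theorem measurable_perpetuity [MeasurableSpace X] {κ K : X → ℝ} (hκ : Measurable κ)
    (hK : Measurable K) (m : ℕ) (a : ℝ) : Measurable fun ω => perpetuity κ K m ω a := by
  simp only [perpetuity_eq_sum]
  fun_prop

variable [MeasurableSpace X] (ν : Measure X) [IsProbabilityMeasure ν]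

theorem ae_tendsto_average_infinitePi {g : X → ℝ} (hg : Measurable g) (hi : Integrable g ν) :
    ∀ᵐ ω ∂(Measure.infinitePi fun _ : ℕ => ν),
      Tendsto (fun n : ℕ => (∑ i ∈ Finset.range n, g (ω i)) / n) atTop (𝓝 (∫ x, g x ∂ν)) := by
  have hmp : ∀ i : ℕ, MeasurePreserving (fun ω : ℕ → X => ω i)
      (Measure.infinitePi fun _ : ℕ => ν) ν :=
    fun i => measurePreserving_eval_infinitePi (fun _ : ℕ => ν) i
  have hident : ∀ i : ℕ, ProbabilityTheory.IdentDistrib (fun ω : ℕ → X => g (ω i))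
      (fun ω : ℕ → X => g (ω 0)) (Measure.infinitePi fun _ : ℕ => ν)
      (Measure.infinitePi fun _ : ℕ => ν) := fun i => by
    refine ⟨(hg.comp (measurable_pi_apply i)).aemeasurable,
      (hg.comp (measurable_pi_apply 0)).aemeasurable, ?_⟩
    have : ∀ j : ℕ, (Measure.infinitePi fun _ : ℕ => ν).map (fun ω => g (ω j)) = ν.map g :=
      fun j => by
        rw [← (hmp j).map_eq, Measure.map_map hg (measurable_pi_apply j)]
        rw [(hmp j).map_eq]
        rfl
    rw [this, this]
  have h := ProbabilityTheory.strong_law_ae_real (μ := Measure.infinitePi fun _ : ℕ => ν)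
    (fun i ω => g (ω i)) ((hmp 0).integrable_comp_of_integrable hi)
    (fun i j hij => (ProbabilityTheory.iIndepFun_infinitePi (P := fun _ : ℕ => ν)
      (X := fun _ => g) (fun _ => hg)).indepFun hij) hident
  have h0 : ∫ ω : ℕ → X, g (ω 0) ∂(Measure.infinitePi fun _ : ℕ => ν) = ∫ x, g x ∂ν := by
    rw [← integral_map (φ := fun ω : ℕ → X => ω 0) (measurable_pi_apply 0).aemeasurable
      hg.aestronglyMeasurable, (hmp 0).map_eq]
  rwa [h0] at h

/-- A term is the difference of two consecutive partial sums, and both averages have the same limit.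
Applied to `log K (ω n)`, this shows that `K (ω n)` grows subexponentially. -/
theorem tendsto_div_of_tendsto_average {x : ℕ → ℝ} {l : ℝ}
    (h : Tendsto (fun n : ℕ => (∑ i ∈ Finset.range n, x i) / n) atTop (𝓝 l)) :
    Tendsto (fun n : ℕ => x n / n) atTop (𝓝 0) := by
  have h1 : Tendsto (fun n : ℕ => ((n + 1 : ℕ) : ℝ) / n) atTop (𝓝 1) := by
    have := (tendsto_const_div_atTop_nhds_zero_nat (1 : ℝ)).const_add 1
    rw [add_zero] at this
    refine this.congr' ?_
    filter_upwards [eventually_gt_atTop 0] with n hn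
    have : (n : ℝ) ≠ 0 := by exact_mod_cast hn.ne'
    push_cast
    field_simp
  have h2 := (((tendsto_add_atTop_iff_nat 1).2 h).mul h1).sub h
  rw [mul_one, sub_self] at h2
  refine h2.congr' ?_
  filter_upwards [eventually_gt_atTop 0] with n hn
  have : (n : ℝ) ≠ 0 := by exact_mod_cast hn.ne'
  have h3 : ((n + 1 : ℕ) : ℝ) ≠ 0 := by positivity
  rw [div_mul_div_cancel₀ h3, Finset.sum_range_succ, ← sub_div]
  congr 1
  ring

variable {ν} {κ K : X → ℝ}

theorem eventually_prod_le_exp {κ : ℕ → ℝ} (hκ0 : ∀ i, 0 < κ i) {L : ℝ} (hL : 0 < L)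
    (h : Tendsto (fun n : ℕ => (∑ i ∈ Finset.range n, Real.log (κ i)) / n) atTop (𝓝 (-L))) :
    ∀ᶠ n : ℕ in atTop, ∏ i ∈ Finset.range n, κ i ≤ Real.exp (-(L / 2) * n) := by
  filter_upwards [h.eventually_lt_const (show -L < -(L / 2) by linarith),
    eventually_gt_atTop 0] with n hn hn0
  have hn' : (0 : ℝ) < n := by exact_mod_cast hn0
  rw [div_lt_iff₀ hn', ← Real.log_prod (fun i _ => (hκ0 i).ne')] at hn
  rw [← Real.log_le_iff_le_exp (Finset.prod_pos fun i _ => hκ0 i)]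
  exact hn.le

theorem integral_log_neg (hκ0 : ∀ x, 0 < κ x) (hκ1 : ∀ x, κ x < 1)
    (hiκ : Integrable (fun x => Real.log (κ x)) ν) : ∫ x, Real.log (κ x) ∂ν < 0 := by
  have hneg : ∀ x, Real.log (κ x) < 0 := fun x => Real.log_neg (hκ0 x) (hκ1 x)
  have h : 0 < ∫ x, -Real.log (κ x) ∂ν := by
    have hi : Integrable (fun x => -Real.log (κ x)) ν := hiκ.neg
    rw [integral_pos_iff_support_of_nonneg (fun x => by simpa using (hneg x).le) hi]
    have : Function.support (fun x => -Real.log (κ x)) = Set.univ := by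
      ext x
      simpa using (hneg x).ne
    rw [this]
    simp
  rw [integral_neg] at h
  linarith

/-- With `-L` the mean of `log κ`, the products eventually lie below `exp (-L n / 2)` while `K (ω
n)` eventually lies below `exp (L n / 4)`. The series is thus dominated by a geometric one, and
logarithmic moments are enough. -/
theorem ae_perpetuity (hκ : Measurable κ) (hK : Measurable K) (hκ0 : ∀ x, 0 < κ x)
    (hκ1 : ∀ x, κ x < 1) (hK0 : ∀ x, 0 < K x)
    (hiκ : Integrable (fun x => Real.log (κ x)) ν) (hiK : Integrable (fun x => Real.log (K x)) ν) :
    ∀ᵐ ω ∂(Measure.infinitePi fun _ : ℕ => ν),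
      Tendsto (fun m => ∏ i ∈ Finset.range m, κ (ω i)) atTop (𝓝 0) ∧
        ∃ C : ℝ, ∀ m, perpetuity κ K m ω 0 ≤ C := by
  have hneg := integral_log_neg hκ0 hκ1 hiκ
  set L := -∫ x, Real.log (κ x) ∂ν with hL
  have hL0 : 0 < L := by linarith
  filter_upwards [ae_tendsto_average_infinitePi ν (Real.measurable_log.comp hκ) hiκ,
    ae_tendsto_average_infinitePi ν (Real.measurable_log.comp hK) hiK] with ω h1 h2
  have h1' := eventually_prod_le_exp (κ := fun i => κ (ω i)) (fun i => hκ0 _) hL0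
    (by simpa [hL] using h1)
  have h2' : ∀ᶠ n : ℕ in atTop, K (ω n) ≤ Real.exp (L / 4 * n) := by
    filter_upwards [(tendsto_div_of_tendsto_average h2).eventually_lt_const
      (show (0 : ℝ) < L / 4 by linarith), eventually_gt_atTop 0] with n hn hn0
    have hn' : (0 : ℝ) < n := by exact_mod_cast hn0
    rw [div_lt_iff₀ hn'] at hn
    rw [← Real.log_le_iff_le_exp (hK0 _)]
    exact hn.le
  have hp0 : ∀ n, 0 ≤ ∏ i ∈ Finset.range n, κ (ω i) := fun n =>
    Finset.prod_nonneg fun i _ => (hκ0 _).le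
  have hgeo : ∀ c : ℝ, 0 < c → Summable fun n : ℕ => Real.exp (-c * n) := fun c hc => by
    have := Real.summable_exp_nat_mul_iff.2 (show -c < 0 by linarith)
    simpa [mul_comm] using this
  refine ⟨?_, ?_⟩
  · exact squeeze_zero' (Eventually.of_forall hp0) h1'
      (hgeo (L / 2) (by linarith)).tendsto_atTop_zero
  · have hs : Summable fun k => K (ω k) * ∏ i ∈ Finset.range k, κ (ω i) := by
      refine Summable.of_norm_bounded_eventually_nat (hgeo (L / 4) (by linarith)) ?_
      filter_upwards [h1', h2'] with n a1 a2
      rw [Real.norm_eq_abs, abs_of_nonneg (mul_nonneg (hK0 _).le (hp0 n))]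
      calc _ ≤ Real.exp (L / 4 * n) * Real.exp (-(L / 2) * n) := by
            gcongr
            exact hp0 n
        _ = _ := by rw [← Real.exp_add]; congr 1; ring
    refine ⟨∑' k, K (ω k) * ∏ i ∈ Finset.range k, κ (ω i), fun m => ?_⟩
    rw [perpetuity_eq_sum, zero_mul, add_zero]
    exact hs.sum_le_tsum _ fun k _ => mul_nonneg (hK0 _).le (hp0 k)

/-- The backward perpetuities started at `0` are uniformly tight. -/
theorem exists_forall_measure_perpetuity_le (hκ : Measurable κ) (hK : Measurable K)
    (hκ0 : ∀ x, 0 < κ x) (hκ1 : ∀ x, κ x < 1) (hK0 : ∀ x, 0 < K x)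
    (hiκ : Integrable (fun x => Real.log (κ x)) ν) (hiK : Integrable (fun x => Real.log (K x)) ν)
    {ε : ℝ≥0∞} (hε : 0 < ε) :
    ∃ M : ℝ, 0 ≤ M ∧
      (Measure.infinitePi fun _ : ℕ => ν) {ω | ∃ m, M < perpetuity κ K m ω 0} ≤ ε := by
  let s : ℕ → Set (ℕ → X) := fun N => {ω | ∃ m, (N : ℝ) < perpetuity κ K m ω 0}
  have hs : ∀ N, MeasurableSet (s N) := fun N => by
    have : s N = ⋃ m, {ω | (N : ℝ) < perpetuity κ K m ω 0} := by ext; simp [s]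
    rw [this]
    exact MeasurableSet.iUnion fun m =>
      measurableSet_lt measurable_const (measurable_perpetuity hκ hK m 0)
  have hanti : Antitone s := fun N N' h ω ⟨m, hm⟩ =>
    ⟨m, lt_of_le_of_lt (by exact_mod_cast h) hm⟩
  have hlim := tendsto_measure_iInter_atTop (μ := Measure.infinitePi fun _ : ℕ => ν)
    (fun N => (hs N).nullMeasurableSet) hanti ⟨0, measure_ne_top _ _⟩
  have h0 : (Measure.infinitePi fun _ : ℕ => ν) (⋂ N, s N) = 0 := by
    rw [measure_eq_zero_iff_ae_notMem]
    filter_upwards [ae_perpetuity hκ hK hκ0 hκ1 hK0 hiκ hiK] with ω ⟨_, C, hC⟩ hω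
    obtain ⟨N, hN⟩ := exists_nat_ge C
    obtain ⟨m, hm⟩ := Set.mem_iInter.1 hω N
    have := hC m
    linarith
  rw [h0] at hlim
  obtain ⟨N, hN⟩ := ((hlim.eventually_lt_const hε).and (eventually_ge_atTop 0)).exists
  exact ⟨N, Nat.cast_nonneg N, hN.1.le⟩

/-- The backward perpetuities are asymptotically tight, with a bound that does not depend on the
starting point. -/
theorem exists_eventually_measure_perpetuity_le (hκ : Measurable κ) (hK : Measurable K)
    (hκ0 : ∀ x, 0 < κ x) (hκ1 : ∀ x, κ x < 1) (hK0 : ∀ x, 0 < K x)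
    (hiκ : Integrable (fun x => Real.log (κ x)) ν) (hiK : Integrable (fun x => Real.log (K x)) ν)
    {ε : ℝ≥0∞} (hε : 0 < ε) :
    ∃ M : ℝ, 0 ≤ M ∧ ∀ a : ℝ, ∀ᶠ m in atTop,
      (Measure.infinitePi fun _ : ℕ => ν) {ω | M < perpetuity κ K m ω a} ≤ ε := by
  obtain ⟨M, hM0, hM⟩ := exists_forall_measure_perpetuity_le hκ hK hκ0 hκ1 hK0 hiκ hiK
    (ENNReal.half_pos hε.ne')
  -- The starting value enters only through `a * ∏ κ`, which tends to `0` in measure. For large `m`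
  -- it costs at most the extra `1`, outside an event of probability `ε / 2`.
  refine ⟨M + 1, by linarith, fun a => ?_⟩
  have hT : TendstoInMeasure (Measure.infinitePi fun _ : ℕ => ν)
      (fun m (ω : ℕ → X) => a * ∏ i ∈ Finset.range m, κ (ω i)) atTop (fun _ => 0) := by
    refine tendstoInMeasure_of_tendsto_ae
      (fun m => (by fun_prop : Measurable _).aestronglyMeasurable) ?_
    filter_upwards [ae_perpetuity hκ hK hκ0 hκ1 hK0 hiκ hiK] with ω ⟨h, _⟩
    simpa using h.const_mul a
  have hT1 := hT 1 one_pos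
  filter_upwards [hT1.eventually_lt_const (ENNReal.half_pos hε.ne')] with m hm
  calc _ ≤ (Measure.infinitePi fun _ : ℕ => ν) ({ω | ∃ m, M < perpetuity κ K m ω 0} ∪
        {ω | 1 ≤ edist (a * ∏ i ∈ Finset.range m, κ (ω i)) 0}) := by
        refine measure_mono fun ω hω => ?_
        by_contra hc
        simp only [Set.mem_union, Set.mem_ofPred_eq, not_or, not_exists, not_lt, not_le] at hc hω
        obtain ⟨c1, c2⟩ := hc
        have c1' := c1 m
        rw [perpetuity_eq_sum] at hω c1'
        rw [edist_dist, dist_zero_right, Real.norm_eq_abs, ENNReal.ofReal_lt_one] at c2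
        have := (abs_lt.1 c2).2
        linarith
    _ ≤ ε / 2 + ε / 2 := (measure_union_le _ _).trans (add_le_add hM hm.le)
    _ = ε := ENNReal.add_halves ε

/-- The expectation of a function of the affine recursion after `m` steps. -/
def perpetuityMean (ν : Measure X) (κ K : X → ℝ) (g : ℝ → ℝ≥0∞) : ℕ → ℝ → ℝ≥0∞
  | 0 => g
  | m + 1 => fun a => ∫⁻ x, perpetuityMean ν κ K g m (κ x * a + K x) ∂ν

/-- Moves the extra average from the first step of the recursion to the last, where it meets the
outermost letter of `perpetuity`. -/
theorem perpetuityMean_succ_apply' (g : ℝ → ℝ≥0∞) (m : ℕ) :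
    perpetuityMean ν κ K g (m + 1) =
      perpetuityMean ν κ K (fun a => ∫⁻ x, g (κ x * a + K x) ∂ν) m := by
  induction m with
  | zero => rfl
  | succ m ih =>
    funext a
    rw [perpetuityMean, ih]
    rfl

/-- The mean composes with the newest letter outermost and `perpetuity` with the newest letter
innermost. For i.i.d. letters the two orders have the same law at each fixed `m`, which transfers
the pathwise bounds to the evolution. -/
theorem perpetuityMean_eq_lintegral (hκ : Measurable κ) (hK : Measurable K) {g : ℝ → ℝ≥0∞}
    (hg : Measurable g) (m : ℕ) (a : ℝ) :
    perpetuityMean ν κ K g m a =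
      ∫⁻ ω, g (perpetuity κ K m ω a) ∂(Measure.infinitePi fun _ : ℕ => ν) := by
  induction m generalizing g with
  | zero => simp [perpetuityMean, perpetuity]
  | succ m ih =>
    have hg' : Measurable fun a => ∫⁻ x, g (κ x * a + K x) ∂ν :=
      Measurable.lintegral_prod_right' (f := fun p : ℝ × X => g (κ p.2 * p.1 + K p.2))
        (hg.comp (by fun_prop))
    rw [perpetuityMean_succ_apply', ih hg',
      lintegral_infinitePi_cons ν (F := fun ω => g (perpetuity κ K (m + 1) ω a))
        (hg.comp (measurable_perpetuity hκ hK (m + 1) a))]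
    simp only [perpetuity, consSeq_zero, consSeq_succ]
    rw [lintegral_lintegral_swap]
    refine (hg.comp ?_).aemeasurable
    have : Measurable fun p : (ℕ → X) × X => perpetuity κ K m p.1 a :=
      (measurable_perpetuity hκ hK m a).comp measurable_fst
    exact ((hκ.comp measurable_snd).mul this).add (hK.comp measurable_snd)

end Perpetuity

end

noncomputable section

/-! ### Measurability, degree, lifts and the area formula for expanding maps. -/

namespace RandomCircle

variable {r : ℕ∞}

namespace CrMap

theorem isInducing_jet : IsInducing (jet (r := r)) := ⟨rfl⟩

/-- In a second countable space a measure is carried by its support, as the equality case requires.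
-/
instance : SecondCountableTopology (CrMap r) := isInducing_jet.secondCountableTopology

theorem continuous_eval : Continuous fun p : CrMap r × UnitAddCircle => p.1 p.2 := by
  have h : Continuous fun p : CrMap r × UnitAddCircle => (jet p.1).1 p.2 :=
    Continuous.eval (continuous_fst.comp (isInducing_jet.continuous.comp continuous_fst))
      continuous_snd
  exact h

theorem continuous_iterDeriv_eval {k : ℕ} (hk : 1 ≤ k) (hkr : (k : ℕ∞) ≤ r) :
    Continuous fun p : CrMap r × UnitAddCircle => p.1.iterDeriv k p.2 := by
  have h : Continuous fun p : CrMap r × UnitAddCircle => (jet p.1).2 ⟨k, hk, hkr⟩ p.2 :=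
    Continuous.eval ((continuous_apply _).comp
      (continuous_snd.comp (isInducing_jet.continuous.comp continuous_fst))) continuous_snd
  exact h

theorem hasDerivAt_lift (hr : 2 ≤ r) (f : CrMap r) (x : ℝ) :
    HasDerivAt f.lift (f.iterDeriv 1 (x : UnitAddCircle)) x := by
  rw [f.iterDeriv_coe le_rfl, iteratedDeriv_one]
  refine ((f.contDiff_lift.differentiable ?_) x).hasDerivAt
  have : (1 : ℕ∞) ≤ r := le_trans (by norm_num) hr
  intro h
  have h' : r = 0 := by exact_mod_cast h
  simp [h'] at this

theorem hasDerivAt_iterDeriv_one (hr : 2 ≤ r) (f : CrMap r) (x : ℝ) :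
    HasDerivAt (fun y : ℝ => f.iterDeriv 1 (y : UnitAddCircle))
      (f.iterDeriv 2 (x : UnitAddCircle)) x := by
  have h1 : (fun y : ℝ => f.iterDeriv 1 (y : UnitAddCircle)) = iteratedDeriv 1 f.lift :=
    funext fun y => f.iterDeriv_coe le_rfl y
  rw [h1, f.iterDeriv_coe (by norm_num), iteratedDeriv_succ (n := 1)]
  refine DifferentiableAt.hasDerivAt ?_
  refine (f.contDiff_lift.differentiable_iteratedDeriv 1 ?_) x
  have : ((1 : ℕ) : ℕ∞) < r := lt_of_lt_of_le (by norm_num) hr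
  exact_mod_cast this

theorem bddAbove_c2Norm (hr : 2 ≤ r) (f : CrMap r) :
    BddAbove (Set.range fun x : UnitAddCircle => max |f.iterDeriv 1 x| |f.iterDeriv 2 x|) := by
  refine (isCompact_range ?_).bddAbove
  exact (f.continuous_iterDeriv le_rfl (le_trans (by norm_num) hr)).abs.max
    (f.continuous_iterDeriv (by norm_num) hr).abs

theorem abs_iterDeriv_one_le (hr : 2 ≤ r) (f : CrMap r) (x : UnitAddCircle) :
    |f.iterDeriv 1 x| ≤ f.c2Norm :=
  (le_max_left _ _).trans (le_ciSup (f.bddAbove_c2Norm hr) x)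

theorem abs_iterDeriv_two_le (hr : 2 ≤ r) (f : CrMap r) (x : UnitAddCircle) :
    |f.iterDeriv 2 x| ≤ f.c2Norm :=
  (le_max_right _ _).trans (le_ciSup (f.bddAbove_c2Norm hr) x)

/-- The supremum runs over uncountably many points. Its sublevel sets are nevertheless closed, as
intersections of conditions that are closed in `f`. -/
theorem measurable_c2Norm (hr : 2 ≤ r) : Measurable (c2Norm (r := r)) := by
  refine measurable_of_Iic fun t => ?_
  have : c2Norm (r := r) ⁻¹' Set.Iic t =
      ⋂ x : UnitAddCircle, {f | max |f.iterDeriv 1 x| |f.iterDeriv 2 x| ≤ t} := by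
    ext f
    simp only [Set.mem_preimage, Set.mem_Iic, Set.mem_iInter]
    exact ciSup_le_iff (f.bddAbove_c2Norm hr)
  rw [this]
  refine (isClosed_iInter fun x => isClosed_le ?_ continuous_const).measurableSet
  exact (((continuous_iterDeriv_eval le_rfl (le_trans (by norm_num) hr)).comp
    (Continuous.prodMk_left x)).abs).max (((continuous_iterDeriv_eval (by norm_num) hr).comp
    (Continuous.prodMk_left x)).abs)

/-- The least expansion `min_x |f'(x)|`. -/
def minDeriv (f : CrMap r) : ℝ := ⨅ x : UnitAddCircle, |f.iterDeriv 1 x|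

theorem bddBelow_minDeriv (f : CrMap r) :
    BddBelow (Set.range fun x : UnitAddCircle => |f.iterDeriv 1 x|) :=
  ⟨0, by rintro _ ⟨x, rfl⟩; exact abs_nonneg _⟩

theorem minDeriv_le (f : CrMap r) (x : UnitAddCircle) : f.minDeriv ≤ |f.iterDeriv 1 x| :=
  ciInf_le f.bddBelow_minDeriv x

theorem measurable_minDeriv (hr : 2 ≤ r) : Measurable (minDeriv (r := r)) := by
  refine measurable_of_Ici fun t => ?_
  have : minDeriv (r := r) ⁻¹' Set.Ici t = ⋂ x : UnitAddCircle, {f | t ≤ |f.iterDeriv 1 x|} := by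
    ext f
    simp only [Set.mem_preimage, Set.mem_Ici, Set.mem_iInter]
    exact le_ciInf_iff f.bddBelow_minDeriv
  rw [this]
  refine (isClosed_iInter fun x => isClosed_le continuous_const ?_).measurableSet
  exact ((continuous_iterDeriv_eval le_rfl (le_trans (by norm_num) hr)).comp
    (Continuous.prodMk_left x)).abs

theorem lift_add_intCast (f : CrMap r) (x : ℝ) (n : ℤ) :
    f.lift (x + n) = f.lift x + n * f.degree := by
  induction n using Int.induction_on generalizing x with
  | zero => simp
  | succ n ih =>
    push_cast at ih ⊢
    rw [← add_assoc, lift_add_one, ih]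
    ring
  | pred n ih =>
    have h := f.lift_add_one (x + (-(n : ℝ) - 1))
    push_cast at ih ⊢
    rw [show x + (-(n : ℝ) - 1) + 1 = x + -(n : ℝ) by ring, ih] at h
    linarith

theorem exists_degree_eq_iterDeriv (hr : 2 ≤ r) (f : CrMap r) :
    ∃ x : UnitAddCircle, f.iterDeriv 1 x = f.degree := by
  obtain ⟨c, _, hc⟩ := exists_hasDerivAt_eq_slope f.lift (fun x : ℝ => f.iterDeriv 1 x)
    (zero_lt_one) f.contDiff_lift.continuous.continuousOn (fun x _ => f.hasDerivAt_lift hr x)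
  refine ⟨c, ?_⟩
  have := f.lift_add_one 0
  rw [zero_add] at this
  rw [hc, this]
  ring

theorem continuous_iterDeriv_one_coe (hr : 2 ≤ r) :
    Continuous fun p : CrMap r × ℝ => p.1.iterDeriv 1 (p.2 : UnitAddCircle) := by
  have hr1 : ((1 : ℕ) : ℕ∞) ≤ r := le_trans (by norm_num) hr
  have hq : Continuous ((↑) : ℝ → UnitAddCircle) := AddCircle.continuous_mk' 1
  have h1 : Continuous fun p : CrMap r × ℝ => (p.1, (p.2 : UnitAddCircle)) :=
    continuous_fst.prodMk (hq.comp continuous_snd)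
  have h2 : Continuous fun p : CrMap r × UnitAddCircle => p.1.iterDeriv 1 p.2 :=
    continuous_iterDeriv_eval (k := 1) le_rfl hr1
  have := Continuous.comp h2 h1
  exact this

/-- This formula makes the degree continuous in the `C^r` topology, hence measurable; being an
integer, it is then locally constant. -/
theorem degree_eq_integral (hr : 2 ≤ r) (f : CrMap r) :
    (f.degree : ℝ) = ∫ x in (0 : ℝ)..1, f.iterDeriv 1 (x : UnitAddCircle) := by
  have hc : Continuous fun x : ℝ => f.iterDeriv 1 (x : UnitAddCircle) := by
    have := Continuous.comp (continuous_iterDeriv_one_coe hr) (Continuous.prodMk_right f)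
    exact this
  have h := intervalIntegral.integral_eq_sub_of_hasDerivAt
    (fun x _ => f.hasDerivAt_lift hr x) (hc.intervalIntegrable 0 1)
  have h1 := f.lift_add_one 0
  rw [zero_add] at h1
  rw [h, h1]
  ring

theorem continuous_degree (hr : 2 ≤ r) : Continuous fun f : CrMap r => (f.degree : ℝ) := by
  rw [show (fun f : CrMap r => (f.degree : ℝ)) =
    fun f : CrMap r => ∫ x in (0 : ℝ)..1, f.iterDeriv 1 (x : UnitAddCircle)
    from funext (degree_eq_integral hr)]
  exact intervalIntegral.continuous_parametric_intervalIntegral_of_continuous'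
    (f := fun (f : CrMap r) (x : ℝ) => f.iterDeriv 1 (x : UnitAddCircle))
    (continuous_iterDeriv_one_coe hr) 0 1

end CrMap

namespace Expanding

theorem continuous_deriv (hr : 2 ≤ r) (f : Expanding r) : Continuous (f.1.iterDeriv 1) :=
  f.1.continuous_iterDeriv le_rfl (le_trans (by norm_num) hr)

theorem measurable_eval : Measurable fun p : Expanding r × UnitAddCircle => p.1.1 p.2 :=
  (CrMap.continuous_eval.comp
    ((continuous_subtype_val.comp continuous_fst).prodMk continuous_snd)).measurable

theorem measurable_map (f : Expanding r) : Measurable (f.1 : UnitAddCircle → UnitAddCircle) :=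
  f.1.isCr.continuous.measurable

theorem measurable_deriv (hr : 2 ≤ r) :
    Measurable fun p : Expanding r × UnitAddCircle => p.1.1.iterDeriv 1 p.2 :=
  ((CrMap.continuous_iterDeriv_eval le_rfl (le_trans (by norm_num) hr)).comp
    ((continuous_subtype_val.comp continuous_fst).prodMk continuous_snd)).measurable

theorem one_lt_minDeriv (hr : 2 ≤ r) (f : Expanding r) : 1 < f.1.minDeriv := by
  obtain ⟨x, hx⟩ := (f.continuous_deriv hr).abs.exists_forall_le_of_isBounded 0
    (isCompact_univ.isBounded.subset (Set.subset_univ _))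
  exact lt_of_lt_of_le (f.2 x) (le_ciInf hx)

theorem minDeriv_le_c2Norm (hr : 2 ≤ r) (f : Expanding r) : f.1.minDeriv ≤ f.1.c2Norm :=
  (f.1.minDeriv_le 0).trans (f.1.abs_iterDeriv_one_le hr 0)

theorem one_lt_c2Norm (hr : 2 ≤ r) (f : Expanding r) : 1 < f.1.c2Norm :=
  (f.one_lt_minDeriv hr).trans_le (f.minDeriv_le_c2Norm hr)

theorem deriv_ne_zero (f : Expanding r) (x : UnitAddCircle) : f.1.iterDeriv 1 x ≠ 0 := by
  have := f.2 x
  intro h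
  rw [h, abs_zero] at this
  linarith

theorem one_lt_abs_degree (hr : 2 ≤ r) (f : Expanding r) : 1 < |(f.1.degree : ℝ)| := by
  obtain ⟨x, hx⟩ := f.1.exists_degree_eq_iterDeriv hr
  rw [← hx]
  exact f.2 x

theorem degree_ne_zero (hr : 2 ≤ r) (f : Expanding r) : (f.1.degree : ℝ) ≠ 0 := by
  have := f.one_lt_abs_degree hr
  intro h
  rw [h, abs_zero] at this
  linarith

theorem abs_degree_le_c2Norm (hr : 2 ≤ r) (f : Expanding r) :
    |(f.1.degree : ℝ)| ≤ f.1.c2Norm := by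
  obtain ⟨x, hx⟩ := f.1.exists_degree_eq_iterDeriv hr
  rw [← hx]
  exact f.1.abs_iterDeriv_one_le hr x

theorem measurable_degree (hr : 2 ≤ r) : Measurable fun f : Expanding r => (f.1.degree : ℝ) :=
  ((CrMap.continuous_degree hr).comp continuous_subtype_val).measurable

theorem measurable_c2Norm (hr : 2 ≤ r) : Measurable fun f : Expanding r => f.1.c2Norm :=
  (CrMap.measurable_c2Norm hr).comp measurable_subtype_coe

theorem measurable_minDeriv (hr : 2 ≤ r) : Measurable fun f : Expanding r => f.1.minDeriv :=
  (CrMap.measurable_minDeriv hr).comp measurable_subtype_coe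

theorem integrable_log_abs_degree (hr : 2 ≤ r) {ν : Measure (Expanding r)}
    (hν : Integrable (fun f : Expanding r => Real.log f.1.c2Norm) ν) :
    Integrable (fun f : Expanding r => Real.log |(f.1.degree : ℝ)|) ν := by
  refine hν.mono' (Real.measurable_log.comp (measurable_degree hr).abs).aestronglyMeasurable
    (ae_of_all _ fun f => ?_)
  have h := f.one_lt_abs_degree hr
  rw [Real.norm_eq_abs, abs_of_nonneg (Real.log_nonneg h.le)]
  exact Real.log_le_log (by linarith) (f.abs_degree_le_c2Norm hr)

theorem integrable_log_inv_minDeriv (hr : 2 ≤ r) {ν : Measure (Expanding r)}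
    (hν : Integrable (fun f : Expanding r => Real.log f.1.c2Norm) ν) :
    Integrable (fun f : Expanding r => Real.log (f.1.minDeriv)⁻¹) ν := by
  refine hν.mono' (Real.measurable_log.comp (measurable_minDeriv hr).inv).aestronglyMeasurable
    (ae_of_all _ fun f => ?_)
  have h := f.one_lt_minDeriv hr
  rw [Real.norm_eq_abs, Real.log_inv, abs_neg, abs_of_nonneg (Real.log_nonneg h.le)]
  exact Real.log_le_log (by linarith) (f.minDeriv_le_c2Norm hr)

theorem deriv_pos_or_neg (hr : 2 ≤ r) (f : Expanding r) :
    (∀ x, 0 < f.1.iterDeriv 1 x) ∨ ∀ x, f.1.iterDeriv 1 x < 0 := by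
  by_contra! h
  obtain ⟨⟨x, hx⟩, y, hy⟩ := h
  obtain ⟨z, hz⟩ := mem_range_of_exists_le_of_exists_ge (f.continuous_deriv hr) ⟨x, hx⟩ ⟨y, hy⟩
  exact f.deriv_ne_zero z hz

theorem strictMono_or_strictAnti_lift (hr : 2 ≤ r) (f : Expanding r) :
    StrictMono f.1.lift ∨ StrictAnti f.1.lift := by
  rcases f.deriv_pos_or_neg hr with h | h
  · left
    exact strictMono_of_deriv_pos fun x => by rw [(f.1.hasDerivAt_lift hr x).deriv]; exact h x
  · right
    exact strictAnti_of_deriv_neg fun x => by rw [(f.1.hasDerivAt_lift hr x).deriv]; exact h x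

theorem surjective_lift (hr : 2 ≤ r) (f : Expanding r) : Function.Surjective f.1.lift := by
  have hc := f.1.contDiff_lift.continuous
  have hd := f.degree_ne_zero hr
  have key : ∀ y : ℝ, ∃ x : ℝ, f.1.lift x ≤ y := fun y => by
    obtain ⟨n, hn⟩ := exists_int_gt ((f.1.lift 0 - y))
    have h1 : (1 : ℝ) ≤ |(f.1.degree : ℝ)| := (f.one_lt_abs_degree hr).le
    rcases lt_or_gt_of_ne hd with h | h
    · refine ⟨0 + ((max n 0 : ℤ) : ℝ), ?_⟩
      rw [CrMap.lift_add_intCast]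
      have h2 : ((n : ℤ) : ℝ) ≤ ((max n 0 : ℤ) : ℝ) := by exact_mod_cast le_max_left _ _
      have h3 : (0 : ℝ) ≤ ((max n 0 : ℤ) : ℝ) := by exact_mod_cast le_max_right _ _
      rw [abs_of_neg h] at h1
      nlinarith
    · refine ⟨0 + ((-(max n 0) : ℤ) : ℝ), ?_⟩
      rw [CrMap.lift_add_intCast]
      have h2 : ((n : ℤ) : ℝ) ≤ ((max n 0 : ℤ) : ℝ) := by exact_mod_cast le_max_left _ _
      have h3 : (0 : ℝ) ≤ ((max n 0 : ℤ) : ℝ) := by exact_mod_cast le_max_right _ _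
      rw [abs_of_pos h] at h1
      rw [Int.cast_neg]
      nlinarith
  have key' : ∀ y : ℝ, ∃ x : ℝ, y ≤ f.1.lift x := fun y => by
    obtain ⟨n, hn⟩ := exists_int_gt (y - f.1.lift 0)
    have h1 : (1 : ℝ) ≤ |(f.1.degree : ℝ)| := (f.one_lt_abs_degree hr).le
    have h2 : ((n : ℤ) : ℝ) ≤ ((max n 0 : ℤ) : ℝ) := by exact_mod_cast le_max_left _ _
    have h3 : (0 : ℝ) ≤ ((max n 0 : ℤ) : ℝ) := by exact_mod_cast le_max_right _ _
    rcases lt_or_gt_of_ne hd with h | h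
    · refine ⟨0 + ((-(max n 0) : ℤ) : ℝ), ?_⟩
      rw [CrMap.lift_add_intCast]
      rw [abs_of_neg h] at h1
      rw [Int.cast_neg]
      nlinarith
    · refine ⟨0 + ((max n 0 : ℤ) : ℝ), ?_⟩
      rw [CrMap.lift_add_intCast]
      rw [abs_of_pos h] at h1
      nlinarith
  exact fun y => mem_range_of_exists_le_of_exists_ge hc (key y) (key' y)

theorem exists_homeomorph_lift (hr : 2 ≤ r) (f : Expanding r) :
    ∃ e : ℝ ≃ₜ ℝ, ⇑e = f.1.lift := by
  rcases f.strictMono_or_strictAnti_lift hr with h | h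
  · exact ⟨(h.orderIsoOfSurjective _ (f.surjective_lift hr)).toHomeomorph, rfl⟩
  · have h' : StrictMono fun x => -f.1.lift x := h.neg
    have hs : Function.Surjective fun x => -f.1.lift x := fun y => by
      obtain ⟨x, hx⟩ := f.surjective_lift hr (-y)
      exact ⟨x, by simp [hx]⟩
    refine ⟨(h'.orderIsoOfSurjective _ hs).toHomeomorph.trans (Homeomorph.neg ℝ), ?_⟩
    funext x
    simp

theorem hasDerivAt_symm (hr : 2 ≤ r) (f : Expanding r) {e : ℝ ≃ₜ ℝ} (he : ⇑e = f.1.lift)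
    (x : ℝ) : HasDerivAt e.symm (f.1.iterDeriv 1 (e.symm x : UnitAddCircle))⁻¹ x := by
  refine HasDerivAt.of_local_left_inverse (f := e) e.symm.continuous.continuousAt ?_
    (f.deriv_ne_zero _) (Eventually.of_forall fun y => e.apply_symm_apply y)
  rw [he]
  exact f.1.hasDerivAt_lift hr _

end Expanding

theorem lintegral_Ioc_add_nat (g : UnitAddCircle → ℝ≥0∞) (a : ℝ) (n : ℕ) :
    ∫⁻ x in Set.Ioc a (a + n), g (x : UnitAddCircle) = n * ∫⁻ x, g x := by
  induction n with
  | zero => simp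
  | succ n ih =>
    have hu : Set.Ioc a (a + ((n + 1 : ℕ) : ℝ)) =
        Set.Ioc a (a + n) ∪ Set.Ioc (a + n) (a + n + 1) := by
      rw [Set.Ioc_union_Ioc_eq_Ioc (by simp) (by simp)]
      push_cast
      rw [add_assoc]
    rw [hu, lintegral_union measurableSet_Ioc (Set.Ioc_disjoint_Ioc_of_le le_rfl), ih,
      UnitAddCircle.lintegral_preimage]
    push_cast
    ring

namespace Expanding

/-- The equality is only almost everywhere because an orientation-reversing lift turns `Ioc` into
`Ico`. -/
theorem lift_image_Ioc_ae_eq (hr : 2 ≤ r) (f : Expanding r) :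
    ∃ a : ℝ, f.1.lift '' Set.Ioc 0 1 =ᵐ[volume] Set.Ioc a (a + f.1.degree.natAbs) := by
  obtain ⟨e, he⟩ := f.exists_homeomorph_lift hr
  have hd : f.1.lift 1 = f.1.lift 0 + f.1.degree := by
    have := f.1.lift_add_one 0
    rwa [zero_add] at this
  have himg : f.1.lift '' Set.Ioc 0 1 = e.symm ⁻¹' Set.Ioc 0 1 := by
    rw [← he]
    exact e.toEquiv.image_eq_preimage_symm _
  have hs : ∀ x, f.1.lift (e.symm x) = x := fun x => by rw [← he]; simp
  rw [himg]
  rcases f.strictMono_or_strictAnti_lift hr with h | h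
  · have hpos : 0 < (f.1.degree : ℝ) := by have := h zero_lt_one; linarith
    have hn : ((f.1.degree.natAbs : ℕ) : ℝ) = f.1.degree := by
      rw [Nat.cast_natAbs, Int.cast_abs, abs_of_pos hpos]
    refine ⟨f.1.lift 0, ?_⟩
    rw [hn, ← hd]
    have : e.symm ⁻¹' Set.Ioc 0 1 = Set.Ioc (f.1.lift 0) (f.1.lift 1) := by
      ext x
      simp only [Set.mem_preimage, Set.mem_Ioc]
      rw [← h.lt_iff_lt, ← h.le_iff_le, hs]
    rw [this]
    exact ae_eq_refl _
  · have hneg : (f.1.degree : ℝ) < 0 := by have := h zero_lt_one; linarith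
    have hn : ((f.1.degree.natAbs : ℕ) : ℝ) = -f.1.degree := by
      rw [Nat.cast_natAbs, Int.cast_abs, abs_of_neg hneg]
    refine ⟨f.1.lift 1, ?_⟩
    rw [hn, show f.1.lift 1 + -(f.1.degree : ℝ) = f.1.lift 0 by rw [hd]; ring]
    have : e.symm ⁻¹' Set.Ioc 0 1 = Set.Ico (f.1.lift 1) (f.1.lift 0) := by
      ext x
      simp only [Set.mem_preimage, Set.mem_Ioc, Set.mem_Ico]
      rw [← h.lt_iff_gt, ← h.le_iff_ge, hs, and_comm]
    rw [this]
    exact Ico_ae_eq_Ioc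

/-- The area formula: an expanding map covers the circle `|deg f|` times. -/
theorem lintegral_abs_deriv_mul_comp (hr : 2 ≤ r) (f : Expanding r)
    (g : UnitAddCircle → ℝ≥0∞) :
    ∫⁻ y, ENNReal.ofReal |f.1.iterDeriv 1 y| * g (f.1 y) = f.1.degree.natAbs * ∫⁻ x, g x := by
  obtain ⟨e, he⟩ := f.exists_homeomorph_lift hr
  obtain ⟨a, ha⟩ := f.lift_image_Ioc_ae_eq hr
  rw [← UnitAddCircle.lintegral_preimage 0, zero_add]
  have h := lintegral_image_eq_lintegral_abs_deriv_mul (s := Set.Ioc (0 : ℝ) 1)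
    (f := f.1.lift) (f' := fun x : ℝ => f.1.iterDeriv 1 x) measurableSet_Ioc
    (fun x _ => (f.1.hasDerivAt_lift hr x).hasDerivWithinAt)
    (by rw [← he]; exact e.injective.injOn) (fun x : ℝ => g x)
  simp only [f.1.coe_lift] at h
  rw [← h, setLIntegral_congr ha, lintegral_Ioc_add_nat]

end Expanding

end RandomCircle

end

noncomputable section

/-! ### Log-Lipschitz densities and the transfer operator of one map. -/

namespace RandomCircle

variable {r : ℕ∞}

instance : IsProbabilityMeasure (volume : Measure UnitAddCircle) :=
  ⟨UnitAddCircle.measure_univ⟩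

theorem continuous_coe : Continuous ((↑) : ℝ → UnitAddCircle) := AddCircle.continuous_mk' 1

theorem continuous_of_comp_coe {Y : Type*} [TopologicalSpace Y] {g : UnitAddCircle → Y}
    (h : Continuous fun x : ℝ => g x) : Continuous g :=
  (QuotientAddGroup.isQuotientMap_mk (N := AddSubgroup.zmultiples (1 : ℝ))).continuous_iff.2 h

theorem exists_coe_eq (x : UnitAddCircle) : ∃ y ∈ Set.Ico (0 : ℝ) 1, (y : UnitAddCircle) = x := by
  obtain ⟨y, hy, h⟩ := AddCircle.coe_image_Ico_eq (1 : ℝ) 0 ▸ Set.mem_univ x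
  exact ⟨y, by simpa using hy, h⟩

theorem integral_eq_setIntegral {E : Type*} [NormedAddCommGroup E] [NormedSpace ℝ E] (t : ℝ)
    (g : UnitAddCircle → E) : ∫ x, g x = ∫ x in Set.Ioc t (t + 1), g (x : UnitAddCircle) :=
  (UnitAddCircle.integral_preimage t g).symm

/-- A positive probability density on the circle whose logarithm is `a`-Lipschitz. -/
structure LogLipDensity (a : ℝ) (ψ : UnitAddCircle → ℝ) : Prop where
  pos : ∀ x, 0 < ψ x
  le : ∀ x y : ℝ, ψ x ≤ Real.exp (a * |x - y|) * ψ y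
  integral : ∫ x, ψ x = 1

namespace LogLipDensity

variable {a : ℝ} {ψ : UnitAddCircle → ℝ}

/-- `0` and `1` are two lifts of one point, so the Lipschitz bound between them forces `exp a ≥ 1`.
-/
theorem nonneg (h : LogLipDensity a ψ) : 0 ≤ a := by
  have h1 := h.le 1 0
  have h2 : ((1 : ℝ) : UnitAddCircle) = ((0 : ℝ) : UnitAddCircle) := by
    rw [AddCircle.coe_period]; rfl
  rw [h2] at h1
  have h3 := h.pos ((0 : ℝ) : UnitAddCircle)
  have h4 : 1 ≤ Real.exp (a * |1 - 0|) := by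
    by_contra! hc
    nlinarith
  simpa using h4

theorem mono (h : LogLipDensity a ψ) {b : ℝ} (hab : a ≤ b) : LogLipDensity b ψ :=
  ⟨h.pos, fun x y => (h.le x y).trans (by have := (h.pos y).le; gcongr), h.integral⟩

theorem const (ha : 0 ≤ a) : LogLipDensity a fun _ => 1 :=
  ⟨fun _ => one_pos, fun x y => by simpa using mul_nonneg ha (abs_nonneg _), by simp⟩

theorem abs_log_sub_le (h : LogLipDensity a ψ) (x y : ℝ) :
    |Real.log (ψ x) - Real.log (ψ y)| ≤ a * |x - y| := by
  have key : ∀ x y : ℝ, Real.log (ψ x) - Real.log (ψ y) ≤ a * |x - y| := fun x y => by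
    have h1 := Real.log_le_log (h.pos x) (h.le x y)
    rw [Real.log_mul (Real.exp_pos _).ne' (h.pos y).ne', Real.log_exp] at h1
    linarith
  rw [abs_le]
  have := key y x
  rw [abs_sub_comm] at this
  exact ⟨by linarith, key x y⟩

theorem continuous (h : LogLipDensity a ψ) : Continuous ψ := by
  refine continuous_of_comp_coe ?_
  have h1 : LipschitzWith a.toNNReal fun x : ℝ => Real.log (ψ x) :=
    LipschitzWith.of_dist_le_mul fun x y => by
      rw [Real.coe_toNNReal _ h.nonneg]
      exact h.abs_log_sub_le x y
  have h2 : (fun x : ℝ => ψ x) = fun x : ℝ => Real.exp (Real.log (ψ x)) :=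
    funext fun x => (Real.exp_log (h.pos x)).symm
  rw [h2]
  exact Real.continuous_exp.comp h1.continuous

theorem integrable (h : LogLipDensity a ψ) : Integrable ψ :=
  h.continuous.integrable_of_hasCompactSupport (HasCompactSupport.of_compactSpace _)

/-- Any two points have lifts at distance at most `1`. Averaging this Harnack inequality over one of
the points gives the two-sided bounds by `exp a` and `exp (-a)`, as the total mass is `1`. -/
theorem le_exp_mul (h : LogLipDensity a ψ) (x y : UnitAddCircle) : ψ x ≤ Real.exp a * ψ y := by
  obtain ⟨x, hx, rfl⟩ := exists_coe_eq x
  obtain ⟨y, hy, rfl⟩ := exists_coe_eq y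
  refine (h.le x y).trans ?_
  have h1 : |x - y| ≤ 1 := by
    rw [abs_le]
    constructor <;> linarith [hx.1, hx.2, hy.1, hy.2]
  have := (h.pos y).le
  have := h.nonneg
  gcongr
  nlinarith

theorem le_exp (h : LogLipDensity a ψ) (x : UnitAddCircle) : ψ x ≤ Real.exp a := by
  have h1 : ∫ _ : UnitAddCircle, ψ x ≤ ∫ y, Real.exp a * ψ y :=
    integral_mono (integrable_const _) (h.integrable.const_mul _) (fun y => h.le_exp_mul x y)
  rw [integral_const_mul, h.integral] at h1
  simpa using h1

theorem exp_neg_le (h : LogLipDensity a ψ) (x : UnitAddCircle) : Real.exp (-a) ≤ ψ x := by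
  have h1 : ∫ y, ψ y ≤ ∫ _ : UnitAddCircle, Real.exp a * ψ x :=
    integral_mono h.integrable (integrable_const _) (fun y => h.le_exp_mul y x)
  rw [h.integral] at h1
  have h2 : (1 : ℝ) ≤ Real.exp a * ψ x := by simpa using h1
  rw [Real.exp_neg, inv_le_iff_one_le_mul₀ (Real.exp_pos _), mul_comm]
  exact h2

/-- Subtracting half of the guaranteed minimum keeps a density in a larger cone. -/
theorem sub_const (h : LogLipDensity a ψ) :
    LogLipDensity (2 * a) fun x =>
      (1 - Real.exp (-a) / 2)⁻¹ * (ψ x - Real.exp (-a) / 2) := by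
  have ha := h.nonneg
  have h1 : Real.exp (-a) ≤ 1 := by rw [Real.exp_le_one_iff]; linarith
  have h0 := Real.exp_pos (-a)
  have h2 : 0 < 1 - Real.exp (-a) / 2 := by linarith
  refine ⟨fun x => mul_pos (inv_pos.2 h2) (by linarith [h.exp_neg_le x]), fun x y => ?_, ?_⟩
  · rw [mul_left_comm]
    refine mul_le_mul_of_nonneg_left ?_ (inv_pos.2 h2).le
    have h3 := h.le x y
    have h4 := h.exp_neg_le (y : UnitAddCircle)
    have h5 : Real.exp (2 * a * |x - y|) = Real.exp (a * |x - y|) ^ 2 := by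
      rw [← Real.exp_nat_mul]
      congr 1
      push_cast
      ring
    have h6 : 1 ≤ Real.exp (a * |x - y|) := Real.one_le_exp (mul_nonneg ha (abs_nonneg _))
    rw [h5]
    set E := Real.exp (a * |x - y|)
    set c := Real.exp (-a)
    -- After `ψ x ≤ E * ψ y`, the claim becomes `(E² - 1) c / 2 ≤ (E² - E) ψ y`. Since `ψ y ≥ c`,
    -- the difference is at least `c (E - 1)² / 2`; removing only half of the minimum matches the
    -- doubled constant.
    have h7 : 0 ≤ (E ^ 2 - E) * (ψ y - c) :=
      mul_nonneg (by nlinarith) (by linarith)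
    nlinarith [mul_nonneg h0.le (sq_nonneg (E - 1))]
  · rw [integral_const_mul, integral_sub h.integrable (integrable_const _), h.integral]
    simp only [integral_const, probReal_univ, smul_eq_mul, one_mul]
    exact inv_mul_cancel₀ h2.ne'

end LogLipDensity

namespace Expanding

theorem symm_add_nat (hr : 2 ≤ r) (f : Expanding r) {e : ℝ ≃ₜ ℝ} (he : ⇑e = f.1.lift) :
    (∀ x, e.symm (x + f.1.degree.natAbs) = e.symm x + 1) ∧ StrictMono e.symm ∨
      (∀ x, e.symm (x + f.1.degree.natAbs) = e.symm x - 1) ∧ StrictAnti e.symm := by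
  have hs : ∀ x, f.1.lift (e.symm x) = x := fun x => by rw [← he]; simp
  have key : ∀ x, e.symm (x + f.1.degree) = e.symm x + 1 := fun x => by
    apply e.injective
    rw [e.apply_symm_apply, he, CrMap.lift_add_one, hs]
  have hd : f.1.lift 1 = f.1.lift 0 + f.1.degree := by
    have := f.1.lift_add_one 0
    rwa [zero_add] at this
  rcases f.strictMono_or_strictAnti_lift hr with h | h
  · left
    have hpos : 0 < (f.1.degree : ℝ) := by have := h zero_lt_one; linarith
    have hn : ((f.1.degree.natAbs : ℕ) : ℝ) = f.1.degree := by
      rw [Nat.cast_natAbs, Int.cast_abs, abs_of_pos hpos]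
    refine ⟨fun x => by rw [hn, key], fun x y hxy => ?_⟩
    rw [← h.lt_iff_lt, hs, hs]
    exact hxy
  · right
    have hneg : (f.1.degree : ℝ) < 0 := by have := h zero_lt_one; linarith
    have hn : ((f.1.degree.natAbs : ℕ) : ℝ) = -f.1.degree := by
      rw [Nat.cast_natAbs, Int.cast_abs, abs_of_neg hneg]
    refine ⟨fun x => ?_, fun x y hxy => ?_⟩
    · have := key (x + f.1.degree.natAbs)
      rw [hn, neg_add_cancel_right] at this
      rw [hn]
      linarith
    · rw [← h.lt_iff_gt, hs, hs]
      exact hxy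

theorem symm_image_Ioc_ae_eq (hr : 2 ≤ r) (f : Expanding r) {e : ℝ ≃ₜ ℝ} (he : ⇑e = f.1.lift) :
    ∃ b : ℝ, e.symm '' Set.Ioc 0 (f.1.degree.natAbs : ℝ) =ᵐ[volume] Set.Ioc b (b + 1) := by
  have himg : e.symm '' Set.Ioc 0 (f.1.degree.natAbs : ℝ) =
      e ⁻¹' Set.Ioc 0 (f.1.degree.natAbs : ℝ) := e.toEquiv.symm.image_eq_preimage_symm _
  rw [himg]
  rcases f.symm_add_nat hr he with ⟨h, hm⟩ | ⟨h, hm⟩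
  · have h0 := h 0
    rw [zero_add] at h0
    refine ⟨e.symm 0, ?_⟩
    have : e ⁻¹' Set.Ioc 0 (f.1.degree.natAbs : ℝ) = Set.Ioc (e.symm 0) (e.symm 0 + 1) := by
      ext x
      rw [← h0]
      simp only [Set.mem_preimage, Set.mem_Ioc]
      rw [← hm.lt_iff_lt, ← hm.le_iff_le, e.symm_apply_apply]
    rw [this]
    exact ae_eq_refl _
  · have h0 := h 0
    rw [zero_add] at h0
    refine ⟨e.symm (f.1.degree.natAbs : ℝ), ?_⟩
    have : e ⁻¹' Set.Ioc 0 (f.1.degree.natAbs : ℝ) = Set.Ico (e.symm (f.1.degree.natAbs : ℝ))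
        (e.symm (f.1.degree.natAbs : ℝ) + 1) := by
      ext x
      rw [show e.symm (f.1.degree.natAbs : ℝ) + 1 = e.symm 0 by rw [h0]; ring]
      simp only [Set.mem_preimage, Set.mem_Ioc, Set.mem_Ico]
      rw [← hm.lt_iff_gt, ← hm.le_iff_ge, e.symm_apply_apply, and_comm]
    rw [this]
    exact Ico_ae_eq_Ioc

theorem abs_symm_sub_le (hr : 2 ≤ r) (f : Expanding r) {e : ℝ ≃ₜ ℝ} (he : ⇑e = f.1.lift)
    (x y : ℝ) : |e.symm x - e.symm y| ≤ f.1.minDeriv⁻¹ * |x - y| := by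
  refine Convex.norm_image_sub_le_of_norm_hasDerivWithin_le (s := Set.univ)
    (fun z _ => (f.hasDerivAt_symm hr he z).hasDerivWithinAt) (fun z _ => ?_) convex_univ
    trivial trivial
  rw [norm_inv, Real.norm_eq_abs]
  exact inv_anti₀ (by linarith [f.one_lt_minDeriv hr]) (f.1.minDeriv_le _)

/-- The derivative of `log|f'|` along the inverse lift is `f'' / (f')²`, and `|f'| > 1` bounds it by
`|f''|`. -/
theorem abs_log_deriv_symm_sub_le (hr : 2 ≤ r) (f : Expanding r) {e : ℝ ≃ₜ ℝ}
    (he : ⇑e = f.1.lift) (x y : ℝ) :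
    |Real.log (|f.1.iterDeriv 1 (e.symm x : UnitAddCircle)|⁻¹) -
      Real.log (|f.1.iterDeriv 1 (e.symm y : UnitAddCircle)|⁻¹)| ≤ f.1.c2Norm * |x - y| := by
  have hd : ∀ z : ℝ, HasDerivAt
      (fun z : ℝ => Real.log (f.1.iterDeriv 1 (e.symm z : UnitAddCircle)))
      (f.1.iterDeriv 2 (e.symm z : UnitAddCircle) *
        (f.1.iterDeriv 1 (e.symm z : UnitAddCircle))⁻¹ /
          f.1.iterDeriv 1 (e.symm z : UnitAddCircle)) z := fun z =>
    ((f.1.hasDerivAt_iterDeriv_one hr (e.symm z)).comp z (f.hasDerivAt_symm hr he z)).log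
      (f.deriv_ne_zero _)
  have h := Convex.norm_image_sub_le_of_norm_hasDerivWithin_le (s := Set.univ) (C := f.1.c2Norm)
    (fun z _ => (hd z).hasDerivWithinAt) (fun z _ => ?_) convex_univ
    (Set.mem_univ y) (Set.mem_univ x)
  · rw [Real.log_inv, Real.log_inv, Real.log_abs, Real.log_abs, ← abs_neg]
    rw [Real.norm_eq_abs, Real.norm_eq_abs] at h
    convert h using 2
    ring
  · rw [norm_div, norm_mul, norm_inv, Real.norm_eq_abs, Real.norm_eq_abs]
    have h1 := f.2 (e.symm z : UnitAddCircle)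
    have h2 := f.1.abs_iterDeriv_two_le hr (e.symm z : UnitAddCircle)
    have h3 : |f.1.iterDeriv 1 (e.symm z : UnitAddCircle)|⁻¹ ≤ 1 := inv_le_one_of_one_le₀ h1.le
    rw [div_eq_mul_inv]
    have h4 : 0 ≤ |f.1.iterDeriv 1 (e.symm z : UnitAddCircle)|⁻¹ := by positivity
    calc _ ≤ |f.1.iterDeriv 2 (e.symm z : UnitAddCircle)| * 1 * 1 := by gcongr
      _ ≤ _ := by simpa using h2

/-- **Distortion**: the transfer operator of an expanding map acts on the cones of log-Lipschitz
densities by an affine map on the constants. -/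
theorem exists_transfer (hr : 2 ≤ r) (f : Expanding r) {a : ℝ} {ψ : UnitAddCircle → ℝ}
    (hψ : LogLipDensity a ψ) :
    ∃ ψ' : UnitAddCircle → ℝ, LogLipDensity (f.1.minDeriv⁻¹ * a + f.1.c2Norm) ψ' ∧
      ∀ h : UnitAddCircle → ℝ, Measurable h → (∀ x, |h x| ≤ 1) →
        ∫ x, ψ' x * h x = ∫ x, ψ x * h (f.1 x) := by
  obtain ⟨e, he⟩ := f.exists_homeomorph_lift hr
  set N := f.1.degree.natAbs with hN
  have hs : ∀ x, f.1.lift (e.symm x) = x := fun x => by rw [← he]; simp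
  let D : ℝ → ℝ := fun x => |f.1.iterDeriv 1 (e.symm x : UnitAddCircle)|⁻¹
  -- The contribution of one inverse branch. On the line the inverse lift is single-valued and
  -- changes by `±1` when its argument moves by `N`, so `t` is `N`-periodic. Summing `t` over `N`
  -- unit translates collects all inverse branches and descends to the circle.
  let t : ℝ → ℝ := fun x => ψ (e.symm x : UnitAddCircle) * D x
  have hD0 : ∀ x, 0 < D x := fun x => inv_pos.2 (abs_pos.2 (f.deriv_ne_zero _))
  have hD1 : ∀ x, D x ≤ 1 := fun x => inv_le_one_of_one_le₀ (f.2 _).le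
  have ht0 : ∀ x, 0 < t x := fun x => mul_pos (hψ.pos _) (hD0 x)
  have hper : ∀ x, t (x + N) = t x := fun x => by
    have : ((e.symm (x + N) : ℝ) : UnitAddCircle) = (e.symm x : UnitAddCircle) := by
      rcases f.symm_add_nat hr he with ⟨h, -⟩ | ⟨h, -⟩
      · rw [h, AddCircle.coe_add, AddCircle.coe_period, add_zero]
      · rw [h, AddCircle.coe_sub, AddCircle.coe_period, sub_zero]
    simp only [t, D, this]
  have hec : Continuous fun x : ℝ => (e.symm x : UnitAddCircle) :=
    continuous_coe.comp e.symm.continuous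
  have htc : Continuous t :=
    (hψ.continuous.comp hec).mul ((((f.continuous_deriv hr).comp hec).abs).inv₀
      fun x => (abs_pos.2 (f.deriv_ne_zero _)).ne')
  have htle : ∀ x, t x ≤ Real.exp a := fun x =>
    (mul_le_of_le_one_right (hψ.pos _).le (hD1 x)).trans (hψ.le_exp _)
  let p : ℝ → ℝ := fun x => ∑ j ∈ Finset.range N, t (x + j)
  have hpper : Function.Periodic p 1 := fun x => by
    have h1 := Finset.sum_range_succ (fun j : ℕ => t (x + j)) N
    rw [Finset.sum_range_succ', hper, Nat.cast_zero, add_zero, add_left_inj] at h1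
    simp only [p]
    rw [← h1]
    refine Finset.sum_congr rfl fun j _ => ?_
    congr 1
    push_cast
    ring
  have hN0 : N ≠ 0 := by
    have := f.degree_ne_zero hr
    simpa [hN] using this
  have hcoe : ∀ x : ℝ, hpper.lift (x : UnitAddCircle) = p x := fun x => hpper.lift_coe x
  have hint : ∀ h : UnitAddCircle → ℝ, Measurable h → (∀ x, |h x| ≤ 1) →
        ∫ x, hpper.lift x * h x = ∫ x, ψ x * h (f.1 x) := by
    intro h hm hb
    have hth : ∀ u v : ℝ, IntervalIntegrable (fun x => t x * h (x : UnitAddCircle)) volume u v := by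
      intro u v
      rw [intervalIntegrable_iff]
      refine Measure.integrableOn_of_bounded (M := Real.exp a) (by simp)
        (htc.measurable.mul (hm.comp continuous_coe.measurable)).aestronglyMeasurable
        (ae_of_all _ fun x => ?_)
      rw [norm_mul, Real.norm_eq_abs, Real.norm_eq_abs, abs_of_pos (ht0 x)]
      calc _ ≤ Real.exp a * 1 := by
            gcongr
            · exact htle x
            · exact hb _
        _ = _ := mul_one _
    have h1 : ∫ x, hpper.lift x * h x =
        ∫ x in (0 : ℝ)..(N : ℝ), t x * h (x : UnitAddCircle) := by
      rw [← UnitAddCircle.intervalIntegral_preimage 0]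
      simp only [hcoe, p, Finset.sum_mul, zero_add]
      have hshift : ∀ j : ℕ, ∀ x : ℝ, t (x + j) * h (x : UnitAddCircle) =
          t (x + j) * h ((x + j : ℝ) : UnitAddCircle) := fun j x => by
        congr 2
        rw [AddCircle.coe_add]
        have : ((j : ℝ) : UnitAddCircle) = 0 :=
          (AddCircle.coe_eq_zero_iff 1).2 ⟨j, by simp⟩
        rw [this, add_zero]
      simp only [hshift]
      rw [intervalIntegral.integral_finsetSum]
      · have h2 : ∀ j : ℕ, ∫ x in (0 : ℝ)..1, t (x + j) * h ((x + j : ℝ) : UnitAddCircle) =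
            ∫ x in (j : ℝ)..((j + 1 : ℕ) : ℝ), t x * h (x : UnitAddCircle) := fun j => by
          rw [intervalIntegral.integral_comp_add_right
            (fun x => t x * h (x : UnitAddCircle)) (j : ℝ)]
          push_cast
          rw [zero_add, add_comm]
        simp only [h2]
        rw [intervalIntegral.sum_integral_adjacent_intervals (a := fun j : ℕ => (j : ℝ))
          (fun j _ => hth _ _), Nat.cast_zero]
      · intro j _
        have := (hth (0 + j) (1 + j)).comp_add_right (j : ℝ)
        simpa using this
    -- The sum over branches has been unfolded into one integral over `[0, N]`, which the inverse
    -- lift carries, up to a null set, onto a fundamental domain of the circle. The remaining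
    -- identity is a change of variables.
    obtain ⟨b, hb'⟩ := f.symm_image_Ioc_ae_eq hr he
    rw [h1, intervalIntegral.integral_of_le (by positivity), integral_eq_setIntegral b,
      ← setIntegral_congr_set hb',
      integral_image_eq_integral_abs_deriv_smul measurableSet_Ioc
        (fun x _ => (f.hasDerivAt_symm hr he x).hasDerivWithinAt) e.symm.injective.injOn]
    refine setIntegral_congr_fun measurableSet_Ioc fun x _ => ?_
    simp only [t, D, ← f.1.coe_lift, hs, smul_eq_mul, abs_inv]
    ring
  refine ⟨hpper.lift, ⟨fun x => ?_, fun x y => ?_, ?_⟩, hint⟩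
  · obtain ⟨y, -, rfl⟩ := exists_coe_eq x
    rw [hcoe]
    exact Finset.sum_pos (fun j _ => ht0 _) (Finset.nonempty_range_iff.2 hN0)
  · rw [hcoe, hcoe, Finset.mul_sum]
    refine Finset.sum_le_sum fun j _ => ?_
    have h1 : |x + j - (y + j)| = |x - y| := by congr 1; ring
    have h2 := hψ.le (e.symm (x + j)) (e.symm (y + j))
    have h3 := f.abs_symm_sub_le hr he (x + j) (y + j)
    have h4 := f.abs_log_deriv_symm_sub_le hr he (x + j) (y + j)
    rw [h1] at h3 h4
    -- The Lipschitz constant has two sources: the inverse branch multiplies the old constant by at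
    -- most `1 / min|f'|`, and the Jacobian adds the `C²` norm.
    have h5 : D (x + j) ≤ Real.exp (f.1.c2Norm * |x - y|) * D (y + j) := by
      rw [← Real.log_le_log_iff (hD0 _) (mul_pos (Real.exp_pos _) (hD0 _)),
        Real.log_mul (Real.exp_pos _).ne' (hD0 _).ne', Real.log_exp]
      have := (abs_le.1 h4).2
      simp only [D]
      linarith
    calc t (x + j) ≤ (Real.exp (a * |e.symm (x + j) - e.symm (y + j)|) *
          ψ (e.symm (y + j) : UnitAddCircle)) *
            (Real.exp (f.1.c2Norm * |x - y|) * D (y + j)) :=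
          mul_le_mul h2 h5 (hD0 _).le ((hψ.pos _).le.trans h2)
      _ ≤ (Real.exp (a * (f.1.minDeriv⁻¹ * |x - y|)) *
          ψ (e.symm (y + j) : UnitAddCircle)) *
            (Real.exp (f.1.c2Norm * |x - y|) * D (y + j)) := by
          have := hψ.nonneg
          have := (hψ.pos (e.symm (y + j) : UnitAddCircle)).le
          have := (hD0 (y + j)).le
          gcongr
      _ = Real.exp ((f.1.minDeriv⁻¹ * a + f.1.c2Norm) * |x - y|) * t (y + j) := by
          rw [add_mul, Real.exp_add]
          simp only [t]
          rw [show a * (f.1.minDeriv⁻¹ * |x - y|) = f.1.minDeriv⁻¹ * a * |x - y| by ring]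
          ring
  · have := hint (fun _ => 1) measurable_const (by simp)
    simpa [hψ.integral] using this

end Expanding

end RandomCircle

end

noncomputable section

/-! ### The Markov operator and its loss of memory in total variation. -/

namespace RandomCircle

variable {r : ℕ∞}

/-- Measurable test functions with values in `[-1, 1]`. -/
structure IsTest (h : UnitAddCircle → ℝ) : Prop where
  measurable : Measurable h
  abs_le_one : ∀ x, |h x| ≤ 1

/-- The Markov operator `h ↦ ∫ h ∘ f dν(f)`. -/
def markov (ν : Measure (Expanding r)) (h : UnitAddCircle → ℝ) (x : UnitAddCircle) : ℝ :=
  ∫ f, h (f.1 x) ∂ν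

variable {ν : Measure (Expanding r)} [IsProbabilityMeasure ν]

theorem IsTest.comp_eval {h : UnitAddCircle → ℝ} (hh : IsTest h) :
    Measurable fun p : UnitAddCircle × Expanding r => h (p.2.1 p.1) :=
  hh.measurable.comp (Expanding.measurable_eval.comp measurable_swap)

theorem IsTest.integrable_mul {h : UnitAddCircle → ℝ} (hh : IsTest h) {μ : Measure UnitAddCircle}
    {φ : UnitAddCircle → ℝ} (hφ : Integrable φ μ) : Integrable (fun x => φ x * h x) μ :=
  hφ.mul_bdd (c := 1) hh.measurable.aestronglyMeasurable (ae_of_all _ hh.abs_le_one)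

theorem IsTest.comp {h : UnitAddCircle → ℝ} (hh : IsTest h) (f : Expanding r) :
    IsTest fun x => h (f.1 x) :=
  ⟨hh.measurable.comp f.measurable_map, fun _ => hh.abs_le_one _⟩

theorem IsTest.markov {h : UnitAddCircle → ℝ} (hh : IsTest h) : IsTest (markov ν h) := by
  refine ⟨?_, fun x => ?_⟩
  · exact (hh.comp_eval.stronglyMeasurable.integral_prod_right').measurable
  · have : ‖∫ f, h (f.1 x) ∂ν‖ ≤ 1 * ν.real Set.univ :=
      norm_integral_le_of_norm_le_const (ae_of_all _ fun f => hh.abs_le_one (f.1 x))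
    simpa [RandomCircle.markov] using this

theorem IsTest.iterate_markov {h : UnitAddCircle → ℝ} (hh : IsTest h) (n : ℕ) :
    IsTest ((RandomCircle.markov ν)^[n] h) := by
  induction n with
  | zero => exact hh
  | succ n ih => rw [Function.iterate_succ_apply']; exact ih.markov

theorem integral_mul_markov {h : UnitAddCircle → ℝ} (hh : IsTest h) {μ : Measure UnitAddCircle}
    [SFinite μ] {φ : UnitAddCircle → ℝ} (hφ : Integrable φ μ) :
    ∫ x, φ x * markov ν h x ∂μ = ∫ f, ∫ x, φ x * h (f.1 x) ∂μ ∂ν := by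
  simp only [markov, ← integral_const_mul]
  rw [integral_integral_swap]
  have h1 : Integrable (fun p : UnitAddCircle × Expanding r => φ p.1) (μ.prod ν) := hφ.comp_fst ν
  exact h1.mul_bdd (c := 1) hh.comp_eval.aestronglyMeasurable
    (ae_of_all _ fun p => hh.abs_le_one _)

theorem measurable_integral_mul_comp {h : UnitAddCircle → ℝ} (hh : IsTest h)
    {φ : UnitAddCircle → ℝ} (hφ : Measurable φ) :
    Measurable fun f : Expanding r => ∫ x, φ x * h (f.1 x) := by
  have : Measurable fun p : Expanding r × UnitAddCircle => φ p.2 * h (p.1.1 p.2) :=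
    (hφ.comp measurable_snd).mul (hh.measurable.comp Expanding.measurable_eval)
  exact (this.stronglyMeasurable.integral_prod_right').measurable

/-- The worst difference after `n` steps between two densities of a cone, tested against functions
bounded by `1`. -/
def coneGap (ν : Measure (Expanding r)) (n : ℕ) (a : ℝ) : ℝ≥0∞ :=
  ⨆ (ψ₁ : UnitAddCircle → ℝ) (ψ₂ : UnitAddCircle → ℝ) (h : UnitAddCircle → ℝ)
    (_ : LogLipDensity a ψ₁) (_ : LogLipDensity a ψ₂) (_ : IsTest h),
    ‖∫ x, (ψ₁ x - ψ₂ x) * (markov ν)^[n] h x‖ₑ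

theorem le_coneGap {n : ℕ} {a : ℝ} {ψ₁ ψ₂ h : UnitAddCircle → ℝ} (h₁ : LogLipDensity a ψ₁)
    (h₂ : LogLipDensity a ψ₂) (hh : IsTest h) :
    ‖∫ x, (ψ₁ x - ψ₂ x) * (markov ν)^[n] h x‖ₑ ≤ coneGap ν n a :=
  le_iSup_of_le ψ₁ (le_iSup_of_le ψ₂ (le_iSup_of_le h (le_iSup_of_le h₁ (le_iSup_of_le h₂
    (le_iSup_of_le hh le_rfl)))))

theorem coneGap_le {n : ℕ} {a : ℝ} {c : ℝ≥0∞}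
    (H : ∀ ψ₁ ψ₂ h : UnitAddCircle → ℝ, LogLipDensity a ψ₁ → LogLipDensity a ψ₂ → IsTest h →
      ‖∫ x, (ψ₁ x - ψ₂ x) * (markov ν)^[n] h x‖ₑ ≤ c) : coneGap ν n a ≤ c :=
  iSup_le fun ψ₁ => iSup_le fun ψ₂ => iSup_le fun h => iSup_le fun h₁ => iSup_le fun h₂ =>
    iSup_le fun hh => H ψ₁ ψ₂ h h₁ h₂ hh

theorem coneGap_mono (n : ℕ) : Monotone (coneGap ν n) := fun _ _ hab =>
  coneGap_le fun _ _ _ h₁ h₂ hh => le_coneGap (h₁.mono hab) (h₂.mono hab) hh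

theorem coneGap_le_two (n : ℕ) (a : ℝ) : coneGap ν n a ≤ 2 := by
  refine coneGap_le fun ψ₁ ψ₂ h h₁ h₂ hh => ?_
  have hq := hh.iterate_markov (ν := ν) n
  have h3 : ‖∫ x, (ψ₁ x - ψ₂ x) * (markov ν)^[n] h x‖ ≤ ∫ x, (ψ₁ x + ψ₂ x) := by
    refine norm_integral_le_of_norm_le (h₁.integrable.add h₂.integrable)
      (ae_of_all _ fun x => ?_)
    have h4 := hq.abs_le_one x
    have h5 := h₁.pos x
    have h6 := h₂.pos x
    rw [norm_mul, Real.norm_eq_abs, Real.norm_eq_abs]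
    calc _ ≤ (ψ₁ x + ψ₂ x) * 1 := by
          gcongr
          rw [abs_le]
          constructor <;> linarith
      _ = _ := mul_one _
  rw [integral_add h₁.integrable h₂.integrable, h₁.integral, h₂.integral] at h3
  rw [← ofReal_norm]
  refine (ENNReal.ofReal_le_ofReal h3).trans ?_
  norm_num

/-- Half of the guaranteed minimum, `exp (-a) / 2`, is common to both densities and cancels in their
difference. The remainders, renormalised to mass `1`, lie in the cone of constant `2 a`, and the
normalisation is the gained factor. -/
theorem coneGap_le_mul (n : ℕ) (a : ℝ) :
    coneGap ν n a ≤ ENNReal.ofReal (1 - Real.exp (-a) / 2) * coneGap ν n (2 * a) := by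
  refine coneGap_le fun ψ₁ ψ₂ h h₁ h₂ hh => ?_
  have ha := h₁.nonneg
  have h0 : Real.exp (-a) ≤ 1 := by rw [Real.exp_le_one_iff]; linarith
  set c := 1 - Real.exp (-a) / 2 with hc
  have hc0 : 0 < c := by linarith
  have : ∫ x, (ψ₁ x - ψ₂ x) * (markov ν)^[n] h x = c * ∫ x, ((c⁻¹ * (ψ₁ x - Real.exp (-a) / 2)) -
      (c⁻¹ * (ψ₂ x - Real.exp (-a) / 2))) * (markov ν)^[n] h x := by
    rw [← integral_const_mul]
    refine integral_congr_ae (ae_of_all _ fun x => ?_)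
    field_simp
    ring
  rw [this, enorm_mul, Real.enorm_of_nonneg hc0.le]
  gcongr
  exact le_coneGap h₁.sub_const h₂.sub_const hh

/-- Condition on the first map: the same `f` acts on both densities and sends them to a common cone.
-/
theorem coneGap_succ_le (hr : 2 ≤ r) (n : ℕ) (a : ℝ) :
    coneGap ν (n + 1) a ≤ ∫⁻ f, coneGap ν n (f.1.minDeriv⁻¹ * a + f.1.c2Norm) ∂ν := by
  refine coneGap_le fun ψ₁ ψ₂ h h₁ h₂ hh => ?_
  have hq := hh.iterate_markov (ν := ν) n
  rw [Function.iterate_succ_apply', integral_mul_markov (φ := fun x => ψ₁ x - ψ₂ x) hq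
    (h₁.integrable.sub h₂.integrable)]
  refine (enorm_integral_le_lintegral_enorm _).trans (lintegral_mono fun f => ?_)
  obtain ⟨ψ₁', h₁', e₁⟩ := f.exists_transfer hr h₁
  obtain ⟨ψ₂', h₂', e₂⟩ := f.exists_transfer hr h₂
  have : ∫ x, (ψ₁ x - ψ₂ x) * (markov ν)^[n] h (f.1 x) =
      ∫ x, (ψ₁' x - ψ₂' x) * (markov ν)^[n] h x := by
    simp only [sub_mul]
    rw [integral_sub ((hq.comp f).integrable_mul h₁.integrable)
      ((hq.comp f).integrable_mul h₂.integrable), integral_sub (hq.integrable_mul h₁'.integrable)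
      (hq.integrable_mul h₂'.integrable), e₁ _ hq.measurable hq.abs_le_one,
      e₂ _ hq.measurable hq.abs_le_one]
  rw [this]
  exact le_coneGap h₁' h₂' hh

theorem coneGap_add_le (hr : 2 ≤ r) (n m : ℕ) (a : ℝ) :
    coneGap ν (n + m) a ≤
      perpetuityMean ν (fun f => f.1.minDeriv⁻¹) (fun f => f.1.c2Norm) (coneGap ν n) m a := by
  induction m generalizing a with
  | zero => exact le_rfl
  | succ m ih => exact (coneGap_succ_le hr (n + m) a).trans (lintegral_mono fun f => ih _)

/-- After `m` random steps the starting density is still in a cone, with a random constant, and it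
is compared there with the constant density `1`. The remaining `n` steps provide the contraction. -/
theorem enorm_integral_iterate_markov_sub_le (hr : 2 ≤ r) (n m : ℕ) {a : ℝ}
    {ψ h : UnitAddCircle → ℝ} (hψ : LogLipDensity a ψ) (hh : IsTest h) :
    ‖(∫ x, ψ x * (markov ν)^[n + m] h x) - ∫ x, (markov ν)^[n] h x‖ₑ ≤
      perpetuityMean ν (fun f => f.1.minDeriv⁻¹) (fun f => f.1.c2Norm) (coneGap ν n) m a := by
  induction m generalizing a ψ with
  | zero =>
    have hq := hh.iterate_markov (ν := ν) n
    have := le_coneGap (ν := ν) (n := n) hψ (LogLipDensity.const hψ.nonneg) hh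
    simp only [sub_mul, one_mul] at this
    rw [integral_sub (hq.integrable_mul hψ.integrable)
      (by simpa using hq.integrable_mul (integrable_const (1 : ℝ)))] at this
    exact this
  | succ m ih =>
    have hq := hh.iterate_markov (ν := ν) (n + m)
    rw [← add_assoc, Function.iterate_succ_apply', integral_mul_markov hq hψ.integrable]
    set J := ∫ x, (markov ν)^[n] h x
    have hi : Integrable (fun f : Expanding r => ∫ x, ψ x * (markov ν)^[n + m] h (f.1 x)) ν := by
      refine Integrable.of_bound (C := 1) (measurable_integral_mul_comp hq
        hψ.continuous.measurable).aestronglyMeasurable (ae_of_all _ fun f => ?_)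
      refine le_of_le_of_eq (norm_integral_le_of_norm_le hψ.integrable
        (ae_of_all _ fun x => ?_)) hψ.integral
      rw [norm_mul, Real.norm_eq_abs, Real.norm_eq_abs, abs_of_pos (hψ.pos x)]
      exact mul_le_of_le_one_right (hψ.pos x).le (hq.abs_le_one _)
    have : (∫ f : Expanding r, (∫ x, ψ x * (markov ν)^[n + m] h (f.1 x)) ∂ν) - J =
        ∫ f : Expanding r, ((∫ x, ψ x * (markov ν)^[n + m] h (f.1 x)) - J) ∂ν := by
      rw [integral_sub hi (integrable_const _)]
      simp
    rw [this]
    refine (enorm_integral_le_lintegral_enorm _).trans (lintegral_mono fun f => ?_)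
    obtain ⟨ψ', h', e⟩ := f.exists_transfer hr hψ
    rw [← e _ hq.measurable hq.abs_le_one]
    exact ih h'

theorem perpetuityMean_coneGap (hr : 2 ≤ r) (n m : ℕ) (a : ℝ) :
    perpetuityMean ν (fun f => f.1.minDeriv⁻¹) (fun f => f.1.c2Norm) (coneGap ν n) m a =
      ∫⁻ ω, coneGap ν n (perpetuity (fun f : Expanding r => f.1.minDeriv⁻¹)
        (fun f => f.1.c2Norm) m ω a) ∂(Measure.infinitePi fun _ : ℕ => ν) :=
  perpetuityMean_eq_lintegral (Expanding.measurable_minDeriv hr).inv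
    (Expanding.measurable_c2Norm hr) (coneGap_mono n).measurable m a

theorem exists_eventually_perpetuity_tight (hr : 2 ≤ r)
    (hν : Integrable (fun f : Expanding r => Real.log f.1.c2Norm) ν) {ε : ℝ≥0∞} (hε : 0 < ε) :
    ∃ M : ℝ, 0 ≤ M ∧ ∀ a : ℝ, ∀ᶠ m in atTop, (Measure.infinitePi fun _ : ℕ => ν)
      {ω | M < perpetuity (fun f : Expanding r => f.1.minDeriv⁻¹)
        (fun f => f.1.c2Norm) m ω a} ≤ ε :=
  exists_eventually_measure_perpetuity_le (Expanding.measurable_minDeriv hr).inv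
    (Expanding.measurable_c2Norm hr)
    (fun f => inv_pos.2 (by linarith [f.one_lt_minDeriv hr]))
    (fun f => inv_lt_one_of_one_lt₀ (f.one_lt_minDeriv hr))
    (fun f => by linarith [f.one_lt_c2Norm hr])
    (Expanding.integrable_log_inv_minDeriv hr hν) hν hε

theorem exists_perpetuity_tight (hr : 2 ≤ r)
    (hν : Integrable (fun f : Expanding r => Real.log f.1.c2Norm) ν) {ε : ℝ≥0∞} (hε : 0 < ε) :
    ∃ M : ℝ, 0 ≤ M ∧ (Measure.infinitePi fun _ : ℕ => ν)
      {ω | ∃ m, M < perpetuity (fun f : Expanding r => f.1.minDeriv⁻¹)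
        (fun f => f.1.c2Norm) m ω 0} ≤ ε :=
  exists_forall_measure_perpetuity_le (Expanding.measurable_minDeriv hr).inv
    (Expanding.measurable_c2Norm hr)
    (fun f => inv_pos.2 (by linarith [f.one_lt_minDeriv hr]))
    (fun f => inv_lt_one_of_one_lt₀ (f.one_lt_minDeriv hr))
    (fun f => by linarith [f.one_lt_c2Norm hr])
    (Expanding.integrable_log_inv_minDeriv hr hν) hν hε

/-- With probability at least one half the factor is at most `1 - exp (-M) / 2`, and otherwise at
most `1`; the average loses `exp (-M) / 4`. -/
theorem lintegral_one_sub_exp_le {Ω : Type*} [MeasurableSpace Ω] {P : Measure Ω}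
    [IsProbabilityMeasure P] {b : Ω → ℝ} (hb : Measurable b) {M : ℝ} (hM : 0 ≤ M)
    (h : P {ω | M < b ω} ≤ 1 / 2) :
    ∫⁻ ω, ENNReal.ofReal (1 - Real.exp (-b ω) / 2) ∂P ≤
      ENNReal.ofReal (1 - Real.exp (-M) / 4) := by
  have hms : MeasurableSet {ω | M < b ω} := measurableSet_lt measurable_const hb
  have h0 := Real.exp_pos (-M)
  have h1 : Real.exp (-M) ≤ 1 := by rw [Real.exp_le_one_iff]; linarith
  calc ∫⁻ ω, ENNReal.ofReal (1 - Real.exp (-b ω) / 2) ∂P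
      ≤ ∫⁻ ω, (ENNReal.ofReal (1 - Real.exp (-M) / 2) +
          Set.indicator {ω | M < b ω} (fun _ => ENNReal.ofReal (Real.exp (-M) / 2)) ω) ∂P := by
        refine lintegral_mono fun ω => ?_
        by_cases hω : M < b ω
        · rw [Set.indicator_of_mem (by exact hω), ← ENNReal.ofReal_add (by linarith) (by linarith)]
          refine ENNReal.ofReal_le_ofReal ?_
          have := Real.exp_pos (-b ω)
          linarith
        · rw [Set.indicator_of_notMem (by exact hω), add_zero]
          refine ENNReal.ofReal_le_ofReal ?_
          have : Real.exp (-M) ≤ Real.exp (-b ω) := Real.exp_le_exp.2 (by linarith [not_lt.1 hω])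
          linarith
    _ = ENNReal.ofReal (1 - Real.exp (-M) / 2) +
          ENNReal.ofReal (Real.exp (-M) / 2) * P {ω | M < b ω} := by
        rw [lintegral_add_left measurable_const, lintegral_indicator hms]
        simp
    _ ≤ ENNReal.ofReal (1 - Real.exp (-M) / 2) +
          ENNReal.ofReal (Real.exp (-M) / 2) * ENNReal.ofReal (1 / 2) := by
        gcongr
        refine h.trans (le_of_eq ?_)
        rw [ENNReal.ofReal_div_of_pos (by norm_num)]
        simp
    _ = _ := by
        rw [← ENNReal.ofReal_mul (by linarith), ← ENNReal.ofReal_add (by linarith) (by linarith)]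
        congr 1
        ring

/-- Let `s` be the supremum over all cones of the asymptotic gap. Waiting until the random constant
is below `M` with probability one half, and cancelling there, gives `s ≤ θ s` with `θ < 1`; as `s ≤
2` is finite, `s = 0`. It matters that the tightness bound `M`, and hence `θ`, does not depend on
`a`. -/
theorem limsup_coneGap_eq_zero (hr : 2 ≤ r)
    (hν : Integrable (fun f : Expanding r => Real.log f.1.c2Norm) ν) (a : ℝ) :
    limsup (fun n => coneGap ν n a) atTop = 0 := by
  set s : ℝ≥0∞ := ⨆ a, limsup (fun n => coneGap ν n a) atTop with hs
  have hs2 : s ≤ 2 := iSup_le fun a => limsup_le_of_le (h := Eventually.of_forall fun n =>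
    coneGap_le_two n a)
  obtain ⟨M, hM0, hM⟩ := exists_eventually_perpetuity_tight hr hν
    (show (0 : ℝ≥0∞) < 1 / 2 by simp)
  set θ := ENNReal.ofReal (1 - Real.exp (-M) / 4) with hθ
  have hθ1 : θ < 1 := by
    rw [hθ, ENNReal.ofReal_lt_one]
    linarith [Real.exp_pos (-M)]
  have key : ∀ a, limsup (fun n => coneGap ν n a) atTop ≤ θ * s := by
    intro a
    -- Only the waiting time `m` depends on `a`. The limsup passes under the integral by the reverse
    -- Fatou lemma, thanks to the uniform bound `2` on the gap.
    obtain ⟨m, hm⟩ := (hM a).exists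
    set b : (ℕ → Expanding r) → ℝ := fun ω => perpetuity (fun f : Expanding r => f.1.minDeriv⁻¹)
        (fun f => f.1.c2Norm) m ω a with hb
    have hbm : Measurable b := measurable_perpetuity (Expanding.measurable_minDeriv hr).inv
      (Expanding.measurable_c2Norm hr) m a
    have hcm : Measurable fun ω => ENNReal.ofReal (1 - Real.exp (-b ω) / 2) := by fun_prop
    have hgm : ∀ n, Measurable fun ω => coneGap ν n (2 * b ω) := fun n =>
      (coneGap_mono n).measurable.comp (hbm.const_mul 2)
    calc limsup (fun n => coneGap ν n a) atTop
        = limsup (fun n => coneGap ν (n + m) a) atTop := (limsup_nat_add _ m).symm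
      _ ≤ limsup (fun n => ∫⁻ ω, ENNReal.ofReal (1 - Real.exp (-b ω) / 2) *
            coneGap ν n (2 * b ω) ∂(Measure.infinitePi fun _ : ℕ => ν)) atTop := by
          refine limsup_le_limsup (Eventually.of_forall fun n => ?_)
          refine (coneGap_add_le hr n m a).trans ?_
          rw [perpetuityMean_coneGap hr]
          exact lintegral_mono fun ω => coneGap_le_mul n _
      _ ≤ ∫⁻ ω, limsup (fun n => ENNReal.ofReal (1 - Real.exp (-b ω) / 2) *
            coneGap ν n (2 * b ω)) atTop ∂(Measure.infinitePi fun _ : ℕ => ν) := by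
          refine limsup_lintegral_le (fun ω => ENNReal.ofReal (1 - Real.exp (-b ω) / 2) * 2)
            (fun n => hcm.mul (hgm n)) (fun n => ae_of_all _ fun ω => ?_) ?_
          · dsimp only
            gcongr
            exact coneGap_le_two n _
          · rw [lintegral_mul_const _ hcm]
            exact ENNReal.mul_ne_top
              ((lintegral_one_sub_exp_le hbm hM0 hm).trans_lt ENNReal.ofReal_lt_top).ne (by simp)
      _ ≤ ∫⁻ ω, ENNReal.ofReal (1 - Real.exp (-b ω) / 2) * s
            ∂(Measure.infinitePi fun _ : ℕ => ν) := by
          refine lintegral_mono fun ω => ?_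
          rw [ENNReal.limsup_const_mul_of_ne_top ENNReal.ofReal_ne_top]
          gcongr
          exact le_iSup (fun a => limsup (fun n => coneGap ν n a) atTop) _
      _ ≤ θ * s := by
          rw [lintegral_mul_const _ hcm]
          gcongr
          exact lintegral_one_sub_exp_le hbm hM0 hm
  have hs0 : s = 0 := by
    by_contra h0
    have h1 : s ≤ θ * s := iSup_le key
    have h2 : θ * s < 1 * s := ENNReal.mul_lt_mul_left h0 (hs2.trans_lt (by simp)).ne hθ1
    rw [one_mul] at h2
    exact absurd h1 (not_le.2 h2)
  exact le_antisymm (hs0 ▸ le_iSup (fun a => limsup (fun n => coneGap ν n a) atTop) a) bot_le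

theorem tendsto_coneGap (hr : 2 ≤ r)
    (hν : Integrable (fun f : Expanding r => Real.log f.1.c2Norm) ν) (a : ℝ) :
    Tendsto (fun n => coneGap ν n a) atTop (𝓝 0) :=
  tendsto_of_le_liminf_of_limsup_le bot_le (limsup_coneGap_eq_zero hr hν a).le

/-- The laws at time `n` of the walk started from Lebesgue measure form a Cauchy sequence,
uniformly over test functions. -/
theorem exists_forall_integral_iterate_markov_sub_le (hr : 2 ≤ r)
    (hν : Integrable (fun f : Expanding r => Real.log f.1.c2Norm) ν) {ε : ℝ} (hε : 0 < ε) :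
    ∃ N, ∀ n ≥ N, ∀ m, ∀ h : UnitAddCircle → ℝ, IsTest h →
      |(∫ x, (markov ν)^[n + m] h x) - ∫ x, (markov ν)^[n] h x| ≤ ε := by
  obtain ⟨M, hM0, hM⟩ := exists_perpetuity_tight hr hν
    (show (0 : ℝ≥0∞) < ENNReal.ofReal (ε / 4) by simpa using hε)
  have h2 := (tendsto_coneGap hr hν M).eventually_le_const
    (show (0 : ℝ≥0∞) < ENNReal.ofReal (ε / 2) by simpa using hε)
  obtain ⟨N, hN⟩ := eventually_atTop.1 h2
  refine ⟨N, fun n hn m h hh => ?_⟩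
  -- Lebesgue measure has constant `a = 0`, for which the recursion is tight uniformly in `m`.
  -- Outside an event of probability `ε / 4`, where the gap is at most `2`, the constant is at most
  -- `M` and the gap is at most `ε / 2`.
  have h3 := enorm_integral_iterate_markov_sub_le (ν := ν) hr n m (LogLipDensity.const le_rfl) hh
  rw [perpetuityMean_coneGap hr] at h3
  simp only [one_mul] at h3
  rw [← Real.norm_eq_abs, ← ENNReal.ofReal_le_ofReal_iff hε.le, ofReal_norm]
  refine h3.trans ?_
  set b : (ℕ → Expanding r) → ℝ := fun ω => perpetuity (fun f : Expanding r => f.1.minDeriv⁻¹)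
      (fun f => f.1.c2Norm) m ω 0 with hb
  have hbm : Measurable b := measurable_perpetuity (Expanding.measurable_minDeriv hr).inv
    (Expanding.measurable_c2Norm hr) m 0
  have hms : MeasurableSet {ω | M < b ω} := measurableSet_lt measurable_const hbm
  calc ∫⁻ ω, coneGap ν n (b ω) ∂(Measure.infinitePi fun _ : ℕ => ν)
      ≤ ∫⁻ ω, (ENNReal.ofReal (ε / 2) + Set.indicator {ω | M < b ω} (fun _ => 2) ω)
          ∂(Measure.infinitePi fun _ : ℕ => ν) := by
        refine lintegral_mono fun ω => ?_
        by_cases hω : M < b ω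
        · rw [Set.indicator_of_mem (by exact hω)]
          exact (coneGap_le_two n _).trans le_add_self
        · rw [Set.indicator_of_notMem (by exact hω), add_zero]
          exact (coneGap_mono n (not_lt.1 hω)).trans (hN n hn)
    _ = ENNReal.ofReal (ε / 2) + 2 * (Measure.infinitePi fun _ : ℕ => ν) {ω | M < b ω} := by
        rw [lintegral_add_left measurable_const, lintegral_indicator hms]
        simp
    _ ≤ ENNReal.ofReal (ε / 2) + 2 * ENNReal.ofReal (ε / 4) := by
        gcongr
        refine le_trans (measure_mono fun ω hω => ?_) hM
        exact ⟨m, hω⟩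
    _ = ENNReal.ofReal ε := by
        rw [show (2 : ℝ≥0∞) = ENNReal.ofReal 2 by simp, ← ENNReal.ofReal_mul (by norm_num),
          ← ENNReal.ofReal_add (by linarith) (by linarith)]
        congr 1
        ring

end RandomCircle

end

/-! ### Setwise limits of measures; existence and uniqueness of the SRB measure. -/

noncomputable section

/-- Continuous functions on a compact metric space are uniform limits of Lipschitz functions. -/
theorem exists_lipschitz_approx {X : Type*} [PseudoMetricSpace X] [CompactSpace X] [Nonempty X]
    {g : X → ℝ} (hg : Continuous g) {ε : ℝ} (hε : 0 < ε) :
    ∃ (L : ℝ) (φ : X → ℝ), 0 ≤ L ∧ (∀ x y, |φ x - φ y| ≤ L * dist x y) ∧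
      ∀ x, |g x - φ x| ≤ ε := by
  obtain ⟨M, hM⟩ : ∃ M, ∀ x, |g x| ≤ M := by
    obtain ⟨M, hM⟩ := (isCompact_range hg.abs).bddAbove
    exact ⟨M, fun x => hM ⟨x, rfl⟩⟩
  have hM0 : 0 ≤ M := (abs_nonneg _).trans (hM (Classical.arbitrary X))
  obtain ⟨δ, hδ, hδ'⟩ := Metric.uniformContinuous_iff.1
    (CompactSpace.uniformContinuous_of_continuous hg) ε hε
  set L := 2 * M / δ with hL
  have hL0 : 0 ≤ L := by positivity
  -- Inf-convolution with slope `2 M / δ`: beyond distance `δ` the penalty exceeds the oscillation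
  -- of `g`, and within distance `δ` uniform continuity controls it.
  let φ : X → ℝ := fun x => ⨅ y, g y + L * dist x y
  have hbdd : ∀ x, BddBelow (Set.range fun y => g y + L * dist x y) := fun x => by
    refine ⟨-M, ?_⟩
    rintro _ ⟨y, rfl⟩
    have := (abs_le.1 (hM y)).1
    have : 0 ≤ L * dist x y := by positivity
    show _ ≤ g y + L * dist x y
    linarith
  have hle : ∀ x, φ x ≤ g x := fun x => (ciInf_le (hbdd x) x).trans (by simp)
  have hge : ∀ x, g x - ε ≤ φ x := fun x => le_ciInf fun y => by
    rcases lt_or_ge (dist x y) δ with h | h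
    · have h1 := hδ' h
      rw [Real.dist_eq] at h1
      have := (abs_lt.1 h1).2
      have : 0 ≤ L * dist x y := by positivity
      linarith
    · have h1 : 2 * M ≤ L * dist x y := by
        rw [hL, div_mul_eq_mul_div, le_div_iff₀ hδ]
        gcongr
      have := (abs_le.1 (hM x)).2
      have := (abs_le.1 (hM y)).1
      linarith
  have hlip : ∀ x y, φ x - φ y ≤ L * dist x y := fun x y => by
    rw [sub_le_iff_le_add', ← sub_le_iff_le_add]
    refine le_ciInf fun z => ?_
    have h1 : φ x ≤ g z + L * dist x z := ciInf_le (hbdd x) z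
    have h2 : L * dist x z ≤ L * (dist x y + dist y z) := by
      gcongr
      exact dist_triangle _ _ _
    linarith
  refine ⟨L, φ, hL0, fun x y => ?_, fun x => ?_⟩
  · rw [abs_le]
    have := hlip y x
    rw [dist_comm] at this
    exact ⟨by linarith, hlip x y⟩
  · rw [abs_le]
    have := hle x
    have := hge x
    constructor <;> linarith

/-- A sequence of probability measures which is Cauchy uniformly over all measurable sets converges
setwise to a probability measure. -/
theorem exists_measure_tendsto_of_uniform_cauchy {Ω : Type*} [MeasurableSpace Ω]
    (μ : ℕ → Measure Ω) [∀ n, IsProbabilityMeasure (μ n)]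
    (H : ∀ ε : ℝ, 0 < ε → ∃ N, ∀ n ≥ N, ∀ m, ∀ A, MeasurableSet A →
      |(μ (n + m)).real A - (μ n).real A| ≤ ε) :
    ∃ μ' : Measure Ω, IsProbabilityMeasure μ' ∧
      ∀ A, MeasurableSet A → Tendsto (fun n => μ n A) atTop (𝓝 (μ' A)) := by
  have hlim : ∀ A, MeasurableSet A → ∃ l, Tendsto (fun n => (μ n).real A) atTop (𝓝 l) := by
    intro A hA
    refine cauchySeq_tendsto_of_complete (Metric.cauchySeq_iff'.2 fun ε hε => ?_)
    obtain ⟨N, hN⟩ := H (ε / 2) (half_pos hε)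
    refine ⟨N, fun n hn => ?_⟩
    obtain ⟨m, rfl⟩ := Nat.exists_eq_add_of_le hn
    rw [Real.dist_eq]
    exact (hN N le_rfl m A hA).trans_lt (half_lt_self hε)
  choose L hL using hlim
  -- The convergence is uniform over sets, so a single `n` serves a countable union and all its
  -- finite subunions at once. This turns the countable additivity of `μ n` into that of the limit.
  have hunif : ∀ ε : ℝ, 0 < ε → ∃ n, ∀ A (hA : MeasurableSet A), |L A hA - (μ n).real A| ≤ ε := by
    intro ε hε
    obtain ⟨N, hN⟩ := H ε hε
    refine ⟨N, fun A hA => ?_⟩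
    have h1 : Tendsto (fun m => |(μ (N + m)).real A - (μ N).real A|) atTop
        (𝓝 |L A hA - (μ N).real A|) := by
      have := (tendsto_add_atTop_iff_nat N).2 (hL A hA)
      simp only [add_comm _ N] at this
      exact (this.sub_const _).abs
    exact le_of_tendsto' h1 fun m => hN N le_rfl m A hA
  have hL0 : ∀ A hA, 0 ≤ L A hA := fun A hA => ge_of_tendsto' (hL A hA) fun n => measureReal_nonneg
  have hadd : ∀ (f : ℕ → Set Ω) (hf : ∀ i, MeasurableSet (f i)),
      Pairwise (Function.onFun Disjoint f) →
        HasSum (fun i => L (f i) (hf i)) (L (⋃ i, f i) (MeasurableSet.iUnion hf)) := by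
    intro f hf hd
    have hfin : ∀ n, HasSum (fun i => (μ n).real (f i)) ((μ n).real (⋃ i, f i)) := fun n => by
      have h1 := measure_iUnion (μ := μ n) hd hf
      have h2 : ∑' i, μ n (f i) ≠ ⊤ := h1 ▸ measure_ne_top _ _
      rw [measureReal_def, h1, ENNReal.tsum_toReal_eq fun i => measure_ne_top _ _]
      exact (ENNReal.summable_toReal h2).hasSum
    have hfinset : ∀ N (A : Set Ω) (hA : MeasurableSet A), A = ⋃ i ∈ Finset.range N, f i →
        ∑ i ∈ Finset.range N, L (f i) (hf i) = L A hA := by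
      intro N A hA hAe
      have h1 : Tendsto (fun n => ∑ i ∈ Finset.range N, (μ n).real (f i)) atTop
          (𝓝 (∑ i ∈ Finset.range N, L (f i) (hf i))) :=
        tendsto_finsetSum _ fun i _ => hL (f i) (hf i)
      refine tendsto_nhds_unique h1 ((hL A hA).congr fun n => ?_)
      rw [hAe, measureReal_biUnion_finset (fun i _ j _ hij => hd hij) (fun i _ => hf i)]
    rw [hasSum_iff_tendsto_nat_of_nonneg (fun i => hL0 _ _), Metric.tendsto_nhds]
    intro ε hε
    obtain ⟨n, hn⟩ := hunif (ε / 3) (by linarith)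
    filter_upwards [Metric.tendsto_nhds.1 (hfin n).tendsto_sum_nat (ε / 3) (by linarith)] with N hN
    have hm : MeasurableSet (⋃ i ∈ Finset.range N, f i) :=
      Finset.measurableSet_biUnion _ fun i _ => hf i
    rw [hfinset N _ hm rfl, Real.dist_eq]
    have h1 := hn _ hm
    have h2 := hn _ (MeasurableSet.iUnion hf)
    rw [← measureReal_biUnion_finset (fun i _ j _ hij => hd hij) (fun i _ => hf i),
      Real.dist_eq] at hN
    rw [abs_lt] at hN ⊢
    rw [abs_le] at h1 h2
    constructor <;> linarith
  have hempty : L ∅ MeasurableSet.empty = 0 :=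
    tendsto_nhds_unique (hL ∅ MeasurableSet.empty) (by simp)
  have huniv : L Set.univ MeasurableSet.univ = 1 :=
    tendsto_nhds_unique (hL _ MeasurableSet.univ) (by simp)
  let μ' : Measure Ω := Measure.ofMeasurable (fun A hA => ENNReal.ofReal (L A hA))
    (by simp [hempty]) (fun f hf hd => by
      rw [← (hadd f hf hd).tsum_eq, ENNReal.ofReal_tsum_of_nonneg (fun i => hL0 _ _)
        (hadd f hf hd).summable])
  have happ : ∀ A (hA : MeasurableSet A), μ' A = ENNReal.ofReal (L A hA) := fun A hA =>
    Measure.ofMeasurable_apply A hA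
  refine ⟨μ', ⟨by rw [happ _ MeasurableSet.univ, huniv]; simp⟩, fun A hA => ?_⟩
  rw [happ A hA]
  exact (ENNReal.tendsto_ofReal (hL A hA)).congr fun n => by simp

namespace RandomCircle

variable {r : ℕ∞} {ν : Measure (Expanding r)} [IsProbabilityMeasure ν]

theorem dist_coe_le (x y : ℝ) : dist (x : UnitAddCircle) (y : UnitAddCircle) ≤ |x - y| := by
  rw [dist_eq_norm, ← AddCircle.coe_sub, UnitAddCircle.norm_eq]
  simpa using round_le (x - y) 0

/-- Adding a constant so that `φ + C ≥ 1` turns the additive Lipschitz bound into a multiplicative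
one, by `1 + t ≤ exp t`. After normalisation this is a density in the cone of constant `L`, to be
compared with the density `1`. -/
theorem exists_forall_abs_integral_lipschitz_le (hr : 2 ≤ r)
    (hν : Integrable (fun f : Expanding r => Real.log f.1.c2Norm) ν) {φ : UnitAddCircle → ℝ}
    {L : ℝ} (hL : 0 ≤ L) (hφ : ∀ x y, |φ x - φ y| ≤ L * dist x y) {ε : ℝ} (hε : 0 < ε) :
    ∃ N, ∀ n ≥ N, ∀ h, IsTest h →
      |∫ x, (φ x - ∫ y, φ y) * (markov ν)^[n] h x| ≤ ε := by
  have hlip : LipschitzWith L.toNNReal φ := LipschitzWith.of_dist_le_mul fun x y => by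
    rw [Real.coe_toNNReal _ hL]
    exact hφ x y
  have hφi : Integrable φ :=
    hlip.continuous.integrable_of_hasCompactSupport (HasCompactSupport.of_compactSpace _)
  obtain ⟨M, hM⟩ : ∃ M, ∀ x, |φ x| ≤ M := by
    obtain ⟨M, hM⟩ := (isCompact_range hlip.continuous.abs).bddAbove
    exact ⟨M, fun x => hM ⟨x, rfl⟩⟩
  set C := 1 + M with hC
  have h1 : ∀ x, 1 ≤ φ x + C := fun x => by have := (abs_le.1 (hM x)).1; linarith
  set I := ∫ x, (φ x + C) with hI
  have hI' : I = (∫ x, φ x) + C := by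
    rw [hI, integral_add hφi (integrable_const C)]
    simp
  have hI1 : 1 ≤ I := by
    have : ∫ _ : UnitAddCircle, (1 : ℝ) ≤ I :=
      integral_mono (integrable_const _) (hφi.add (integrable_const C)) h1
    simpa using this
  have hd : LogLipDensity L fun x => I⁻¹ * (φ x + C) := by
    refine ⟨fun x => mul_pos (by positivity) (by linarith [h1 x]), fun x y => ?_, ?_⟩
    · rw [mul_left_comm]
      refine mul_le_mul_of_nonneg_left ?_ (by positivity)
      have h2 := (abs_le.1 (hφ x y)).2
      have h3 : L * dist (x : UnitAddCircle) y ≤ L * |x - y| := by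
        gcongr
        exact dist_coe_le x y
      have h4 := Real.add_one_le_exp (L * |x - y|)
      have h5 := h1 y
      have h6 : 0 ≤ L * |x - y| := by positivity
      nlinarith
    · rw [integral_const_mul]
      exact inv_mul_cancel₀ (by linarith)
  have h2 := (tendsto_coneGap hr hν L).eventually_le_const
    (show (0 : ℝ≥0∞) < ENNReal.ofReal (ε / I) by simpa using div_pos hε (by linarith))
  obtain ⟨N, hN⟩ := eventually_atTop.1 h2
  refine ⟨N, fun n hn h hh => ?_⟩
  have h3 := (le_coneGap (n := n) hd (LogLipDensity.const hL) hh).trans (hN n hn)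
  have h4 : ∫ x, (φ x - ∫ y, φ y) * (markov ν)^[n] h x =
      I * ∫ x, (I⁻¹ * (φ x + C) - 1) * (markov ν)^[n] h x := by
    rw [← integral_const_mul]
    refine integral_congr_ae (ae_of_all _ fun x => ?_)
    dsimp only
    rw [← mul_assoc, mul_sub, ← mul_assoc, mul_inv_cancel₀ (by linarith), hI']
    ring
  rw [h4, abs_mul, abs_of_pos (by linarith : 0 < I)]
  rw [← ofReal_norm, ENNReal.ofReal_le_ofReal_iff (div_nonneg hε.le (by linarith)),
    Real.norm_eq_abs, le_div_iff₀ (by linarith)] at h3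
  linarith

/-- **Decay**: the Markov operator contracts integrable functions of integral zero to zero,
uniformly over test functions. -/
theorem exists_forall_abs_integral_mul_iterate_markov_le (hr : 2 ≤ r)
    (hν : Integrable (fun f : Expanding r => Real.log f.1.c2Norm) ν) {φ : UnitAddCircle → ℝ}
    (hφ : Integrable φ) (hφ0 : ∫ x, φ x = 0) {ε : ℝ} (hε : 0 < ε) :
    ∃ N, ∀ n ≥ N, ∀ h, IsTest h → |∫ x, φ x * (markov ν)^[n] h x| ≤ ε := by
  -- Budget: replacing `φ` by the Lipschitz function `ψ` costs `2ε/5`, the mean of `ψ` is at most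
  -- `2ε/5` because that of `φ` vanishes, and the centred `ψ` decays below `ε/5`.
  obtain ⟨g, -, hg, hgc, hgi⟩ := hφ.exists_hasCompactSupport_integral_sub_le
    (show 0 < ε / 5 by linarith)
  obtain ⟨L, ψ, hL, hψ, hψg⟩ := exists_lipschitz_approx hgc (show 0 < ε / 5 by linarith)
  have hlip : LipschitzWith L.toNNReal ψ := LipschitzWith.of_dist_le_mul fun x y => by
    rw [Real.coe_toNNReal _ hL]
    exact hψ x y
  have hψi : Integrable ψ :=
    hlip.continuous.integrable_of_hasCompactSupport (HasCompactSupport.of_compactSpace _)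
  have hd : ∫ x, |φ x - ψ x| ≤ 2 * (ε / 5) := by
    calc ∫ x, |φ x - ψ x| ≤ ∫ x, (‖φ x - g x‖ + ε / 5) := by
          refine integral_mono (hφ.sub hψi).abs ((hφ.sub hgi).norm.add (integrable_const _)) ?_
          intro x
          exact (abs_sub_le _ (g x) _).trans (add_le_add le_rfl (hψg x))
      _ = (∫ x, ‖φ x - g x‖) + ε / 5 := by
          have hi : Integrable fun x => ‖φ x - g x‖ := (hφ.sub hgi).norm
          rw [integral_add hi (integrable_const _)]
          simp
      _ ≤ 2 * (ε / 5) := by linarith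
  have hI : |∫ x, ψ x| ≤ 2 * (ε / 5) := by
    have : ∫ x, ψ x = -∫ x, (φ x - ψ x) := by rw [integral_sub hφ hψi, hφ0]; ring
    rw [this, abs_neg]
    exact (abs_integral_le_integral_abs).trans hd
  obtain ⟨N, hN⟩ := exists_forall_abs_integral_lipschitz_le hr hν hL hψ
    (show 0 < ε / 5 by linarith)
  refine ⟨N, fun n hn h hh => ?_⟩
  have hq := hh.iterate_markov (ν := ν) n
  have h1 : ∫ x, φ x * (markov ν)^[n] h x = (∫ x, (φ x - ψ x) * (markov ν)^[n] h x) +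
      (∫ x, (ψ x - ∫ y, ψ y) * (markov ν)^[n] h x) +
        ∫ x, (∫ y, ψ y) * (markov ν)^[n] h x := by
    rw [← integral_add (hq.integrable_mul (φ := fun x => φ x - ψ x) (hφ.sub hψi))
        (hq.integrable_mul (φ := fun x => ψ x - ∫ y, ψ y) (hψi.sub (integrable_const _))),
      ← integral_add]
    · refine integral_congr_ae (ae_of_all _ fun x => ?_)
      dsimp only
      ring
    · exact (hq.integrable_mul (φ := fun x => φ x - ψ x) (hφ.sub hψi)).add
        (hq.integrable_mul (φ := fun x => ψ x - ∫ y, ψ y) (hψi.sub (integrable_const _)))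
    · exact hq.integrable_mul (integrable_const _)
  have hbd : ∀ u : UnitAddCircle → ℝ, Integrable u →
      |∫ x, u x * (markov ν)^[n] h x| ≤ ∫ x, |u x| := fun u hu => by
    rw [← Real.norm_eq_abs]
    refine norm_integral_le_of_norm_le hu.abs (ae_of_all _ fun x => ?_)
    rw [norm_mul, Real.norm_eq_abs, Real.norm_eq_abs]
    exact mul_le_of_le_one_right (abs_nonneg _) (hq.abs_le_one x)
  have h2 := hbd _ (hφ.sub hψi)
  have h3 := hbd _ (integrable_const (∫ y, ψ y))
  simp only [integral_const, probReal_univ, smul_eq_mul, one_mul] at h3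
  have h4 := hN n hn h hh
  simp only [Pi.sub_apply] at h2
  rw [h1]
  refine (abs_add_three _ _ _).trans ?_
  linarith

/-- The law of `f x` when `f` and `x` are independent with laws `ν` and `μ`. -/
def stepMeasure (ν : Measure (Expanding r)) (μ : Measure UnitAddCircle) : Measure UnitAddCircle :=
  (ν.prod μ).map fun p => p.1.1 p.2

instance (μ : Measure UnitAddCircle) [IsProbabilityMeasure μ] :
    IsProbabilityMeasure (stepMeasure ν μ) :=
  Measure.isProbabilityMeasure_map Expanding.measurable_eval.aemeasurable

theorem stepMeasure_apply (μ : Measure UnitAddCircle) [SFinite μ] {A : Set UnitAddCircle}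
    (hA : MeasurableSet A) : stepMeasure ν μ A = ∫⁻ f, μ (f.1 ⁻¹' A) ∂ν := by
  rw [stepMeasure, Measure.map_apply Expanding.measurable_eval hA,
    Measure.prod_apply (Expanding.measurable_eval hA)]
  rfl

theorem integral_stepMeasure (μ : Measure UnitAddCircle) [IsFiniteMeasure μ]
    {h : UnitAddCircle → ℝ} (hh : IsTest h) :
    ∫ x, h x ∂(stepMeasure ν μ) = ∫ x, markov ν h x ∂μ := by
  have h1 := integral_mul_markov (ν := ν) hh (μ := μ) (integrable_const (1 : ℝ))
  simp only [one_mul] at h1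
  rw [h1, stepMeasure, integral_map Expanding.measurable_eval.aemeasurable
    hh.measurable.aestronglyMeasurable, integral_prod]
  exact Integrable.of_bound (C := 1)
    (hh.measurable.comp Expanding.measurable_eval).aestronglyMeasurable
    (ae_of_all _ fun p => hh.abs_le_one _)

instance (μ : Measure UnitAddCircle) [IsProbabilityMeasure μ] (n : ℕ) :
    IsProbabilityMeasure ((stepMeasure ν)^[n] μ) := by
  induction n with
  | zero => assumption
  | succ n ih => rw [Function.iterate_succ_apply']; infer_instance

theorem integral_iterate_stepMeasure (μ : Measure UnitAddCircle) [IsProbabilityMeasure μ]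
    {h : UnitAddCircle → ℝ} (hh : IsTest h) (n : ℕ) :
    ∫ x, h x ∂((stepMeasure ν)^[n] μ) = ∫ x, (markov ν)^[n] h x ∂μ := by
  induction n generalizing μ with
  | zero => rfl
  | succ n ih =>
    rw [Function.iterate_succ_apply, ih, integral_stepMeasure _ (hh.iterate_markov n),
      Function.iterate_succ_apply']

theorem IsTest.indicator {A : Set UnitAddCircle} (hA : MeasurableSet A) :
    IsTest (A.indicator fun _ => 1) := by
  refine ⟨measurable_const.indicator hA, fun x => ?_⟩
  by_cases hx : x ∈ A <;> simp [hx]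

theorem isStationary_iff {μ : Measure UnitAddCircle} [IsProbabilityMeasure μ] :
    IsStationary ν μ ↔ stepMeasure ν μ = μ := by
  constructor
  · intro h
    ext A hA
    rw [stepMeasure_apply μ hA, h.lintegral_preimage A hA]
  · intro h
    refine ⟨inferInstance, fun A hA => ?_⟩
    rw [← stepMeasure_apply μ hA, h]

/-- By the area formula the integral of `|f'|` over the preimage vanishes, and `|f'|` is nowhere
zero. -/
theorem Expanding.volume_preimage_eq_zero (hr : 2 ≤ r) (f : Expanding r) {A : Set UnitAddCircle}
    (hA : MeasurableSet A) (h0 : volume A = 0) : volume (f.1 ⁻¹' A) = 0 := by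
  have h := f.lintegral_abs_deriv_mul_comp hr (A.indicator fun _ => 1)
  have hm : Measurable fun y => ENNReal.ofReal |f.1.iterDeriv 1 y| *
      A.indicator (fun _ => (1 : ℝ≥0∞)) (f.1 y) :=
    (f.continuous_deriv hr).abs.measurable.ennreal_ofReal.mul
      ((measurable_const.indicator hA).comp f.measurable_map)
  rw [lintegral_indicator hA, setLIntegral_const, h0, mul_zero, mul_zero,
    lintegral_eq_zero_iff hm] at h
  rw [measure_eq_zero_iff_ae_notMem]
  filter_upwards [h] with y hy hyA
  have h1 : 0 < |f.1.iterDeriv 1 y| := abs_pos.2 (f.deriv_ne_zero y)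
  have h2 : f.1 y ∈ A := hyA
  simp only [h2, Set.indicator_of_mem, mul_one, Pi.zero_apply, ENNReal.ofReal_eq_zero] at hy
  linarith

theorem Expanding.quasiMeasurePreserving (hr : 2 ≤ r) (f : Expanding r) :
    Measure.QuasiMeasurePreserving f.1 volume volume :=
  ⟨f.measurable_map, Measure.AbsolutelyContinuous.mk fun A hA h0 => by
    rw [Measure.map_apply f.measurable_map hA]
    exact f.volume_preimage_eq_zero hr hA h0⟩

theorem stepMeasure_absolutelyContinuous (hr : 2 ≤ r) {μ : Measure UnitAddCircle} [SFinite μ]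
    (h : μ ≪ volume) : stepMeasure ν μ ≪ volume := by
  refine Measure.AbsolutelyContinuous.mk fun A hA h0 => ?_
  rw [stepMeasure_apply μ hA]
  simp [fun f : Expanding r => h (f.volume_preimage_eq_zero hr hA h0)]

theorem iterate_stepMeasure_absolutelyContinuous (hr : 2 ≤ r) (n : ℕ) :
    (stepMeasure ν)^[n] volume ≪ volume := by
  induction n with
  | zero => exact Measure.AbsolutelyContinuous.rfl
  | succ n ih =>
    rw [Function.iterate_succ_apply']
    exact stepMeasure_absolutelyContinuous hr ih

/-- Existence of the stationary SRB measure. -/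
theorem exists_isStationarySRB (hr : 2 ≤ r)
    (hν : Integrable (fun f : Expanding r => Real.log f.1.c2Norm) ν) :
    ∃ μ, IsStationarySRB ν μ := by
  have hreal : ∀ (n : ℕ) (A : Set UnitAddCircle), MeasurableSet A →
      ((stepMeasure ν)^[n] volume).real A = ∫ x, (markov ν)^[n] (A.indicator fun _ => 1) x :=
    fun n A hA => by
      rw [← integral_iterate_stepMeasure _ (IsTest.indicator hA), integral_indicator hA]
      simp
  obtain ⟨μ, hμ, hlim⟩ := exists_measure_tendsto_of_uniform_cauchy
    (fun n => (stepMeasure ν)^[n] volume) (fun ε hε => by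
      obtain ⟨N, hN⟩ := exists_forall_integral_iterate_markov_sub_le hr hν hε
      refine ⟨N, fun n hn m A hA => ?_⟩
      rw [hreal _ A hA, hreal _ A hA]
      exact hN n hn m _ (IsTest.indicator hA))
  refine ⟨μ, ⟨hμ, fun A hA => ?_⟩, ?_⟩
  · have h1 : Tendsto (fun n => ∫⁻ f : Expanding r, (stepMeasure ν)^[n] volume (f.1 ⁻¹' A) ∂ν)
        atTop (𝓝 (∫⁻ f : Expanding r, μ (f.1 ⁻¹' A) ∂ν)) := by
      refine tendsto_lintegral_of_dominated_convergence (fun _ => 1) (fun n => ?_) (fun n => ?_)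
        (by simp) (ae_of_all _ fun f => hlim _ (f.measurable_map hA))
      · exact measurable_measure_prodMk_left (Expanding.measurable_eval hA)
      · exact ae_of_all _ fun f => prob_le_one
    refine tendsto_nhds_unique h1 (((tendsto_add_atTop_iff_nat 1).2 (hlim A hA)).congr fun n => ?_)
    rw [Function.iterate_succ_apply', stepMeasure_apply _ hA]
  · refine Measure.AbsolutelyContinuous.mk fun A hA h0 => ?_
    refine tendsto_nhds_unique (hlim A hA) ?_
    simp [fun n => iterate_stepMeasure_absolutelyContinuous (ν := ν) hr n h0]

theorem IsStationary.iterate {μ : Measure UnitAddCircle} (h : IsStationary ν μ) (n : ℕ) :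
    (stepMeasure ν)^[n] μ = μ := by
  have := h.isProbabilityMeasure
  have h1 := isStationary_iff.1 h
  induction n with
  | zero => rfl
  | succ n ih => rw [Function.iterate_succ_apply, h1, ih]

/-- The density of a measure on the circle. -/
def density (μ : Measure UnitAddCircle) (x : UnitAddCircle) : ℝ := (μ.rnDeriv volume x).toReal

theorem measurable_density (μ : Measure UnitAddCircle) : Measurable (density μ) :=
  (Measure.measurable_rnDeriv _ _).ennreal_toReal

theorem density_nonneg (μ : Measure UnitAddCircle) (x : UnitAddCircle) : 0 ≤ density μ x :=
  ENNReal.toReal_nonneg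

theorem integrable_density (μ : Measure UnitAddCircle) [IsFiniteMeasure μ] :
    Integrable (density μ) := Measure.integrable_toReal_rnDeriv

theorem integral_density_mul {μ : Measure UnitAddCircle} [IsFiniteMeasure μ] (h : μ ≪ volume)
    (g : UnitAddCircle → ℝ) : ∫ x, density μ x * g x = ∫ x, g x ∂μ := by
  have := integral_rnDeriv_smul (E := ℝ) h (f := g)
  simpa [density] using this

theorem integral_density {μ : Measure UnitAddCircle} [IsProbabilityMeasure μ] (h : μ ≪ volume) :
    ∫ x, density μ x = 1 := by
  have := integral_density_mul h (fun _ => 1)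
  simpa using this

/-- Uniqueness of the stationary SRB measure. -/
theorem IsStationarySRB.unique (hr : 2 ≤ r)
    (hν : Integrable (fun f : Expanding r => Real.log f.1.c2Norm) ν)
    {μ₁ μ₂ : Measure UnitAddCircle} (h₁ : IsStationarySRB ν μ₁) (h₂ : IsStationarySRB ν μ₂) :
    μ₁ = μ₂ := by
  have := h₁.isProbabilityMeasure
  have := h₂.isProbabilityMeasure
  ext A hA
  have hh := IsTest.indicator hA
  have hreal : ∀ (n : ℕ) (μ : Measure UnitAddCircle), IsStationarySRB ν μ →
      μ.real A = ∫ x, density μ x * (markov ν)^[n] (A.indicator fun _ => 1) x := fun n μ h => by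
    have := h.isProbabilityMeasure
    rw [integral_density_mul h.absolutelyContinuous, ← integral_iterate_stepMeasure _ hh,
      h.toIsStationary.iterate, integral_indicator hA]
    simp
  -- By stationarity each `μᵢ A` can be tested after any number of steps, so the difference of the
  -- measures of `A` is a pairing of a mean-zero function to which the decay applies.
  have key : ∀ ε : ℝ, 0 < ε → |μ₁.real A - μ₂.real A| ≤ ε := fun ε hε => by
    obtain ⟨N, hN⟩ := exists_forall_abs_integral_mul_iterate_markov_le hr hν
      (φ := fun x => density μ₁ x - density μ₂ x)
      ((integrable_density μ₁).sub (integrable_density μ₂)) (by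
        rw [integral_sub (integrable_density μ₁) (integrable_density μ₂),
          integral_density h₁.absolutelyContinuous, integral_density h₂.absolutelyContinuous,
          sub_self]) hε
    have hq := hh.iterate_markov (ν := ν) N
    have := hN N le_rfl _ hh
    simp only [sub_mul] at this
    rwa [integral_sub (hq.integrable_mul (integrable_density _))
      (hq.integrable_mul (integrable_density _)), ← hreal N μ₁ h₁, ← hreal N μ₂ h₂] at this
  have h0 : μ₁.real A = μ₂.real A := by
    by_contra hne
    have h1 : 0 < |μ₁.real A - μ₂.real A| := abs_pos.2 (sub_ne_zero.2 hne)
    have := key _ (half_pos h1)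
    linarith
  exact (measureReal_eq_measureReal_iff).1 h0

end RandomCircle

end

/-! ### Ergodicity of the skew product and existence of the Lyapunov exponent. -/

noncomputable section

/-- A finite measure on a sequence space that is, up to a factor `c`, a product measure on boxes is
`c` times the product measure. -/
theorem apply_eq_mul_infinitePi {X : Type*} [MeasurableSpace X] (ν : Measure X)
    [IsProbabilityMeasure ν] {κ : Measure (ℕ → X)} {c : ℝ≥0∞} (hc : c ≠ ⊤)
    (h : ∀ (k : ℕ) (t : ℕ → Set X), (∀ i, MeasurableSet (t i)) →
      κ {ω | ∀ i < k, ω i ∈ t i} = c * ∏ i ∈ Finset.range k, ν (t i))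
    (s : Set (ℕ → X)) : κ s = c * (Measure.infinitePi fun _ : ℕ => ν) s := by
  have huniv : κ Set.univ = c := by
    have := h 0 (fun _ => Set.univ) (fun _ => MeasurableSet.univ)
    simpa using this
  rcases eq_or_ne c 0 with rfl | h0
  · have : κ s ≤ 0 := huniv ▸ measure_mono (Set.subset_univ s)
    simpa using this
  · have : c⁻¹ • κ = Measure.infinitePi fun _ : ℕ => ν := by
      refine Measure.eq_infinitePi _ fun u t ht => ?_
      classical
      obtain ⟨k, hk⟩ : ∃ k, u ⊆ Finset.range k := u.exists_nat_subset_range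
      let t' : ℕ → Set X := fun i => if i ∈ u then t i else Set.univ
      have ht' : ∀ i, MeasurableSet (t' i) := fun i => by
        simp only [t']
        split_ifs
        · exact ht i
        · exact MeasurableSet.univ
      have hset : (u : Set ℕ).pi t = {ω | ∀ i < k, ω i ∈ t' i} := by
        ext ω
        constructor
        · intro hω i _
          simp only [t']
          split_ifs with hi
          · exact hω i hi
          · trivial
        · intro hω i hi
          have hi' : i ∈ u := hi
          have := hω i (Finset.mem_range.1 (hk hi'))
          simpa [t', hi'] using this
      have hprod : ∏ i ∈ Finset.range k, ν (t' i) = ∏ i ∈ u, ν (t i) := by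
        rw [← Finset.prod_subset hk]
        · exact Finset.prod_congr rfl fun i hi => by simp [t', hi]
        · intro i _ hi
          simp [t', hi]
      rw [hset, Measure.smul_apply, h k t' ht', hprod, smul_eq_mul, ← mul_assoc,
        ENNReal.inv_mul_cancel h0 hc, one_mul]
    rw [← this, Measure.smul_apply, smul_eq_mul, ← mul_assoc, ENNReal.mul_inv_cancel h0 hc,
      one_mul]

theorem indicator_one_congr {X Y : Type*} {s : Set X} {t : Set Y} {x : X} {y : Y}
    (h : x ∈ s ↔ y ∈ t) : s.indicator (1 : X → ℝ≥0∞) x = t.indicator (1 : Y → ℝ≥0∞) y := by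
  by_cases hx : x ∈ s
  · rw [Set.indicator_of_mem hx, Set.indicator_of_mem (h.1 hx)]
    rfl
  · rw [Set.indicator_of_notMem hx, Set.indicator_of_notMem (fun hy => hx (h.2 hy))]

namespace RandomCircle

variable {r : ℕ∞}

namespace CrMap

/-- The chosen `lift` is opaque, but all continuous lifts differ by integers. Derivatives may
therefore be computed with any explicit lift, such as a composition of lifts. -/
theorem hasDerivAt_of_lift (hr : 2 ≤ r) (f : CrMap r) {F : ℝ → ℝ} (hF : Continuous F)
    (h : ∀ x : ℝ, (F x : UnitAddCircle) = f x) (x : ℝ) :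
    HasDerivAt F (f.iterDeriv 1 (x : UnitAddCircle)) x := by
  obtain ⟨d, hd⟩ := exists_int_of_lifts hF f.contDiff_lift.continuous
    (fun x => (h x).trans (f.coe_lift x).symm)
  rw [show F = fun x => f.lift x + d from funext hd]
  exact (f.hasDerivAt_lift hr x).add_const _

theorem iterDeriv_one_comp (hr : 2 ≤ r) (g f : CrMap r) (x : UnitAddCircle) :
    (g.comp f).iterDeriv 1 x = g.iterDeriv 1 (f x) * f.iterDeriv 1 x := by
  obtain ⟨y, -, rfl⟩ := exists_coe_eq x
  have h1 := (g.comp f).hasDerivAt_of_lift hr (F := fun x => g.lift (f.lift x))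
    (g.contDiff_lift.continuous.comp f.contDiff_lift.continuous)
    (fun x => by rw [g.coe_lift, f.coe_lift]; rfl) y
  have h2 := (g.hasDerivAt_lift hr (f.lift y)).comp y (f.hasDerivAt_lift hr y)
  rw [f.coe_lift] at h2
  exact h1.unique h2

theorem iterDeriv_one_id (hr : 2 ≤ r) (x : UnitAddCircle) : (CrMap.id r).iterDeriv 1 x = 1 := by
  obtain ⟨y, -, rfl⟩ := exists_coe_eq x
  exact ((CrMap.id r).hasDerivAt_of_lift hr (F := fun x => x) continuous_id (fun _ => rfl) y).unique
    (hasDerivAt_id y)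

end CrMap

/-- The skew product `(ω, x) ↦ (σ ω, f_{ω_0}(x))`. -/
def skewProduct (p : (ℕ → Expanding r) × UnitAddCircle) : (ℕ → Expanding r) × UnitAddCircle :=
  (fun n => p.1 (n + 1), (p.1 0).1 p.2)

theorem measurable_skewProduct : Measurable (skewProduct (r := r)) := by
  refine Measurable.prodMk ?_ ?_
  · exact measurable_pi_lambda _ fun n => (measurable_pi_apply (n + 1)).comp measurable_fst
  · have h0 : Measurable fun p : (ℕ → Expanding r) × UnitAddCircle => (p.1 0, p.2) :=
      ((measurable_pi_apply 0).comp measurable_fst).prodMk measurable_snd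
    exact Expanding.measurable_eval.comp h0

theorem skewProduct_consSeq (f : Expanding r) (ω : ℕ → Expanding r) (x : UnitAddCircle) :
    skewProduct (consSeq f ω, x) = (ω, f.1 x) := rfl

theorem iterate_skewProduct (n : ℕ) (p : (ℕ → Expanding r) × UnitAddCircle) :
    skewProduct^[n] p = (fun k => p.1 (n + k), randomIterate p.1 n p.2) := by
  induction n with
  | zero => simp [randomIterate, CrMap.id]
  | succ n ih =>
    rw [Function.iterate_succ_apply', ih]
    refine Prod.ext (funext fun k => ?_) rfl
    show p.1 (n + (k + 1)) = p.1 (n + 1 + k)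
    rw [show n + (k + 1) = n + 1 + k by ring]

/-- The chain rule: the logarithm of the derivative is an additive cocycle over the skew product. -/
theorem birkhoffSum_log_deriv (hr : 2 ≤ r) (n : ℕ) (p : (ℕ → Expanding r) × UnitAddCircle) :
    birkhoffSum skewProduct
        (fun q : (ℕ → Expanding r) × UnitAddCircle => Real.log |(q.1 0).1.iterDeriv 1 q.2|) n p =
      Real.log |(randomIterate p.1 n).iterDeriv 1 p.2| := by
  have hne : ∀ n, (randomIterate p.1 n).iterDeriv 1 p.2 ≠ 0 := fun n => by
    induction n with
    | zero => rw [randomIterate, CrMap.iterDeriv_one_id hr]; exact one_ne_zero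
    | succ n ih =>
      rw [randomIterate, CrMap.iterDeriv_one_comp hr]
      exact mul_ne_zero (Expanding.deriv_ne_zero _ _) ih
  induction n with
  | zero => simp [randomIterate, CrMap.iterDeriv_one_id hr]
  | succ n ih =>
    rw [birkhoffSum_succ, ih, iterate_skewProduct, randomIterate, CrMap.iterDeriv_one_comp hr,
      abs_mul, Real.log_mul (abs_ne_zero.2 (Expanding.deriv_ne_zero _ _)) (abs_ne_zero.2 (hne n))]
    rw [add_comm]
    simp

variable {ν : Measure (Expanding r)} [IsProbabilityMeasure ν]

/-- The law of an i.i.d. sequence of expanding maps. -/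
abbrev seqLaw (ν : Measure (Expanding r)) [IsProbabilityMeasure ν] : Measure (ℕ → Expanding r) :=
  Measure.infinitePi fun _ : ℕ => ν

theorem lintegral_seqLaw_prod (m : Measure UnitAddCircle) [SFinite m]
    {G : (ℕ → Expanding r) × UnitAddCircle → ℝ≥0∞} (hG : Measurable G) :
    ∫⁻ p, G p ∂((seqLaw ν).prod m) =
      ∫⁻ f, ∫⁻ q, G (consSeq f q.1, q.2) ∂((seqLaw ν).prod m) ∂ν := by
  rw [lintegral_prod _ hG.aemeasurable, lintegral_infinitePi_cons ν hG.lintegral_prod_right']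
  refine lintegral_congr fun f => ?_
  rw [lintegral_prod]
  exact (hG.comp ((measurable_consSeq.comp (measurable_const.prodMk measurable_fst)).prodMk
    measurable_snd)).aemeasurable

theorem measurePreserving_skewProduct {μ : Measure UnitAddCircle} (h : IsStationary ν μ) :
    MeasurePreserving skewProduct ((seqLaw ν).prod μ) ((seqLaw ν).prod μ) := by
  have := h.isProbabilityMeasure
  refine ⟨measurable_skewProduct, (Measure.prod_eq fun s t hs ht => ?_).symm⟩
  have hst : Measurable ((s ×ˢ t).indicator fun _ : (ℕ → Expanding r) × UnitAddCircle =>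
    (1 : ℝ≥0∞)) := measurable_const.indicator (hs.prod ht)
  rw [Measure.map_apply measurable_skewProduct (hs.prod ht),
    ← lintegral_indicator_one (measurable_skewProduct (hs.prod ht)),
    lintegral_seqLaw_prod μ (measurable_one.indicator (measurable_skewProduct (hs.prod ht)))]
  have h1 : ∀ f : Expanding r, ∫⁻ q, (skewProduct ⁻¹' s ×ˢ t).indicator
      (1 : (ℕ → Expanding r) × UnitAddCircle → ℝ≥0∞) (consSeq f q.1, q.2) ∂((seqLaw ν).prod μ) =
        seqLaw ν s * μ (f.1 ⁻¹' t) := fun f => by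
    rw [← Measure.prod_prod, ← lintegral_indicator_one (hs.prod (f.measurable_map ht))]
    rfl
  simp only [h1]
  rw [lintegral_const_mul, h.lintegral_preimage t ht]
  exact measurable_measure_prodMk_left (Expanding.measurable_eval ht)

section Ergodicity

variable {μ : Measure UnitAddCircle} {A : Set ((ℕ → Expanding r) × UnitAddCircle)}

theorem consSeq_mem_iff (hinv : skewProduct ⁻¹' A = A) (f : Expanding r) (ω : ℕ → Expanding r)
    (x : UnitAddCircle) : (consSeq f ω, x) ∈ A ↔ (ω, f.1 x) ∈ A := by
  rw [← hinv, Set.mem_preimage, skewProduct_consSeq, hinv]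

theorem measurable_seqLaw_section (hA : MeasurableSet A) :
    Measurable fun x => seqLaw ν {ω | (ω, x) ∈ A} :=
  measurable_measure_prodMk_right hA

theorem isTest_seqLaw_section (hA : MeasurableSet A) :
    IsTest fun x => (seqLaw ν).real {ω | (ω, x) ∈ A} := by
  refine ⟨(measurable_seqLaw_section hA).ennreal_toReal, fun x => ?_⟩
  rw [abs_of_nonneg measureReal_nonneg]
  exact measureReal_le_one

/-- Conditioning on the first letter, invariance of `A` says that the probability of its section is
a harmonic function. -/
theorem markov_seqLaw_section (hA : MeasurableSet A) (hinv : skewProduct ⁻¹' A = A) :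
    markov ν (fun x => (seqLaw ν).real {ω | (ω, x) ∈ A}) =
      fun x => (seqLaw ν).real {ω | (ω, x) ∈ A} := by
  funext x
  have hm : MeasurableSet {ω : ℕ → Expanding r | (ω, x) ∈ A} :=
    measurable_id.prodMk measurable_const hA
  have h1 : seqLaw ν {ω | (ω, x) ∈ A} = ∫⁻ f, seqLaw ν {ω | (ω, f.1 x) ∈ A} ∂ν := by
    rw [← lintegral_indicator_one hm, lintegral_infinitePi_cons ν (measurable_one.indicator hm)]
    refine lintegral_congr fun f => ?_
    have hm' : MeasurableSet {ω : ℕ → Expanding r | (ω, f.1 x) ∈ A} :=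
      measurable_id.prodMk measurable_const hA
    rw [← lintegral_indicator_one hm']
    refine lintegral_congr fun ω => ?_
    exact indicator_one_congr (consSeq_mem_iff hinv f ω x)
  rw [markov]
  simp only [measureReal_def]
  rw [integral_toReal, h1]
  · exact ((measurable_seqLaw_section hA).comp
      (Expanding.measurable_eval.comp (measurable_id.prodMk measurable_const))).aemeasurable
  · exact ae_of_all _ fun f => measure_lt_top _ _

/-- A bounded harmonic function equals its own iterates under the Markov operator. Decay on
mean-zero functions makes it orthogonal to all of them, hence constant almost everywhere. -/
theorem ae_seqLaw_section_eq (hr : 2 ≤ r)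
    (hν : Integrable (fun f : Expanding r => Real.log f.1.c2Norm) ν) (h : IsStationarySRB ν μ)
    (hA : MeasurableSet A) (hinv : skewProduct ⁻¹' A = A) :
    ∀ᵐ x ∂μ, seqLaw ν {ω | (ω, x) ∈ A} = ((seqLaw ν).prod μ) A := by
  have := h.isProbabilityMeasure
  set H : UnitAddCircle → ℝ := fun x => (seqLaw ν).real {ω | (ω, x) ∈ A} with hH
  have hHt : IsTest H := isTest_seqLaw_section hA
  have hfix : ∀ n, (markov ν)^[n] H = H := fun n => by
    induction n with
    | zero => rfl
    | succ n ih => rw [Function.iterate_succ_apply, markov_seqLaw_section hA hinv, ih]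
  have hHi : Integrable H μ := by
    simpa using hHt.integrable_mul (integrable_const (1 : ℝ))
  have hset : ∀ B, MeasurableSet B → ∫ x in B, H x ∂μ = ∫ x in B, (∫ y, H y ∂μ) ∂μ := by
    intro B hB
    have hρ := integrable_density μ
    have hac := h.absolutelyContinuous
    -- `φ = ρ (1_B - μ(B))` has mean zero; pairing it with `H` gives the integral of `H` over `B`
    -- minus `μ(B)` times its full integral.
    set φ : UnitAddCircle → ℝ := fun x =>
      density μ x * B.indicator (fun _ => 1) x - μ.real B * density μ x with hφ
    have hBi : Integrable fun x => density μ x * B.indicator (fun _ => 1) x :=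
      (IsTest.indicator hB).integrable_mul hρ
    have hφi : Integrable φ := hBi.sub (hρ.const_mul _)
    have hφ0 : ∫ x, φ x = 0 := by
      rw [hφ, integral_sub hBi (hρ.const_mul _), integral_density_mul hac,
        integral_const_mul, integral_density hac, integral_indicator hB]
      simp
    have hφH : ∫ x, φ x * H x = (∫ x in B, H x ∂μ) - μ.real B * ∫ x, H x ∂μ := by
      have e1 : ∀ x, φ x * H x = density μ x * B.indicator H x -
          μ.real B * (density μ x * H x) := fun x => by
        by_cases hx : x ∈ B <;> simp [hφ, hx] <;> ring
      simp only [e1]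
      rw [integral_sub, integral_density_mul hac, integral_const_mul, integral_density_mul hac,
        integral_indicator hB]
      · refine IsTest.integrable_mul ⟨hHt.measurable.indicator hB, fun x => ?_⟩ hρ
        by_cases hx : x ∈ B
        · simpa [hx] using hHt.abs_le_one x
        · simp [hx]
      · exact (hHt.integrable_mul hρ).const_mul _
    have hzero : ∫ x, φ x * H x = 0 := by
      by_contra hne
      obtain ⟨N, hN⟩ := exists_forall_abs_integral_mul_iterate_markov_le hr hν hφi hφ0
        (half_pos (abs_pos.2 hne))
      have := hN N le_rfl H hHt
      rw [hfix] at this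
      have := abs_pos.2 hne
      linarith
    rw [hφH] at hzero
    simp only [setIntegral_const, smul_eq_mul]
    linarith
  have hae : H =ᵐ[μ] fun _ => ∫ y, H y ∂μ :=
    hHi.ae_eq_of_forall_setIntegral_eq _ _ (integrable_const _) fun B hB _ => hset B hB
  have htot : ∫ y, H y ∂μ = (((seqLaw ν).prod μ) A).toReal := by
    rw [Measure.prod_apply_symm hA, hH]
    simp only [measureReal_def]
    rw [integral_toReal (measurable_seqLaw_section hA).aemeasurable
      (ae_of_all _ fun x => measure_lt_top _ _)]
    rfl
  filter_upwards [hae] with x hx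
  rw [htot] at hx
  exact (ENNReal.toReal_eq_toReal_iff' (measure_ne_top _ _) (measure_ne_top _ _)).1 hx

/-- The density is not yet known to be positive. By stationarity almost every `f` sends `μ`-almost
every point into the set `D` where it does not vanish; a `μ`-null set meets `D` in a Lebesgue-null
set, and `f` is nonsingular. -/
theorem IsStationarySRB.ae_map_absolutelyContinuous (hr : 2 ≤ r) (h : IsStationarySRB ν μ) :
    ∀ᵐ f : Expanding r ∂ν, μ.map f.1 ≪ μ := by
  have := h.isProbabilityMeasure
  have hdens : volume.withDensity (μ.rnDeriv volume) = μ :=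
    Measure.withDensity_rnDeriv_eq _ _ h.absolutelyContinuous
  have hm := Measure.measurable_rnDeriv μ volume
  have hzero : ∀ s : Set UnitAddCircle, μ s = 0 ↔
      volume ({x | μ.rnDeriv volume x ≠ 0} ∩ s) = 0 := fun s => by
    conv_lhs => rw [← hdens]
    exact withDensity_apply_eq_zero hm
  set D : Set UnitAddCircle := {x | μ.rnDeriv volume x ≠ 0} with hD
  have hDm : MeasurableSet D := hm (measurableSet_singleton 0).compl
  have hD0 : μ Dᶜ = 0 := (hzero _).2 (by simp)
  have hmeas : Measurable fun f : Expanding r => μ (f.1 ⁻¹' Dᶜ) :=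
    measurable_measure_prodMk_left (Expanding.measurable_eval hDm.compl)
  have h1 := (lintegral_eq_zero_iff hmeas).1 ((h.lintegral_preimage Dᶜ hDm.compl).trans hD0)
  filter_upwards [h1] with f hf
  refine Measure.AbsolutelyContinuous.mk fun A hA h0 => ?_
  rw [Measure.map_apply f.measurable_map hA]
  have h2 : volume (f.1 ⁻¹' (D ∩ A)) = 0 :=
    f.volume_preimage_eq_zero hr (hDm.inter hA) ((hzero A).1 h0)
  refine measure_mono_null (t := f.1 ⁻¹' (D ∩ A) ∪ f.1 ⁻¹' Dᶜ) (fun x hx => ?_)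
    (measure_union_null (h.absolutelyContinuous h2) hf)
  by_cases hxD : f.1 x ∈ D
  · exact Or.inl ⟨hxD, hx⟩
  · exact Or.inr hxD

/-- `A` is independent of the first `k` letters. In the induction the first map is absorbed by
pushing `m` forward, which is why the statement allows every `m ≪ μ`. -/
theorem measure_inter_box (hA : MeasurableSet A) (hinv : skewProduct ⁻¹' A = A) {α : ℝ≥0∞}
    (hα : ∀ᵐ x ∂μ, seqLaw ν {ω | (ω, x) ∈ A} = α) (hac : ∀ᵐ f : Expanding r ∂ν, μ.map f.1 ≪ μ)
    (k : ℕ) (t : ℕ → Set (Expanding r)) (ht : ∀ i, MeasurableSet (t i))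
    (m : Measure UnitAddCircle) [SFinite m] (hm : m ≪ μ) :
    ((seqLaw ν).prod m) (A ∩ {p | ∀ i < k, p.1 i ∈ t i}) =
      α * (∏ i ∈ Finset.range k, ν (t i)) * m Set.univ := by
  have hbox : ∀ (k : ℕ) (t : ℕ → Set (Expanding r)), (∀ i, MeasurableSet (t i)) →
      MeasurableSet {p : (ℕ → Expanding r) × UnitAddCircle | ∀ i < k, p.1 i ∈ t i} := by
    intro k t ht
    have : {p : (ℕ → Expanding r) × UnitAddCircle | ∀ i < k, p.1 i ∈ t i} =
        ⋂ i, ⋂ (_ : i < k), {p | p.1 i ∈ t i} := by ext; simp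
    rw [this]
    exact MeasurableSet.iInter fun i => MeasurableSet.iInter fun _ =>
      ((measurable_pi_apply i).comp measurable_fst) (ht i)
  induction k generalizing t m with
  | zero =>
    have h1 : A ∩ {p : (ℕ → Expanding r) × UnitAddCircle | ∀ i < 0, p.1 i ∈ t i} = A := by simp
    rw [h1, Measure.prod_apply_symm hA]
    have h2 : ∫⁻ y, seqLaw ν ((fun x => (x, y)) ⁻¹' A) ∂m = ∫⁻ _, α ∂m :=
      lintegral_congr_ae (hm.ae_le hα)
    rw [h2]
    simp
  | succ k ih =>
    have hms := hA.inter (hbox (k + 1) t ht)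
    rw [← lintegral_indicator_one hms, lintegral_seqLaw_prod m (measurable_one.indicator hms)]
    have hae : ∀ᵐ f : Expanding r ∂ν, ∫⁻ q, (A ∩ {p | ∀ i < k + 1, p.1 i ∈ t i}).indicator
        (1 : (ℕ → Expanding r) × UnitAddCircle → ℝ≥0∞) (consSeq f q.1, q.2) ∂((seqLaw ν).prod m) =
          (t 0).indicator (fun _ => α * (∏ i ∈ Finset.range k, ν (t (i + 1))) * m Set.univ) f := by
      filter_upwards [hac] with f hf
      by_cases hf0 : f ∈ t 0
      · rw [Set.indicator_of_mem hf0]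
        have h1 := ih (fun i => t (i + 1)) (fun i => ht (i + 1)) (m.map f.1)
          ((hm.map f.measurable_map).trans hf)
        rw [Measure.map_apply f.measurable_map MeasurableSet.univ, Set.preimage_univ] at h1
        have hms' := hA.inter (hbox k (fun i => t (i + 1)) fun i => ht (i + 1))
        have hmap : (seqLaw ν).prod (m.map f.1) =
            ((seqLaw ν).prod m).map (Prod.map id f.1) := by
          rw [← Measure.map_prod_map _ _ measurable_id f.measurable_map, Measure.map_id]
        rw [← h1, hmap, Measure.map_apply (measurable_id.prodMap f.measurable_map) hms',
          ← lintegral_indicator_one (measurable_id.prodMap f.measurable_map hms')]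
        refine lintegral_congr fun q => ?_
        have hiff : (consSeq f q.1, q.2) ∈ A ∩ {p | ∀ i < k + 1, p.1 i ∈ t i} ↔
            q ∈ Prod.map id f.1 ⁻¹' (A ∩ {p | ∀ i < k, p.1 i ∈ t (i + 1)}) := by
          constructor
          · rintro ⟨ha, hb⟩
            exact ⟨(consSeq_mem_iff hinv f q.1 q.2).1 ha,
              fun i hi => hb (i + 1) (Nat.succ_lt_succ hi)⟩
          · rintro ⟨ha, hb⟩
            refine ⟨(consSeq_mem_iff hinv f q.1 q.2).2 ha, fun i hi => ?_⟩
            cases i with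
            | zero => exact hf0
            | succ i => exact hb i (Nat.lt_of_succ_lt_succ hi)
        exact indicator_one_congr hiff
      · rw [Set.indicator_of_notMem hf0]
        rw [← lintegral_zero (μ := (seqLaw ν).prod m)]
        refine lintegral_congr fun q => Set.indicator_of_notMem (fun hq => hf0 ?_) _
        exact hq.2 0 (Nat.succ_pos k)
    rw [lintegral_congr_ae hae, lintegral_indicator (ht 0), setLIntegral_const,
      Finset.prod_range_succ']
    ring

/-- The skew product is ergodic. -/
theorem ergodic_skewProduct (hr : 2 ≤ r)
    (hν : Integrable (fun f : Expanding r => Real.log f.1.c2Norm) ν) (h : IsStationarySRB ν μ) :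
    Ergodic skewProduct ((seqLaw ν).prod μ) := by
  have := h.isProbabilityMeasure
  refine ⟨measurePreserving_skewProduct h.toIsStationary, ⟨fun A hA hinv => ?_⟩⟩
  set α := ((seqLaw ν).prod μ) A with hα
  have hαt : α ≠ ⊤ := measure_ne_top _ _
  have hsec := ae_seqLaw_section_eq hr hν h hA hinv
  -- Sections of constant probability `α` make `A` independent of every rectangle. If `α ≠ 0`, the
  -- whole law is then `α⁻¹` times its restriction to `A`, so the complement of `A` is null.
  have hrect : ∀ (s : Set (ℕ → Expanding r)) (B : Set UnitAddCircle), MeasurableSet s →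
      MeasurableSet B → ((seqLaw ν).prod μ) (A ∩ s ×ˢ B) = α * (seqLaw ν s * μ B) := by
    intro s B hs hB
    have h1 := apply_eq_mul_infinitePi ν (κ := (((seqLaw ν).prod (μ.restrict B)).restrict A).map
      Prod.fst) (c := α * μ B) (ENNReal.mul_ne_top hαt (measure_ne_top _ _)) (fun k t ht => ?_) s
    · rw [Measure.map_apply measurable_fst hs, Measure.restrict_apply (measurable_fst hs),
        ← Measure.restrict_univ (μ := seqLaw ν), Measure.prod_restrict,
        Measure.restrict_apply ((measurable_fst hs).inter hA)] at h1
      rw [show A ∩ s ×ˢ B = Prod.fst ⁻¹' s ∩ A ∩ Set.univ ×ˢ B by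
        ext ⟨ω, x⟩
        simp only [Set.mem_inter_iff, Set.mem_prod, Set.mem_preimage, Set.mem_univ, true_and]
        tauto, h1]
      ring
    · have hb : MeasurableSet {ω : ℕ → Expanding r | ∀ i < k, ω i ∈ t i} := by
        have : {ω : ℕ → Expanding r | ∀ i < k, ω i ∈ t i} =
            ⋂ i, ⋂ (_ : i < k), {ω | ω i ∈ t i} := by ext; simp
        rw [this]
        exact MeasurableSet.iInter fun i => MeasurableSet.iInter fun _ =>
          (measurable_pi_apply i) (ht i)
      rw [Measure.map_apply measurable_fst hb, Measure.restrict_apply (measurable_fst hb),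
        Set.inter_comm]
      have h2 := measure_inter_box hA hinv hsec (h.ae_map_absolutelyContinuous hr) k t ht
        (μ.restrict B) Measure.absolutelyContinuous_restrict
      rw [Measure.restrict_apply_univ] at h2
      exact h2.trans (by ring)
  rw [eventuallyConst_set']
  rcases eq_or_ne α 0 with h0 | h0
  · left
    exact ae_eq_empty.2 h0
  · right
    have h2 : (seqLaw ν).prod μ = α⁻¹ • ((seqLaw ν).prod μ).restrict A :=
      Measure.prod_eq fun s B hs hB => by
        rw [Measure.smul_apply, Measure.restrict_apply (hs.prod hB), Set.inter_comm, hrect s B hs hB,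
          smul_eq_mul, ← mul_assoc, ENNReal.inv_mul_cancel h0 hαt, one_mul]
    refine ae_eq_univ.2 ?_
    rw [h2, Measure.smul_apply, Measure.restrict_apply hA.compl]
    simp

end Ergodicity

/-- The Lyapunov exponent of a stationary measure. -/
def lyapunov (ν : Measure (Expanding r)) (μ : Measure UnitAddCircle) : ℝ :=
  ∫ p : Expanding r × UnitAddCircle, Real.log |p.1.1.iterDeriv 1 p.2| ∂(ν.prod μ)

theorem measurable_log_deriv (hr : 2 ≤ r) :
    Measurable fun p : Expanding r × UnitAddCircle => Real.log |p.1.1.iterDeriv 1 p.2| :=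
  Real.measurable_log.comp (Expanding.measurable_deriv hr).abs

theorem integrable_log_deriv (hr : 2 ≤ r)
    (hν : Integrable (fun f : Expanding r => Real.log f.1.c2Norm) ν) (μ : Measure UnitAddCircle)
    [IsFiniteMeasure μ] :
    Integrable (fun p : Expanding r × UnitAddCircle => Real.log |p.1.1.iterDeriv 1 p.2|)
      (ν.prod μ) := by
  have hK : Integrable (fun p : Expanding r × UnitAddCircle => Real.log p.1.1.c2Norm)
      (ν.prod μ) := hν.comp_fst μ
  refine hK.mono' (measurable_log_deriv hr).aestronglyMeasurable (ae_of_all _ fun p => ?_)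
  have h := p.1.2 p.2
  rw [Real.norm_eq_abs, abs_of_nonneg (Real.log_nonneg h.le)]
  exact Real.log_le_log (by linarith) (p.1.1.abs_iterDeriv_one_le hr p.2)

theorem measurePreserving_eval_zero_prod (ν : Measure (Expanding r)) [IsProbabilityMeasure ν]
    (μ : Measure UnitAddCircle) [IsProbabilityMeasure μ] :
    MeasurePreserving (fun p : (ℕ → Expanding r) × UnitAddCircle => (p.1 0, p.2))
      ((seqLaw ν).prod μ) (ν.prod μ) :=
  (measurePreserving_eval_infinitePi (fun _ : ℕ => ν) 0).prod (MeasurePreserving.id μ)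

theorem isLyapunovExponent_lyapunov (hr : 2 ≤ r)
    (hν : Integrable (fun f : Expanding r => Real.log f.1.c2Norm) ν) {μ : Measure UnitAddCircle}
    (h : IsStationarySRB ν μ) : IsLyapunovExponent ν μ (lyapunov ν μ) := by
  have := h.isProbabilityMeasure
  have hmp := measurePreserving_eval_zero_prod ν μ
  have hgm := Measurable.comp (measurable_log_deriv hr) hmp.measurable
  have hgi := hmp.integrable_comp_of_integrable (integrable_log_deriv hr hν μ)
  have hbirk := (ergodic_skewProduct hr hν h).ae_tendsto_birkhoffAverage hgm hgi
  have hval : ∫ q : (ℕ → Expanding r) × UnitAddCircle, Real.log |(q.1 0).1.iterDeriv 1 q.2|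
      ∂((seqLaw ν).prod μ) = lyapunov ν μ := by
    rw [lyapunov, ← hmp.map_eq, integral_map hmp.measurable.aemeasurable]
    exact (measurable_log_deriv hr).aestronglyMeasurable
  have hcomp : ((fun p : Expanding r × UnitAddCircle => Real.log |p.1.1.iterDeriv 1 p.2|) ∘
      fun p : (ℕ → Expanding r) × UnitAddCircle => (p.1 0, p.2)) =
        fun q => Real.log |(q.1 0).1.iterDeriv 1 q.2| := rfl
  rw [hcomp, hval] at hbirk
  filter_upwards [hbirk] with p hp
  simpa only [birkhoffSum_log_deriv hr] using hp

end RandomCircle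

end

/-! ### The bound by the mean logarithmic degree, and its equality case. -/

noncomputable section

namespace RandomCircle

variable {r : ℕ∞} {ν : Measure (Expanding r)} [IsProbabilityMeasure ν] {μ : Measure UnitAddCircle}

theorem IsStationary.measurePreserving_eval [IsProbabilityMeasure μ] (h : IsStationary ν μ) :
    MeasurePreserving (fun p : Expanding r × UnitAddCircle => p.1.1 p.2) (ν.prod μ) μ :=
  ⟨Expanding.measurable_eval, isStationary_iff.1 h⟩

/-- For a stationary measure, `u (f x) - u x` is integrable with integral zero as soon as it is
bounded above by an integrable function. -/
theorem IsStationary.integral_coboundary_eq_zero [IsProbabilityMeasure μ] (h : IsStationary ν μ)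
    {u : UnitAddCircle → ℝ} (hu : Measurable u) {w : Expanding r × UnitAddCircle → ℝ}
    (hw : Integrable w (ν.prod μ)) (hle : ∀ᵐ p ∂(ν.prod μ), u (p.1.1 p.2) - u p.2 ≤ w p) :
    Integrable (fun p : Expanding r × UnitAddCircle => u (p.1.1 p.2) - u p.2) (ν.prod μ) ∧
      ∫ p : Expanding r × UnitAddCircle, (u (p.1.1 p.2) - u p.2) ∂(ν.prod μ) = 0 := by
  -- Evaluation `(f, x) ↦ f x` is not a self-map. Viewed on the skew product, the expression is a
  -- genuine coboundary that depends only on the first letter.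
  have hmp := measurePreserving_eval_zero_prod ν μ
  have hm : Measurable fun p : Expanding r × UnitAddCircle => u (p.1.1 p.2) - u p.2 :=
    (Measurable.comp hu Expanding.measurable_eval).sub (Measurable.comp hu measurable_snd)
  have hu' : Measurable fun p : (ℕ → Expanding r) × UnitAddCircle => u p.2 :=
    hu.comp measurable_snd
  have hw' := hmp.integrable_comp_of_integrable hw
  have hle' := hmp.quasiMeasurePreserving.ae hle
  obtain ⟨h1, h2⟩ := (measurePreserving_skewProduct h).integral_coboundary_eq_zero hu' hw' hle'
  constructor
  · exact (hmp.integrable_comp hm.aestronglyMeasurable).1 h1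
  · rw [← hmp.map_eq, integral_map hmp.measurable.aemeasurable hm.aestronglyMeasurable]
    exact h2

theorem ae_density_pos [IsProbabilityMeasure μ] (h : μ ≪ volume) : ∀ᵐ x ∂μ, 0 < density μ x := by
  filter_upwards [Measure.rnDeriv_pos h, h.ae_le (Measure.rnDeriv_lt_top μ volume)] with x h1 h2
  exact ENNReal.toReal_pos h1.ne' h2.ne

theorem ofReal_density_ae_eq (μ : Measure UnitAddCircle) [IsProbabilityMeasure μ] :
    (fun x => ENNReal.ofReal (density μ x)) =ᵐ[volume] μ.rnDeriv volume := by
  filter_upwards [Measure.rnDeriv_lt_top μ volume] with x hx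
  exact ENNReal.ofReal_toReal hx.ne

theorem lintegral_density_mul [IsProbabilityMeasure μ] (h : μ ≪ volume)
    {g : UnitAddCircle → ℝ≥0∞} (hg : Measurable g) :
    ∫⁻ x, ENNReal.ofReal (density μ x) * g x = ∫⁻ x, g x ∂μ := by
  rw [← lintegral_rnDeriv_mul h hg.aemeasurable]
  refine lintegral_congr_ae ?_
  filter_upwards [ofReal_density_ae_eq μ] with x hx
  rw [hx]

theorem lintegral_density [IsProbabilityMeasure μ] (h : μ ≪ volume) :
    ∫⁻ x, ENNReal.ofReal (density μ x) = 1 := by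
  have := lintegral_density_mul h (g := fun _ => 1) measurable_const
  simpa using this

theorem natAbs_degree_eq (f : Expanding r) :
    (f.1.degree.natAbs : ℝ≥0∞) = ENNReal.ofReal |(f.1.degree : ℝ)| := by
  rw [← ENNReal.ofReal_natCast, Nat.cast_natAbs, Int.cast_abs]

theorem lintegral_deriv_mul_density (hr : 2 ≤ r) [IsProbabilityMeasure μ] (h : μ ≪ volume)
    (f : Expanding r) :
    ∫⁻ y, ENNReal.ofReal (|f.1.iterDeriv 1 y| * density μ (f.1 y)) =
      ENNReal.ofReal |(f.1.degree : ℝ)| := by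
  have h1 := f.lintegral_abs_deriv_mul_comp hr fun x => ENNReal.ofReal (density μ x)
  rw [lintegral_density h, mul_one] at h1
  simp only [ENNReal.ofReal_mul (abs_nonneg _)]
  rw [h1, natAbs_degree_eq]

/-- The weight `|f'(y)| ρ(f y) / (|deg f| ρ(y))` of the inverse branch of `f` at `f y`, relative to
the uniform weights, where `ρ` is the density of `μ`. -/
def branchWeight (μ : Measure UnitAddCircle) (p : Expanding r × UnitAddCircle) : ℝ :=
  |p.1.1.iterDeriv 1 p.2| * density μ (p.1.1 p.2) / (|(p.1.1.degree : ℝ)| * density μ p.2)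

theorem measurable_branchWeight (hr : 2 ≤ r) (μ : Measure UnitAddCircle) :
    Measurable (branchWeight (r := r) μ) := by
  have h1 := Measurable.comp (measurable_density μ) (Expanding.measurable_eval (r := r))
  have h2 : Measurable fun p : Expanding r × UnitAddCircle => |(p.1.1.degree : ℝ)| :=
    Measurable.comp measurable_abs ((Expanding.measurable_degree hr).comp measurable_fst)
  have h3 : Measurable fun p : Expanding r × UnitAddCircle => density μ p.2 :=
    (measurable_density μ).comp measurable_snd
  exact ((Measurable.abs (Expanding.measurable_deriv hr)).mul h1).div (h2.mul h3)

theorem branchWeight_nonneg (μ : Measure UnitAddCircle) (p : Expanding r × UnitAddCircle) :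
    0 ≤ branchWeight μ p :=
  div_nonneg (mul_nonneg (abs_nonneg _) (density_nonneg _ _))
    (mul_nonneg (abs_nonneg _) (density_nonneg _ _))

/-- For fixed `f`, integrating against `μ` cancels `ρ(y)`, and the area formula yields `|deg f| /
|deg f|`. Only an inequality is claimed, since the weight does not see the points where `ρ`
vanishes. -/
theorem lintegral_branchWeight_le (hr : 2 ≤ r) [IsProbabilityMeasure μ] (h : μ ≪ volume) :
    ∫⁻ p, ENNReal.ofReal (branchWeight μ p) ∂(ν.prod μ) ≤ 1 := by
  have hm := (measurable_branchWeight (r := r) hr μ).ennreal_ofReal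
  rw [lintegral_prod _ hm.aemeasurable]
  refine (lintegral_mono (g := fun _ => 1) fun f => ?_).trans (by simp)
  have hmf : Measurable fun y => ENNReal.ofReal (branchWeight μ (f, y)) :=
    hm.comp measurable_prodMk_left
  have hd : 0 < |(f.1.degree : ℝ)| := abs_pos.2 (f.degree_ne_zero hr)
  rw [← lintegral_density_mul h hmf]
  calc ∫⁻ y, ENNReal.ofReal (density μ y) * ENNReal.ofReal (branchWeight μ (f, y))
      ≤ ∫⁻ y, ENNReal.ofReal |(f.1.degree : ℝ)|⁻¹ *
          ENNReal.ofReal (|f.1.iterDeriv 1 y| * density μ (f.1 y)) := by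
        refine lintegral_mono fun y => ?_
        rw [← ENNReal.ofReal_mul (density_nonneg _ _), ← ENNReal.ofReal_mul (by positivity)]
        refine ENNReal.ofReal_le_ofReal ?_
        have hn : 0 ≤ |f.1.iterDeriv 1 y| * density μ (f.1 y) :=
          mul_nonneg (abs_nonneg _) (density_nonneg _ _)
        -- Where `ρ(y) = 0` the left side is zero; elsewhere `ρ(y)` cancels exactly.
        rcases (density_nonneg μ y).eq_or_lt with h0 | h0
        · rw [← h0, zero_mul]
          positivity
        · refine le_of_eq ?_
          rw [branchWeight]
          field_simp
    _ = 1 := by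
        rw [lintegral_const_mul' _ _ ENNReal.ofReal_ne_top, lintegral_deriv_mul_density hr h,
          ← ENNReal.ofReal_mul (by positivity), inv_mul_cancel₀ hd.ne', ENNReal.ofReal_one]

theorem integrable_branchWeight (hr : 2 ≤ r) [IsProbabilityMeasure μ] (h : μ ≪ volume) :
    Integrable (branchWeight μ) (ν.prod μ) := by
  refine ⟨(measurable_branchWeight hr μ).aestronglyMeasurable, ?_⟩
  rw [hasFiniteIntegral_iff_ofReal (ae_of_all _ (branchWeight_nonneg μ))]
  exact (lintegral_branchWeight_le hr h).trans_lt ENNReal.one_lt_top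

theorem integral_branchWeight_le (hr : 2 ≤ r) [IsProbabilityMeasure μ] (h : μ ≪ volume) :
    ∫ p, branchWeight μ p ∂(ν.prod μ) ≤ 1 := by
  rw [integral_eq_lintegral_of_nonneg_ae (ae_of_all _ (branchWeight_nonneg μ))
    (measurable_branchWeight hr μ).aestronglyMeasurable]
  exact ENNReal.toReal_mono ENNReal.one_ne_top (lintegral_branchWeight_le hr h)

theorem IsStationarySRB.ae_density_pos_prod (h : IsStationarySRB ν μ) :
    ∀ᵐ p ∂(ν.prod μ), 0 < density μ p.2 ∧ 0 < density μ (p.1.1 p.2) := by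
  have := h.isProbabilityMeasure
  have h1 := ae_density_pos h.absolutelyContinuous
  exact (Measure.quasiMeasurePreserving_snd.ae h1).and
    (h.toIsStationary.measurePreserving_eval.quasiMeasurePreserving.ae h1)

theorem log_branchWeight (hr : 2 ≤ r) {p : Expanding r × UnitAddCircle}
    (hp : 0 < density μ p.2 ∧ 0 < density μ (p.1.1 p.2)) :
    Real.log (branchWeight μ p) = Real.log |p.1.1.iterDeriv 1 p.2| -
      Real.log |(p.1.1.degree : ℝ)| +
        (Real.log (density μ (p.1.1 p.2)) - Real.log (density μ p.2)) := by
  have h1 := abs_ne_zero.2 (p.1.deriv_ne_zero p.2)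
  have h2 := abs_ne_zero.2 (p.1.degree_ne_zero hr)
  rw [branchWeight, Real.log_div (mul_ne_zero h1 hp.2.ne') (mul_ne_zero h2 hp.1.ne'),
    Real.log_mul h1 hp.2.ne', Real.log_mul h2 hp.1.ne']
  ring

theorem branchWeight_pos (hr : 2 ≤ r) {p : Expanding r × UnitAddCircle}
    (hp : 0 < density μ p.2 ∧ 0 < density μ (p.1.1 p.2)) : 0 < branchWeight μ p :=
  div_pos (mul_pos (abs_pos.2 (p.1.deriv_ne_zero p.2)) hp.2)
    (mul_pos (abs_pos.2 (p.1.degree_ne_zero hr)) hp.1)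

/-- Integrability of `log ρ` is not available. From `log w ≤ w - 1` and `log|f'| ≥ 0`, the
coboundary of `log ρ` is at most `w + log|deg f|`, which is integrable, and this suffices for mean
zero. -/
theorem IsStationarySRB.integral_log_branchWeight (hr : 2 ≤ r)
    (hν : Integrable (fun f : Expanding r => Real.log f.1.c2Norm) ν) (h : IsStationarySRB ν μ) :
    Integrable (fun p => Real.log (branchWeight μ p)) (ν.prod μ) ∧
      ∫ p, Real.log (branchWeight μ p) ∂(ν.prod μ) =
        lyapunov ν μ - ∫ f : Expanding r, Real.log |(f.1.degree : ℝ)| ∂ν := by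
  have := h.isProbabilityMeasure
  have hdeg := Expanding.integrable_log_abs_degree hr hν
  have hdeg' : Integrable (fun p : Expanding r × UnitAddCircle => Real.log |(p.1.1.degree : ℝ)|)
    (ν.prod μ) := hdeg.comp_fst μ
  have hder := integrable_log_deriv hr hν μ
  have hlog := h.ae_density_pos_prod
  obtain ⟨hi, h0⟩ := h.toIsStationary.integral_coboundary_eq_zero
    (Measurable.comp Real.measurable_log (measurable_density μ))
    ((integrable_branchWeight hr h.absolutelyContinuous).add hdeg') (by
      filter_upwards [hlog] with p hp
      have h1 := log_branchWeight hr hp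
      have h2 := Real.log_le_sub_one_of_pos (branchWeight_pos hr hp)
      have h3 := Real.log_nonneg (p.1.2 p.2).le
      simp only [Function.comp_apply, Pi.add_apply]
      linarith)
  have hsub : Integrable (fun p : Expanding r × UnitAddCircle =>
    Real.log |p.1.1.iterDeriv 1 p.2| - Real.log |(p.1.1.degree : ℝ)|) (ν.prod μ) := hder.sub hdeg'
  replace hi : Integrable (fun p : Expanding r × UnitAddCircle =>
    Real.log (density μ (p.1.1 p.2)) - Real.log (density μ p.2)) (ν.prod μ) := hi
  have hae : (fun p => Real.log (branchWeight μ p)) =ᵐ[ν.prod μ] fun p : Expanding r × UnitAddCircle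
      => (Real.log |p.1.1.iterDeriv 1 p.2| - Real.log |(p.1.1.degree : ℝ)|) +
        (Real.log (density μ (p.1.1 p.2)) - Real.log (density μ p.2)) := by
    filter_upwards [hlog] with p hp using log_branchWeight hr hp
  refine ⟨(hsub.add hi).congr hae.symm, ?_⟩
  rw [integral_congr_ae hae, integral_add hsub hi, integral_sub hder hdeg']
  have e1 : ∫ p : Expanding r × UnitAddCircle, Real.log |(p.1.1.degree : ℝ)| ∂(ν.prod μ) =
      ∫ f : Expanding r, Real.log |(f.1.degree : ℝ)| ∂ν := by
    rw [integral_fun_fst (μ := ν) (ν := μ) fun f : Expanding r => Real.log |(f.1.degree : ℝ)|]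
    simp
  rw [e1]
  have h0' : ∫ p : Expanding r × UnitAddCircle, (Real.log (density μ (p.1.1 p.2)) -
      Real.log (density μ p.2)) ∂(ν.prod μ) = 0 := h0
  rw [h0', add_zero, lyapunov]

/-- The Lyapunov exponent is at most the mean logarithm of the degree. -/
theorem IsStationarySRB.lyapunov_le (hr : 2 ≤ r)
    (hν : Integrable (fun f : Expanding r => Real.log f.1.c2Norm) ν) (h : IsStationarySRB ν μ) :
    lyapunov ν μ ≤ ∫ f : Expanding r, Real.log |(f.1.degree : ℝ)| ∂ν := by
  have := h.isProbabilityMeasure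
  obtain ⟨hi, heq⟩ := h.integral_log_branchWeight hr hν
  have hw := integrable_branchWeight (ν := ν) hr h.absolutelyContinuous
  have h1 : ∫ p, Real.log (branchWeight μ p) ∂(ν.prod μ) ≤
      ∫ p, (branchWeight μ p - 1) ∂(ν.prod μ) := by
    refine integral_mono_ae hi (hw.sub (integrable_const 1)) ?_
    filter_upwards [h.ae_density_pos_prod] with p hp
    exact Real.log_le_sub_one_of_pos (branchWeight_pos hr hp)
  rw [integral_sub hw (integrable_const 1)] at h1
  have h2 := integral_branchWeight_le (ν := ν) hr h.absolutelyContinuous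
  simp only [integral_const, probReal_univ, smul_eq_mul, mul_one] at h1
  linarith

/-- In the equality case, all inverse branches have the same weight. -/
theorem IsStationarySRB.ae_branchWeight_eq_one (hr : 2 ≤ r)
    (hν : Integrable (fun f : Expanding r => Real.log f.1.c2Norm) ν) (h : IsStationarySRB ν μ)
    (heq : lyapunov ν μ = ∫ f : Expanding r, Real.log |(f.1.degree : ℝ)| ∂ν) :
    ∀ᵐ p ∂(ν.prod μ), branchWeight μ p = 1 := by
  have := h.isProbabilityMeasure
  obtain ⟨hi, h0⟩ := h.integral_log_branchWeight hr hν
  rw [heq, sub_self] at h0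
  have hw := integrable_branchWeight (ν := ν) hr h.absolutelyContinuous
  have hnn : 0 ≤ᵐ[ν.prod μ] fun p => branchWeight μ p - 1 - Real.log (branchWeight μ p) := by
    filter_upwards [h.ae_density_pos_prod] with p hp
    exact sub_nonneg.2 (Real.log_le_sub_one_of_pos (branchWeight_pos hr hp))
  have hw1 : Integrable (fun p => branchWeight μ p - 1) (ν.prod μ) := hw.sub (integrable_const 1)
  have hint : Integrable (fun p => branchWeight μ p - 1 - Real.log (branchWeight μ p)) (ν.prod μ) :=
    hw1.sub hi
  have hle : ∫ p, (branchWeight μ p - 1 - Real.log (branchWeight μ p)) ∂(ν.prod μ) ≤ 0 := by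
    rw [integral_sub hw1 hi]
    have h2 := integral_branchWeight_le (ν := ν) hr h.absolutelyContinuous
    have h3 : ∫ p, (branchWeight μ p - 1) ∂(ν.prod μ) = ∫ p, branchWeight μ p ∂(ν.prod μ) - 1 := by
      rw [integral_sub hw (integrable_const 1)]
      simp
    linarith
  have hz := (integral_eq_zero_iff_of_nonneg_ae hnn hint).1
    (le_antisymm hle (integral_nonneg_of_ae hnn))
  filter_upwards [hz, h.ae_density_pos_prod] with p hp hpos
  by_contra hne
  have := Real.log_lt_sub_one_of_pos (branchWeight_pos hr hpos) hne
  simp only [Pi.zero_apply] at hp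
  linarith

/-- In the equality case, almost every map multiplies the density by its degree. -/
theorem IsStationarySRB.ae_deriv_mul_density_eq (hr : 2 ≤ r)
    (hν : Integrable (fun f : Expanding r => Real.log f.1.c2Norm) ν) (h : IsStationarySRB ν μ)
    (heq : lyapunov ν μ = ∫ f : Expanding r, Real.log |(f.1.degree : ℝ)| ∂ν) :
    ∀ᵐ f : Expanding r ∂ν, ∀ᵐ y,
      |f.1.iterDeriv 1 y| * density μ (f.1 y) = |(f.1.degree : ℝ)| * density μ y := by
  have := h.isProbabilityMeasure
  have hρ := measurable_density μ
  filter_upwards [Measure.ae_ae_of_ae_prod (h.ae_branchWeight_eq_one hr hν heq)] with f hf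
  have hd : 0 < |(f.1.degree : ℝ)| := abs_pos.2 (f.degree_ne_zero hr)
  have hf1 : ∀ᵐ y ∂μ, |f.1.iterDeriv 1 y| * density μ (f.1 y) = |(f.1.degree : ℝ)| * density μ y := by
    filter_upwards [hf, ae_density_pos h.absolutelyContinuous] with y hy hpos
    rw [branchWeight, div_eq_one_iff_eq (mul_pos hd hpos).ne'] at hy
    exact hy
  -- The identity holds `μ`-almost everywhere, hence almost everywhere on the set where `ρ` is
  -- nonzero; on the zero set of `ρ` one inequality is trivial. Both sides have integral `|deg f|`,
  -- which upgrades the inequality to equality.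
  have hle : ∀ᵐ y, |(f.1.degree : ℝ)| * density μ y ≤ |f.1.iterDeriv 1 y| * density μ (f.1 y) := by
    have hdens : volume.withDensity (μ.rnDeriv volume) = μ :=
      Measure.withDensity_rnDeriv_eq _ _ h.absolutelyContinuous
    rw [← hdens, ae_withDensity_iff (Measure.measurable_rnDeriv _ _), hdens] at hf1
    filter_upwards [hf1] with y hy
    by_cases h0 : μ.rnDeriv volume y = 0
    · have : density μ y = 0 := by rw [density, h0, ENNReal.toReal_zero]
      rw [this, mul_zero]
      exact mul_nonneg (abs_nonneg _) (density_nonneg _ _)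
    · exact (hy h0).ge
  have hmL : Measurable fun y => |(f.1.degree : ℝ)| * density μ y := hρ.const_mul _
  have hmR : Measurable fun y => |f.1.iterDeriv 1 y| * density μ (f.1 y) :=
    (f.continuous_deriv hr).abs.measurable.mul (hρ.comp f.measurable_map)
  have hint : ∫⁻ y, ENNReal.ofReal (|(f.1.degree : ℝ)| * density μ y) =
      ENNReal.ofReal |(f.1.degree : ℝ)| := by
    simp only [ENNReal.ofReal_mul hd.le]
    rw [lintegral_const_mul' _ _ ENNReal.ofReal_ne_top, lintegral_density h.absolutelyContinuous,
      mul_one]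
  have hae := ae_eq_of_ae_le_of_lintegral_le
    (f := fun y => ENNReal.ofReal (|(f.1.degree : ℝ)| * density μ y))
    (g := fun y => ENNReal.ofReal (|f.1.iterDeriv 1 y| * density μ (f.1 y)))
    (hle.mono fun y hy => ENNReal.ofReal_le_ofReal hy) (by rw [hint]; exact ENNReal.ofReal_ne_top)
    hmR.ennreal_ofReal.aemeasurable (by
      rw [hint, lintegral_deriv_mul_density hr h.absolutelyContinuous])
  filter_upwards [hae] with y hy
  exact ((ENNReal.ofReal_eq_ofReal_iff (mul_nonneg hd.le (density_nonneg _ _))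
    (mul_nonneg (abs_nonneg _) (density_nonneg _ _))).1 hy).symm

/-- If `f` multiplies the density of `μ` by its degree, then `f` preserves `μ`. -/
theorem isStationarySRB_dirac (hr : 2 ≤ r) [IsProbabilityMeasure μ] (h : μ ≪ volume)
    {f : Expanding r} (hf : ∀ᵐ y,
      |f.1.iterDeriv 1 y| * density μ (f.1 y) = |(f.1.degree : ℝ)| * density μ y) :
    IsStationarySRB (Measure.dirac f) μ := by
  refine ⟨⟨inferInstance, fun A hA => ?_⟩, h⟩
  have hm : Measurable fun f : Expanding r => μ (f.1 ⁻¹' A) :=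
    measurable_measure_prodMk_left (Expanding.measurable_eval hA)
  have hd : 0 < |(f.1.degree : ℝ)| := abs_pos.2 (f.degree_ne_zero hr)
  rw [lintegral_dirac' _ hm]
  have hB := f.measurable_map hA
  rw [← lintegral_indicator_one hA, ← lintegral_indicator_one hB,
    ← lintegral_density_mul h (measurable_one.indicator hA),
    ← lintegral_density_mul h (measurable_one.indicator hB)]
  have h1 := f.lintegral_abs_deriv_mul_comp hr
    fun x => ENNReal.ofReal (density μ x) * A.indicator 1 x
  have h2 : ∫⁻ y, ENNReal.ofReal |f.1.iterDeriv 1 y| *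
      (ENNReal.ofReal (density μ (f.1 y)) * A.indicator 1 (f.1 y)) =
        ENNReal.ofReal |(f.1.degree : ℝ)| *
          ∫⁻ y, ENNReal.ofReal (density μ y) * (f.1 ⁻¹' A).indicator 1 y := by
    rw [← lintegral_const_mul' _ _ ENNReal.ofReal_ne_top]
    refine lintegral_congr_ae ?_
    filter_upwards [hf] with y hy
    rw [← mul_assoc, ← mul_assoc, ← ENNReal.ofReal_mul (abs_nonneg _),
      ← ENNReal.ofReal_mul (abs_nonneg _), hy]
    rfl
  rw [h2, natAbs_degree_eq] at h1
  exact (ENNReal.mul_right_inj (by simpa using f.degree_ne_zero hr) ENNReal.ofReal_ne_top).1 h1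

end RandomCircle

end

/-! ### Smoothness of solutions of functional equations along a contraction. -/

noncomputable section

/-- If `D (n + 1) = γ n + s · D n ∘ G` with `|s| ≤ κ < 1` and `γ n → g` geometrically, and `D n` is
the derivative of `W n`, then the pointwise limit of `W n` is differentiable, and its derivative is
the continuous solution of `w' = g + s · w' ∘ G`. -/
theorem exists_hasDerivAt_of_affine_recursion {κ : ℝ} (hκ0 : 0 ≤ κ) (hκ : κ < 1) {G s g : ℝ → ℝ}
    (hG : Continuous G) (hs : Continuous s) (hg : Continuous g) (hsκ : ∀ x, |s x| ≤ κ) {B : ℝ}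
    (hgB : ∀ x, |g x| ≤ B) {γ W D : ℕ → ℝ → ℝ} {C : ℝ} (hC : 0 ≤ C)
    (hγ : ∀ n x, |γ n x - g x| ≤ C * κ ^ n) (hD0 : ∀ x, D 0 x = 0)
    (hDs : ∀ n x, D (n + 1) x = γ n x + s x * D n (G x))
    (hder : ∀ n x, HasDerivAt (W n) (D n x) x) {w : ℝ → ℝ}
    (hw : ∀ x, Tendsto (fun n => W n x) atTop (𝓝 (w x))) :
    ∃ w' : ℝ → ℝ, Continuous w' ∧ (∀ x, HasDerivAt w (w' x) x) ∧
      ∀ x, w' x = g x + s x * w' (G x) := by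
  let gb : BoundedContinuousFunction ℝ ℝ := BoundedContinuousFunction.ofNormedAddCommGroup g hg B hgB
  let sb : BoundedContinuousFunction ℝ ℝ := BoundedContinuousFunction.ofNormedAddCommGroup s hs κ hsκ
  let Φ : BoundedContinuousFunction ℝ ℝ → BoundedContinuousFunction ℝ ℝ :=
    fun b => gb + sb * b.compContinuous ⟨G, hG⟩
  have hΦ : ∀ b x, Φ b x = g x + s x * b (G x) := fun b x => rfl
  -- The candidate derivative is the fixed point of the affine contraction `b ↦ g + s · b ∘ G` on
  -- bounded continuous functions.
  have hcontr : ContractingWith ⟨κ, hκ0⟩ Φ := by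
    refine ⟨by exact_mod_cast hκ, LipschitzWith.of_dist_le_mul fun a b => ?_⟩
    refine (BoundedContinuousFunction.dist_le (mul_nonneg hκ0 dist_nonneg)).2 fun x => ?_
    rw [hΦ, hΦ, Real.dist_eq, show g x + s x * a (G x) - (g x + s x * b (G x)) =
      s x * (a (G x) - b (G x)) by ring, abs_mul]
    exact mul_le_mul (hsκ x) (a.dist_coe_le_dist (g := b) (G x)) (abs_nonneg _) hκ0
  obtain ⟨b, hb⟩ : ∃ b, Φ b = b := ⟨_, hcontr.fixedPoint_isFixedPt⟩
  have hbx : ∀ x, b x = g x + s x * b (G x) := fun x => by rw [← hΦ, hb]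
  -- The error obeys `e (n+1) ≤ C κ^n + κ e n`. The slower rate `q = κ + (1 - κ) / 2` absorbs the
  -- forcing, and `A` is chosen so that `C ≤ A (1 - κ) / 2` and `A` bounds the initial error.
  set q : ℝ := (1 + κ) / 2 with hq
  set A : ℝ := ‖b‖ + 2 * C / (1 - κ) with hA
  have h1κ : 0 < 1 - κ := by linarith
  have hA0 : 0 ≤ A := by positivity
  have hCA : C ≤ A * ((1 - κ) / 2) := by
    have : C = 2 * C / (1 - κ) * ((1 - κ) / 2) := by field_simp
    have h2 : 0 ≤ ‖b‖ * ((1 - κ) / 2) := by positivity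
    rw [hA, add_mul]
    linarith
  have hκq : κ ≤ q := by linarith
  have hq0 : 0 ≤ q := hκ0.trans hκq
  have key : ∀ n x, |D n x - b x| ≤ A * q ^ n := by
    intro n
    induction n with
    | zero =>
      intro x
      rw [hD0, zero_sub, abs_neg, pow_zero, mul_one]
      have h1 := b.norm_coe_le_norm x
      rw [Real.norm_eq_abs] at h1
      have h2 : 0 ≤ 2 * C / (1 - κ) := by positivity
      linarith
    | succ n ih =>
      intro x
      rw [hDs, hbx x, show γ n x + s x * D n (G x) - (g x + s x * b (G x)) =
        (γ n x - g x) + s x * (D n (G x) - b (G x)) by ring]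
      refine (abs_add_le _ _).trans ?_
      rw [abs_mul]
      have h1 : |s x| * |D n (G x) - b (G x)| ≤ κ * (A * q ^ n) :=
        mul_le_mul (hsκ x) (ih _) (abs_nonneg _) hκ0
      have h2 : C * κ ^ n ≤ A * ((1 - κ) / 2) * q ^ n :=
        mul_le_mul hCA (pow_le_pow_left₀ hκ0 hκq n) (pow_nonneg hκ0 n) (by positivity)
      have h3 : A * q ^ (n + 1) = A * ((1 - κ) / 2) * q ^ n + κ * (A * q ^ n) := by
        rw [pow_succ, hq]
        ring
      linarith [hγ n x]
  have hunif : TendstoUniformly D b atTop := by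
    rw [Metric.tendstoUniformly_iff]
    intro ε hε
    have hlim : Tendsto (fun n => A * q ^ n) atTop (𝓝 0) := by
      simpa using (tendsto_pow_atTop_nhds_zero_of_lt_one hq0 (by linarith)).const_mul A
    filter_upwards [hlim.eventually_lt_const hε] with n hn x
    rw [dist_comm, Real.dist_eq]
    exact (key n x).trans_lt hn
  exact ⟨b, b.continuous, fun x => hasDerivAt_of_tendstoUniformly hunif
    (Eventually.of_forall fun n x => hder n x) hw x, hbx⟩

theorem Function.Periodic.exists_abs_le {f : ℝ → ℝ} {c : ℝ} (hp : Function.Periodic f c) (hc : c ≠ 0)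
    (hf : Continuous f) : ∃ B, 0 ≤ B ∧ ∀ x, |f x| ≤ B := by
  obtain ⟨B, hB⟩ := (hp.isBounded_of_continuous hc hf).exists_norm_le
  exact ⟨B, (norm_nonneg _).trans (hB (f 0) ⟨0, rfl⟩), fun x => hB _ ⟨x, rfl⟩⟩

theorem Function.Periodic.of_hasDerivAt {f f' : ℝ → ℝ} {c : ℝ} (hp : Function.Periodic f c)
    (hf : ∀ x, HasDerivAt f (f' x) x) : Function.Periodic f' c := fun x => by
  have h1 := (hf (x + c)).comp_add_const x c
  have h2 : (fun y => f (y + c)) = f := funext hp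
  rw [h2] at h1
  exact h1.unique (hf x)

theorem ContDiff.exists_hasDerivAt {f : ℝ → ℝ} {k : ℕ} (hf : ContDiff ℝ (k + 1 : ℕ) f) :
    ∃ f' : ℝ → ℝ, ContDiff ℝ k f' ∧ ∀ x, HasDerivAt f (f' x) x := by
  have h := contDiff_succ_iff_deriv.1 (by exact_mod_cast hf : ContDiff ℝ ((k : WithTop ℕ∞) + 1) f)
  exact ⟨deriv f, h.2.2, fun x => (h.1 x).hasDerivAt⟩

theorem contDiff_succ_of_hasDerivAt {f f' : ℝ → ℝ} {k : ℕ} (hf' : ContDiff ℝ k f')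
    (hf : ∀ x, HasDerivAt f (f' x) x) : ContDiff ℝ (k + 1 : ℕ) f := by
  have : ContDiff ℝ ((k : WithTop ℕ∞) + 1) f := by
    refine contDiff_succ_iff_deriv.2 ⟨fun x => (hf x).differentiableAt, by simp, ?_⟩
    rwa [show deriv f = f' from funext fun x => (hf x).deriv]
  exact_mod_cast this

/-- A continuous solution of `w = v + m · w ∘ G`, where `|m|` and `|G'|` are at most `κ < 1`, is as
smooth as the data. -/
theorem contDiff_of_eq_add_mul_comp {κ T : ℝ} (hκ0 : 0 ≤ κ) (hκ : κ < 1) (hT : T ≠ 0) {G G' : ℝ → ℝ}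
    (hG' : ∀ x, HasDerivAt G (G' x) x) (hGκ : ∀ x, |G' x| ≤ κ) (hGT : ∀ x, G (x + T) = G x + 1)
    (k : ℕ) (hG : ContDiff ℝ k G) {m v w : ℝ → ℝ} (hm : ContDiff ℝ k m)
    (hv : ContDiff ℝ k v) (hmT : Function.Periodic m T) (hvT : Function.Periodic v T)
    (hmκ : ∀ x, |m x| ≤ κ) (hw : Continuous w) (hw1 : Function.Periodic w 1)
    (heq : ∀ x, w x = v x + m x * w (G x)) : ContDiff ℝ k w := by
  induction k generalizing m v w with
  | zero =>
    simpa using hw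
  | succ k ih =>
    have hle : ((k : ℕ) : WithTop ℕ∞) ≤ ((k + 1 : ℕ) : WithTop ℕ∞) := by exact_mod_cast k.le_succ
    have hGk := hG.of_le hle
    have hwk : ContDiff ℝ k w :=
      ih hGk (hm.of_le hle) (hv.of_le hle) hmT hvT hmκ hw hw1 heq
    obtain ⟨m', hm', hdm⟩ := hm.exists_hasDerivAt
    obtain ⟨v', hv', hdv⟩ := hv.exists_hasDerivAt
    have hG'k : ContDiff ℝ k G' := by
      obtain ⟨G'', h1, h2⟩ := hG.exists_hasDerivAt
      rwa [show G' = G'' from funext fun x => (hG' x).unique (h2 x)]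
    have hm'T := hmT.of_hasDerivAt hdm
    have hv'T := hvT.of_hasDerivAt hdv
    have hG'T : Function.Periodic G' T := fun x => by
      have h1 := (hG' (x + T)).comp_add_const x T
      rw [show (fun y => G (y + T)) = fun y => G y + 1 from funext hGT] at h1
      exact h1.unique ((hG' x).add_const 1)
    have hwGT : Function.Periodic (fun x => w (G x)) T := fun x => by
      show w (G (x + T)) = w (G x)
      rw [hGT, hw1]
    have hgk : ContDiff ℝ k fun x => v' x + m' x * w (G x) := hv'.add (hm'.mul (hwk.comp hGk))
    have hgT : Function.Periodic (fun x => v' x + m' x * w (G x)) T := fun x => by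
      have h1 := hwGT x
      simp only at h1 ⊢
      rw [hv'T, hm'T, h1]
    obtain ⟨B, -, hB⟩ := hgT.exists_abs_le hT hgk.continuous
    obtain ⟨M, hM0, hM⟩ := hm'T.exists_abs_le hT hm'.continuous
    obtain ⟨L, hL0, hL⟩ := hw1.exists_abs_le one_ne_zero hw
    -- Differentiable approximations: iterate the equation from `0`. They converge to `w`
    -- geometrically, and their derivatives satisfy the affine recursion with multiplier `m · G'`.
    let W : ℕ → ℝ → ℝ := fun n => (fun (f : ℝ → ℝ) x => v x + m x * f (G x))^[n] 0
    have hWs : ∀ n x, W (n + 1) x = v x + m x * W n (G x) := fun n x => by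
      simp only [W, Function.iterate_succ_apply']
    have hWw : ∀ n x, |W n x - w x| ≤ L * κ ^ n := by
      intro n
      induction n with
      | zero =>
        intro x
        simpa [W] using hL x
      | succ n ihn =>
        intro x
        rw [hWs, heq x, show v x + m x * W n (G x) - (v x + m x * w (G x)) =
          m x * (W n (G x) - w (G x)) by ring, abs_mul]
        calc |m x| * |W n (G x) - w (G x)| ≤ κ * (L * κ ^ n) :=
              mul_le_mul (hmκ x) (ihn _) (abs_nonneg _) hκ0
          _ = L * κ ^ (n + 1) := by ring
    have hWd : ∀ n, Differentiable ℝ (W n) := by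
      intro n
      induction n with
      | zero => exact differentiable_const _
      | succ n ihn =>
        rw [show W (n + 1) = fun x => v x + m x * W n (G x) from funext (hWs n)]
        intro x
        exact (hdv x).differentiableAt.add ((hdm x).differentiableAt.mul
          ((ihn (G x)).comp x (hG' x).differentiableAt))
    obtain ⟨w', hw'c, hdw, heq'⟩ := exists_hasDerivAt_of_affine_recursion hκ0 hκ
      (s := fun x => m x * G' x) (g := fun x => v' x + m' x * w (G x))
      (γ := fun n x => v' x + m' x * W n (G x)) (W := W) (D := fun n => deriv (W n)) (w := w)
      (C := M * L) hG.continuous (hm.continuous.mul hG'k.continuous) hgk.continuous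
      (fun x => by
        rw [abs_mul]
        calc |m x| * |G' x| ≤ κ * 1 := mul_le_mul (hmκ x) ((hGκ x).trans hκ.le) (abs_nonneg _) hκ0
          _ = κ := mul_one κ)
      hB (by positivity)
      (fun n x => by
        rw [show v' x + m' x * W n (G x) - (v' x + m' x * w (G x)) =
          m' x * (W n (G x) - w (G x)) by ring, abs_mul, mul_assoc]
        exact mul_le_mul (hM x) (hWw n _) (abs_nonneg _) hM0)
      (fun x => by simp [W])
      (fun n x => by
        have h1 : HasDerivAt (W (n + 1)) (v' x + (m' x * W n (G x) +
            m x * (deriv (W n) (G x) * G' x))) x := by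
          rw [show W (n + 1) = fun x => v x + m x * W n (G x) from funext (hWs n)]
          exact (hdv x).add ((hdm x).mul ((hWd n (G x)).hasDerivAt.comp x (hG' x)))
        rw [h1.deriv]
        ring)
      (fun n x => (hWd n x).hasDerivAt)
      (fun x => by
        rw [tendsto_iff_dist_tendsto_zero]
        refine squeeze_zero (fun n => dist_nonneg) (fun n => (hWw n x)) ?_
        simpa using (tendsto_pow_atTop_nhds_zero_of_lt_one hκ0 hκ).const_mul L)
    refine contDiff_succ_of_hasDerivAt (f' := w') ?_ hdw
    -- The derivative solves an equation of the same form, with multiplier `m · G'` still bounded by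
    -- `κ`. Its inhomogeneous term contains `w ∘ G`, which is `C^k` by the first use of the
    -- induction hypothesis.
    refine ih hGk (m := fun x => m x * G' x) (v := fun x => v' x + m' x * w (G x))
      ((hm.of_le hle).mul hG'k) hgk (fun x => ?_) hgT (fun x => ?_) hw'c (hw1.of_hasDerivAt hdw) heq'
    · simp only
      rw [hmT, hG'T]
    · rw [abs_mul]
      calc |m x| * |G' x| ≤ κ * 1 := mul_le_mul (hmκ x) ((hGκ x).trans hκ.le) (abs_nonneg _) hκ0
        _ = κ := mul_one κ

/-- A continuous periodic solution of `u = v + u ∘ G`, where `G` is a contraction, is as smooth as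
the data. -/
theorem contDiff_of_eq_add_comp {κ T : ℝ} (hκ0 : 0 ≤ κ) (hκ : κ < 1) (hT : T ≠ 0) {G G' : ℝ → ℝ}
    (hG' : ∀ x, HasDerivAt G (G' x) x) (hGκ : ∀ x, |G' x| ≤ κ) (hGT : ∀ x, G (x + T) = G x + 1)
    (k : ℕ) (hG : ContDiff ℝ (k + 1 : ℕ) G) {v u : ℝ → ℝ} (hv : ContDiff ℝ (k + 1 : ℕ) v)
    (hvT : Function.Periodic v T) (hu : Continuous u) (hu1 : Function.Periodic u 1)
    (heq : ∀ x, u x = v x + u (G x)) : ContDiff ℝ (k + 1 : ℕ) u := by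
  have hle : ((k : ℕ) : WithTop ℕ∞) ≤ ((k + 1 : ℕ) : WithTop ℕ∞) := by exact_mod_cast k.le_succ
  obtain ⟨v', hv', hdv⟩ := hv.exists_hasDerivAt
  have hv'T := hvT.of_hasDerivAt hdv
  have hG'k : ContDiff ℝ k G' := by
    obtain ⟨G'', h1, h2⟩ := hG.exists_hasDerivAt
    rwa [show G' = G'' from funext fun x => (hG' x).unique (h2 x)]
  have hG'T : Function.Periodic G' T := fun x => by
    have h1 := (hG' (x + T)).comp_add_const x T
    rw [show (fun y => G (y + T)) = fun y => G y + 1 from funext hGT] at h1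
    exact h1.unique ((hG' x).add_const 1)
  obtain ⟨B, -, hB⟩ := hv'T.exists_abs_le hT hv'.continuous
  have hcontr : ContractingWith ⟨κ, hκ0⟩ G := by
    refine ⟨by exact_mod_cast hκ, lipschitzWith_of_nnnorm_deriv_le
      (fun x => (hG' x).differentiableAt) fun x => ?_⟩
    rw [(hG' x).deriv]
    exact_mod_cast hGκ x
  set p := hcontr.fixedPoint with hp
  have hpG : ∀ x, Tendsto (fun n => G^[n] x) atTop (𝓝 p) := hcontr.tendsto_iterate_fixedPoint
  -- The multiplier is now `1`, so iteration does not contract. Starting from the constant `u p`,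
  -- where `p` is the fixed point of `G`, the error is `u p - u (G^[n] x)`, which tends to `0` by
  -- continuity of `u`.
  let W : ℕ → ℝ → ℝ := fun n => (fun (f : ℝ → ℝ) x => v x + f (G x))^[n] fun _ => u p
  have hWs : ∀ n x, W (n + 1) x = v x + W n (G x) := fun n x => by
    simp only [W, Function.iterate_succ_apply']
  have hWu : ∀ n x, W n x = u x + (u p - u (G^[n] x)) := by
    intro n
    induction n with
    | zero => intro x; simp [W]
    | succ n ih =>
      intro x
      rw [hWs, ih, heq x, Function.iterate_succ_apply]
      ring
  have hWd : ∀ n, Differentiable ℝ (W n) := by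
    intro n
    induction n with
    | zero => exact differentiable_const _
    | succ n ihn =>
      rw [show W (n + 1) = fun x => v x + W n (G x) from funext (hWs n)]
      intro x
      exact (hdv x).differentiableAt.add ((ihn (G x)).comp x (hG' x).differentiableAt)
  obtain ⟨u', hu'c, hdu, heq'⟩ := exists_hasDerivAt_of_affine_recursion hκ0 hκ
    (s := G') (g := v') (γ := fun _ => v') (W := W) (D := fun n => deriv (W n)) (w := u)
    (C := 0) hG.continuous hG'k.continuous hv'.continuous hGκ hB le_rfl (fun n x => by simp)
    (fun x => by simp [W])
    (fun n x => by
      have h1 : HasDerivAt (W (n + 1)) (v' x + deriv (W n) (G x) * G' x) x := by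
        rw [show W (n + 1) = fun x => v x + W n (G x) from funext (hWs n)]
        exact (hdv x).add ((hWd n (G x)).hasDerivAt.comp x (hG' x))
      rw [h1.deriv]
      ring)
    (fun n x => (hWd n x).hasDerivAt)
    (fun x => by
      simp only [hWu]
      have h1 := (hu.tendsto p).comp (hpG x)
      have h2 : Tendsto (fun n => u x + (u p - u (G^[n] x))) atTop (𝓝 (u x + (u p - u p))) :=
        tendsto_const_nhds.add (tendsto_const_nhds.sub h1)
      simpa using h2)
  refine contDiff_succ_of_hasDerivAt (f' := u') ?_ hdu
  -- Differentiating once produces the multiplier `G'`, which is contracting, so the previous case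
  -- applies to `u'`.
  exact contDiff_of_eq_add_mul_comp hκ0 hκ hT hG' hGκ hGT k (hG.of_le hle) hG'k hv' hG'T hv'T hGκ
    hu'c (hu1.of_hasDerivAt hdu) heq'

end

/-! ### Regularity of an absolutely continuous measure preserved by one expanding map. -/

noncomputable section

namespace RandomCircle

variable {r : ℕ∞}

/-- A pointwise bounded sequence of log-Lipschitz densities has a log-Lipschitz pointwise limit along
an ultrafilter. -/
theorem exists_logLip_of_tendsto_ae {a : ℝ} {ψ : ℕ → UnitAddCircle → ℝ}
    (hψ : ∀ n, LogLipDensity a (ψ n)) {ρ : UnitAddCircle → ℝ}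
    (hρ : ∀ᵐ x, Tendsto (fun n => ψ n x) atTop (𝓝 (ρ x))) (hρ1 : ∫ x, ρ x = 1) :
    ∃ p, LogLipDensity a p ∧ ρ =ᵐ[volume] p := by
  have hlim : ∀ x, ∃ c, Real.exp (-a) ≤ c ∧ Tendsto (fun n => ψ n x) (hyperfilter ℕ) (𝓝 c) := by
    intro x
    have hmem : Set.Icc (Real.exp (-a)) (Real.exp a) ∈ (hyperfilter ℕ).map fun n => ψ n x :=
      mem_map.2 (univ_mem' fun n => ⟨(hψ n).exp_neg_le x, (hψ n).le_exp x⟩)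
    obtain ⟨c, hc, h⟩ := isCompact_Icc.ultrafilter_le_nhds _ (le_principal_iff.2 hmem)
    exact ⟨c, hc.1, h⟩
  choose p hp hpt using hlim
  have hae : ρ =ᵐ[volume] p := by
    filter_upwards [hρ] with x hx
    exact tendsto_nhds_unique (hx.mono_left Nat.hyperfilter_le_atTop) (hpt x)
  refine ⟨p, ⟨fun x => (Real.exp_pos _).trans_le (hp x), fun x y => ?_, ?_⟩, hae⟩
  · exact le_of_tendsto_of_tendsto' (hpt x) ((hpt y).const_mul _) fun n => (hψ n).le x y
  · rw [← integral_congr_ae hae, hρ1]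

theorem markov_dirac (f : Expanding r) {h : UnitAddCircle → ℝ} (hh : IsTest h) :
    markov (Measure.dirac f) h = fun x => h (f.1 x) := by
  funext x
  have hm : Measurable fun g : Expanding r => h (g.1 x) :=
    hh.comp_eval.comp measurable_prodMk_left
  exact integral_dirac' _ _ hm.stronglyMeasurable

/-- The constant `K / (1 - κ)` is the fixed point of `a ↦ κ a + K`, so for a single map this cone is
invariant and contains all images of Lebesgue measure. -/
theorem Expanding.exists_logLipDensity_iterate (hr : 2 ≤ r) (f : Expanding r) :
    ∃ b, ∀ n : ℕ, ∃ ψ, LogLipDensity b ψ ∧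
      ∀ h, IsTest h → ∫ x, ψ x * h x = ∫ x, (markov (Measure.dirac f))^[n] h x := by
  have h1 := f.one_lt_minDeriv hr
  have hκ : f.1.minDeriv⁻¹ < 1 := inv_lt_one_of_one_lt₀ h1
  have hK := f.one_lt_c2Norm hr
  have h1κ : 0 < 1 - f.1.minDeriv⁻¹ := by linarith
  refine ⟨f.1.c2Norm / (1 - f.1.minDeriv⁻¹), fun n => ?_⟩
  have hb : f.1.minDeriv⁻¹ * (f.1.c2Norm / (1 - f.1.minDeriv⁻¹)) + f.1.c2Norm =
      f.1.c2Norm / (1 - f.1.minDeriv⁻¹) := by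
    have : f.1.minDeriv ≠ 0 := by positivity
    have : f.1.minDeriv - 1 ≠ 0 := by linarith
    field_simp
    ring
  induction n with
  | zero =>
    exact ⟨fun _ => 1, LogLipDensity.const (by positivity), fun h _ => by simp⟩
  | succ n ih =>
    obtain ⟨ψ, hψ, hψi⟩ := ih
    obtain ⟨ψ', hψ', hψi'⟩ := f.exists_transfer hr hψ
    rw [hb] at hψ'
    refine ⟨ψ', hψ', fun h hh => ?_⟩
    rw [hψi' h hh.measurable hh.abs_le_one, hψi _ (hh.comp f), Function.iterate_succ_apply,
      markov_dirac f hh]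

/-- The sign of `φ - ψ` is itself an admissible test function. -/
theorem integral_abs_sub_le_of_test {φ ψ : UnitAddCircle → ℝ} (hφm : Measurable φ)
    (hψm : Measurable ψ) {ε : ℝ} (h : ∀ h, IsTest h → |∫ x, (φ x - ψ x) * h x| ≤ ε) :
    ∫ x, |φ x - ψ x| ≤ ε := by
  have hs : MeasurableSet {x | 0 ≤ φ x - ψ x} := measurableSet_le measurable_const (hφm.sub hψm)
  classical
  have ht : IsTest fun x => if 0 ≤ φ x - ψ x then (1 : ℝ) else -1 :=
    ⟨Measurable.ite hs measurable_const measurable_const, fun x => by split_ifs <;> simp⟩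
  have h1 := h _ ht
  have h2 : ∀ x, (φ x - ψ x) * (if 0 ≤ φ x - ψ x then (1 : ℝ) else -1) = |φ x - ψ x| := fun x => by
    split_ifs with hx
    · rw [mul_one, abs_of_nonneg hx]
    · rw [abs_of_neg (not_le.1 hx)]
      ring
  simp only [h2] at h1
  exact (le_abs_self _).trans h1

/-- The density of an absolutely continuous measure preserved by an expanding map is log-Lipschitz. -/
theorem IsStationarySRB.exists_logLipDensity (hr : 2 ≤ r) {f : Expanding r}
    {μ : Measure UnitAddCircle} (h : IsStationarySRB (Measure.dirac f) μ) :
    ∃ b p, LogLipDensity b p ∧ density μ =ᵐ[volume] p := by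
  have := h.isProbabilityMeasure
  have hac := h.absolutelyContinuous
  have hρ := integrable_density μ
  obtain ⟨b, hb⟩ := f.exists_logLipDensity_iterate hr
  choose ψ hψ hψi using hb
  have hν : Integrable (fun f : Expanding r => Real.log f.1.c2Norm) (Measure.dirac f) := by
    have hm : Measurable fun f : Expanding r => Real.log f.1.c2Norm :=
      Real.measurable_log.comp (Expanding.measurable_c2Norm hr)
    refine ⟨hm.aestronglyMeasurable, ?_⟩
    rw [HasFiniteIntegral, lintegral_dirac' _ hm.enorm]
    exact enorm_lt_top
  -- Decay for the Dirac mass at `f`, applied to `ρ - 1`, shows that the images of Lebesgue measure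
  -- converge in `L¹` to the invariant density `ρ`. A subsequence converges almost everywhere, and
  -- the cone bound survives.
  have hL1 : Tendsto (fun n => ∫ x, |density μ x - ψ n x|) atTop (𝓝 0) := by
    rw [Metric.tendsto_atTop]
    intro ε hε
    obtain ⟨N, hN⟩ := exists_forall_abs_integral_mul_iterate_markov_le hr hν
      (φ := fun x => density μ x - 1) (hρ.sub (integrable_const 1)) (by
        rw [integral_sub hρ (integrable_const 1), integral_density hac]
        simp) (half_pos hε)
    refine ⟨N, fun n hn => ?_⟩
    rw [Real.dist_eq, sub_zero, abs_of_nonneg (integral_nonneg fun x => abs_nonneg _)]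
    refine (integral_abs_sub_le_of_test (measurable_density μ) (hψ n).continuous.measurable
      fun t ht => ?_).trans_lt (half_lt_self hε)
    have hQ := ht.iterate_markov (ν := Measure.dirac f) n
    have h1 := hN n hn t ht
    have hinv : ∫ x, density μ x * (markov (Measure.dirac f))^[n] t x = ∫ x, density μ x * t x := by
      rw [integral_density_mul hac, integral_density_mul hac, ← integral_iterate_stepMeasure _ ht,
        h.toIsStationary.iterate]
    have hQi : Integrable fun x => (markov (Measure.dirac f))^[n] t x := by
      simpa using hQ.integrable_mul (integrable_const (1 : ℝ))
    simp only [sub_mul, one_mul] at h1 ⊢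
    rw [integral_sub (hQ.integrable_mul hρ) hQi, hinv, ← hψi n t ht] at h1
    rwa [integral_sub (ht.integrable_mul hρ) (ht.integrable_mul (hψ n).integrable)]
  have hmeas : TendstoInMeasure volume ψ atTop (density μ) := by
    refine tendstoInMeasure_of_tendsto_eLpNorm one_ne_zero
      (fun n => (hψ n).continuous.aestronglyMeasurable) (measurable_density μ).aestronglyMeasurable ?_
    have hint : ∀ n, Integrable fun x => |density μ x - ψ n x| :=
      fun n => (hρ.sub (hψ n).integrable).abs
    have heq : ∀ n, eLpNorm (ψ n - density μ) 1 volume =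
        ENNReal.ofReal (∫ x, |density μ x - ψ n x|) := fun n => by
      rw [eLpNorm_one_eq_lintegral_enorm,
        ofReal_integral_eq_lintegral_ofReal (hint n) (ae_of_all _ fun x => abs_nonneg _)]
      refine lintegral_congr fun x => ?_
      rw [Pi.sub_apply, abs_sub_comm, Real.enorm_eq_ofReal_abs]
    simp only [heq]
    simpa using ENNReal.tendsto_ofReal hL1
  obtain ⟨k, -, hk⟩ := hmeas.exists_seq_tendsto_ae
  exact ⟨b, exists_logLip_of_tendsto_ae (fun n => hψ (k n)) hk (integral_density hac)⟩

/-- If `f` multiplies the density of `μ` by its degree, so it does with any continuous version. -/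
theorem Expanding.deriv_mul_eq_of_ae (hr : 2 ≤ r) (f : Expanding r) {ρ p : UnitAddCircle → ℝ}
    (hf : ∀ᵐ y, |f.1.iterDeriv 1 y| * ρ (f.1 y) = |(f.1.degree : ℝ)| * ρ y)
    (hρp : ρ =ᵐ[volume] p) (hp : Continuous p) (y : UnitAddCircle) :
    |f.1.iterDeriv 1 y| * p (f.1 y) = |(f.1.degree : ℝ)| * p y := by
  have hae : (fun y => |f.1.iterDeriv 1 y| * p (f.1 y)) =ᵐ[volume]
      fun y => |(f.1.degree : ℝ)| * p y := by
    filter_upwards [hf, hρp, (f.quasiMeasurePreserving hr).ae hρp] with y h1 h2 h3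
    rw [← h2, ← h3, h1]
  exact congrFun ((((f.continuous_deriv hr).abs.mul
    (hp.comp f.1.isCr.continuous)).ae_eq_iff_eq volume (continuous_const.mul hp)).1 hae) y

end RandomCircle

end

/-! ### Construction of the smooth conjugacy, and the converse. -/

noncomputable section

namespace RandomCircle

variable {r : ℕ∞}

/-- A continuous density that `f` multiplies by its degree is smooth. -/
theorem Expanding.contDiff_log_of_deriv_mul_eq (hr : 2 ≤ r) (f : Expanding r)
    {p : UnitAddCircle → ℝ} (hpc : Continuous p) (hpos : ∀ x, 0 < p x)
    (heq : ∀ y, |f.1.iterDeriv 1 y| * p (f.1 y) = |(f.1.degree : ℝ)| * p y) {k : ℕ}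
    (hk : ((k + 1 + 1 : ℕ) : ℕ∞) ≤ r) :
    ContDiff ℝ (k + 1 : ℕ) fun x : ℝ => Real.log (p x) := by
  obtain ⟨e, he⟩ := f.exists_homeomorph_lift hr
  have hF : ContDiff ℝ (k + 1 + 1 : ℕ) f.1.lift :=
    f.1.contDiff_lift.of_le (by exact_mod_cast hk)
  have hle : ((k + 1 : ℕ) : WithTop ℕ∞) ≤ ((k + 1 + 1 : ℕ) : WithTop ℕ∞) := by
    exact_mod_cast (k + 1).le_succ
  have hG : ContDiff ℝ (k + 1 : ℕ) e.symm :=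
    e.contDiff_symm_deriv (f' := fun x : ℝ => f.1.iterDeriv 1 x) (fun x => f.deriv_ne_zero _)
      (fun x => by rw [he]; exact f.1.hasDerivAt_lift hr x) (by rw [he]; exact hF.of_le hle)
  have hF' : ContDiff ℝ (k + 1 : ℕ) fun x : ℝ => f.1.iterDeriv 1 x := by
    obtain ⟨F', h1, h2⟩ := hF.exists_hasDerivAt
    rwa [show (fun x : ℝ => f.1.iterDeriv 1 x) = F' from
      funext fun x => (f.1.hasDerivAt_lift hr x).unique (h2 x)]
  have hGT : ∀ x, e.symm (x + f.1.degree) = e.symm x + 1 := fun x => by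
    apply e.injective
    rw [e.apply_symm_apply, he, CrMap.lift_add_one, ← he, e.apply_symm_apply]
  have hκ1 := f.one_lt_minDeriv hr
  have hκ0 : 0 ≤ f.1.minDeriv⁻¹ := inv_nonneg.2 (by linarith)
  have hcoe : ∀ x : ℝ, ((x + 1 : ℝ) : UnitAddCircle) = x := fun x => by
    rw [AddCircle.coe_add, AddCircle.coe_period, add_zero]
  -- Logarithms of the identity at `y = e.symm x` give `log p(x) = log|deg f| - log|f'(y)| + log
  -- p(y)`, with the period `T` equal to the degree. `Real.log` ignores signs, so `f'` needs no
  -- absolute value.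
  refine contDiff_of_eq_add_comp hκ0 (inv_lt_one_of_one_lt₀ hκ1) (f.degree_ne_zero hr)
    (f.hasDerivAt_symm hr he) (fun x => ?_) hGT k hG
    (v := fun x => Real.log |(f.1.degree : ℝ)| - Real.log (f.1.iterDeriv 1 (e.symm x : ℝ)))
    (contDiff_const.sub ((hF'.comp hG).log fun x => f.deriv_ne_zero _)) (fun x => ?_)
    ((hpc.comp continuous_coe).log fun x => (hpos x).ne') (fun x => ?_) (fun x => ?_)
  · rw [abs_inv]
    exact inv_anti₀ (by linarith) (f.1.minDeriv_le _)
  · simp only [hGT, hcoe]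
  · simp only [hcoe]
  · have h1 := heq (e.symm x : ℝ)
    have h2 : f.1 ((e.symm x : ℝ) : UnitAddCircle) = (x : UnitAddCircle) := by
      rw [← f.1.coe_lift, ← he, e.apply_symm_apply]
    rw [h2] at h1
    have h3 := congrArg Real.log h1
    rw [Real.log_mul (abs_ne_zero.2 (f.deriv_ne_zero _)) (hpos _).ne',
      Real.log_mul (abs_ne_zero.2 (f.degree_ne_zero hr)) (hpos _).ne', Real.log_abs] at h3
    linarith

/-- The primitive of a smooth positive periodic density of integral one is a diffeomorphism of the
line commuting with the unit translation. -/
theorem exists_homeomorph_primitive (hr : 2 ≤ r) {p : UnitAddCircle → ℝ} (hpc : Continuous p)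
    (hpos : ∀ x, 0 < p x) (hp1 : ∫ x, p x = 1)
    (hlog : ∀ k : ℕ, ((k + 1 + 1 : ℕ) : ℕ∞) ≤ r →
      ContDiff ℝ (k + 1 : ℕ) fun x : ℝ => Real.log (p x)) :
    ∃ E : ℝ ≃ₜ ℝ, (∀ x : ℝ, HasDerivAt E (p x) x) ∧ (∀ x, E (x + 1) = E x + 1) ∧ ContDiff ℝ r E ∧
      ContDiff ℝ r E.symm := by
  have hpc' : Continuous fun x : ℝ => p x := hpc.comp continuous_coe
  set H : ℝ → ℝ := fun x => ∫ t in (0 : ℝ)..x, p t with hH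
  have hd : ∀ x : ℝ, HasDerivAt H (p x) x := fun x => (hpc'.integral_hasStrictDerivAt 0 x).hasDerivAt
  have hadd : ∀ x, H (x + 1) = H x + 1 := fun x => by
    have h1 : ∫ t in x..x + 1, p t = 1 := by
      rw [intervalIntegral.integral_of_le (by linarith), ← integral_eq_setIntegral x p, hp1]
    have h2 := intervalIntegral.integral_add_adjacent_intervals (hpc'.intervalIntegrable 0 x)
      (hpc'.intervalIntegrable (μ := volume) x (x + 1))
    rw [h1] at h2
    exact h2.symm
  have hmono : StrictMono H := strictMono_of_deriv_pos fun x => by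
    rw [(hd x).deriv]
    exact hpos x
  have hcont : Continuous H := continuous_iff_continuousAt.2 fun x => (hd x).continuousAt
  have hint : ∀ n : ℤ, H n = n + H 0 := fun n => by
    have hper : Function.Periodic (fun x => H x - x) 1 := fun x => by
      simp only [hadd]
      ring
    have := hper.int_mul_eq n
    simp only [mul_one, sub_zero] at this
    linarith
  have hsurj : Function.Surjective H := fun y => by
    have hmem := mem_range_of_exists_le_of_exists_ge hcont (c := y)
      ⟨(⌊y - H 0⌋ : ℤ), by rw [hint]; linarith [Int.floor_le (y - H 0)]⟩
      ⟨(⌈y - H 0⌉ : ℤ), by rw [hint]; linarith [Int.le_ceil (y - H 0)]⟩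
    exact hmem
  have hpk : ∀ k : ℕ, ((k + 1 + 1 : ℕ) : ℕ∞) ≤ r → ContDiff ℝ (k + 1 : ℕ) fun x : ℝ => p x :=
    fun k hk => by
      have h1 := (hlog k hk).exp
      simpa only [Real.exp_log (hpos _)] using h1
  have hHr : ContDiff ℝ r H := by
    refine contDiff_iff_forall_nat_le.2 fun n hn => ?_
    -- The regularity of `log p` is available only from order two of `f` on, so small orders `n` are
    -- raised to `2 ≤ r`.
    have hmax : ((max n 2 : ℕ) : ℕ∞) ≤ r := by
      rcases le_total n 2 with h | h
      · rw [max_eq_right h]; exact_mod_cast hr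
      · rw [max_eq_left h]; exact hn
    obtain ⟨k, hk⟩ : ∃ k, max n 2 = k + 1 + 1 := ⟨max n 2 - 2, by omega⟩
    have h1 : ContDiff ℝ (k + 1 + 1 : ℕ) H :=
      contDiff_succ_of_hasDerivAt (hpk k (hk ▸ hmax)) hd
    refine h1.of_le ?_
    exact_mod_cast hk ▸ le_max_left n 2
  refine ⟨(hmono.orderIsoOfSurjective H hsurj).toHomeomorph, hd, hadd, hHr, ?_⟩
  exact Homeomorph.contDiff_symm_deriv _ (fun x => (hpos x).ne') hd hHr

/-- A `C^r` diffeomorphism of the line commuting with the unit translation covers a `C^r`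
diffeomorphism of the circle. -/
theorem exists_crDiffeo_of_lift (E : ℝ ≃ₜ ℝ) (hE : ∀ x, E (x + 1) = E x + 1)
    (hEr : ContDiff ℝ r E) (hEr' : ContDiff ℝ r E.symm) :
    ∃ h : CrDiffeo r, (∀ x : ℝ, h.toHomeomorph x = (E x : UnitAddCircle)) ∧
      ∀ x : ℝ, h.toHomeomorph.symm x = (E.symm x : UnitAddCircle) := by
  have hcoe : ∀ x : ℝ, ((x + 1 : ℝ) : UnitAddCircle) = x := fun x => by
    rw [AddCircle.coe_add, AddCircle.coe_period, add_zero]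
  have hE' : ∀ x, E.symm (x + 1) = E.symm x + 1 := fun x => by
    apply E.injective
    rw [hE, E.apply_symm_apply, E.apply_symm_apply]
  have h1 : Function.Periodic (fun x => (E x : UnitAddCircle)) 1 := fun x => by
    simp only [hE, hcoe]
  have h2 : Function.Periodic (fun x => (E.symm x : UnitAddCircle)) 1 := fun x => by
    simp only [hE', hcoe]
  let h : UnitAddCircle ≃ₜ UnitAddCircle :=
    { toFun := h1.lift
      invFun := h2.lift
      left_inv := fun x => by
        obtain ⟨y, -, rfl⟩ := exists_coe_eq x
        show ((E.symm (E y) : ℝ) : UnitAddCircle) = y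
        rw [E.symm_apply_apply]
      right_inv := fun x => by
        obtain ⟨y, -, rfl⟩ := exists_coe_eq x
        show ((E (E.symm y) : ℝ) : UnitAddCircle) = y
        rw [E.apply_symm_apply]
      continuous_toFun := continuous_of_comp_coe (continuous_coe.comp E.continuous)
      continuous_invFun := continuous_of_comp_coe (continuous_coe.comp E.symm.continuous) }
  exact ⟨⟨h, ⟨E, hEr, fun _ => rfl⟩, ⟨E.symm, hEr', fun _ => rfl⟩⟩, fun _ => rfl, fun _ => rfl⟩

/-- If `f` multiplies the derivative of `h` by its degree, then `h` conjugates `f` to an affine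
map. -/
theorem Expanding.conjugatesToAffine_of_deriv_mul_eq (hr : 2 ≤ r) (f : Expanding r)
    {p : UnitAddCircle → ℝ} (heq : ∀ y, |f.1.iterDeriv 1 y| * p (f.1 y) = |(f.1.degree : ℝ)| * p y)
    {E : ℝ ≃ₜ ℝ} (hE : ∀ x : ℝ, HasDerivAt E (p x) x) {h : CrDiffeo r}
    (h1 : ∀ x : ℝ, h.toHomeomorph x = (E x : UnitAddCircle))
    (h2 : ∀ x : ℝ, h.toHomeomorph.symm x = (E.symm x : UnitAddCircle)) :
    ConjugatesToAffine h f.1 := by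
  -- The degree is a value of `f'`, which has constant sign; both absolute values therefore drop
  -- with the same sign.
  have hsgn : ∀ y, p (f.1 y) * f.1.iterDeriv 1 y = f.1.degree * p y := fun y => by
    obtain ⟨z, hz⟩ := f.1.exists_degree_eq_iterDeriv hr
    have h3 := heq y
    rcases f.deriv_pos_or_neg hr with hs | hs
    · rw [abs_of_pos (hs y), ← hz, abs_of_pos (hs z), hz] at h3
      linarith
    · rw [abs_of_neg (hs y), ← hz, abs_of_neg (hs z), hz] at h3
      linarith
  have hder : ∀ x : ℝ, HasDerivAt (fun x => E (f.1.lift x) - f.1.degree * E x) 0 x := fun x => by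
    have h3 := ((hE (f.1.lift x)).comp x (f.1.hasDerivAt_lift hr x)).sub
      ((hE x).const_mul (f.1.degree : ℝ))
    rw [f.1.coe_lift, hsgn, sub_self] at h3
    exact h3
  have hconst : ∀ x, E (f.1.lift x) = f.1.degree * E x + (E (f.1.lift 0) - f.1.degree * E 0) :=
    fun x => by
      have := is_const_of_deriv_eq_zero (fun x => (hder x).differentiableAt)
        (fun x => (hder x).deriv) x 0
      linarith
  refine ⟨((E (f.1.lift 0) - f.1.degree * E 0 : ℝ) : UnitAddCircle), fun x => ?_⟩
  obtain ⟨y, -, rfl⟩ := exists_coe_eq x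
  rw [h2, ← f.1.coe_lift, h1, hconst, E.apply_symm_apply, AddCircle.coe_add, ← AddCircle.coe_zsmul,
    zsmul_eq_mul]

theorem continuous_eval_const (x : UnitAddCircle) : Continuous fun f : CrMap r => f x :=
  CrMap.continuous_eval.comp (continuous_id.prodMk continuous_const)

/-- The translation must be the value at `0`, which eliminates the existential. What remains is an
intersection over `x` of equalities between continuous functions of `f`, the degree being continuous
into the discrete integers. -/
theorem isClosed_conjugatesToAffine (hr : 2 ≤ r) (h : CrDiffeo r) :
    IsClosed {f : CrMap r | ConjugatesToAffine h f} := by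
  have hset : {f : CrMap r | ConjugatesToAffine h f} = ⋂ x : UnitAddCircle,
      {f | h.toHomeomorph (f (h.toHomeomorph.symm x)) =
        f.degree • x + h.toHomeomorph (f (h.toHomeomorph.symm 0))} := by
    ext f
    simp only [Set.mem_iInter]
    constructor
    · rintro ⟨ρ, hρ⟩ x
      have h0 := hρ 0
      rw [smul_zero, zero_add] at h0
      show h.toHomeomorph (f (h.toHomeomorph.symm x)) =
        f.degree • x + h.toHomeomorph (f (h.toHomeomorph.symm 0))
      rw [hρ x, h0]
    · intro hf
      exact ⟨_, hf⟩
  rw [hset]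
  have hdeg : Continuous fun f : CrMap r => f.degree :=
    Int.isClosedEmbedding_coe_real.isInducing.continuous_iff.2 (CrMap.continuous_degree hr)
  refine isClosed_iInter fun x => isClosed_eq
    (h.toHomeomorph.continuous.comp (continuous_eval_const _)) (Continuous.add ?_
      (h.toHomeomorph.continuous.comp (continuous_eval_const _)))
  have h3 : Continuous fun n : ℤ => n • x := continuous_of_discreteTopology
  exact h3.comp hdeg

variable {ν : Measure (Expanding r)} [IsProbabilityMeasure ν] {μ : Measure UnitAddCircle}

/-- In the equality case, the maps in the support are simultaneously conjugate to affine maps. -/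
theorem IsStationarySRB.exists_conjugatesToAffine (hr : 2 ≤ r)
    (hν : Integrable (fun f : Expanding r => Real.log f.1.c2Norm) ν) (h : IsStationarySRB ν μ)
    (heq : lyapunov ν μ = ∫ f : Expanding r, Real.log |(f.1.degree : ℝ)| ∂ν) :
    ∃ h : CrDiffeo r, ∀ f ∈ ν.support, ConjugatesToAffine h f.1 := by
  have := h.isProbabilityMeasure
  have hae := h.ae_deriv_mul_density_eq hr hν heq
  -- One good map determines a smooth version `p` of the density, and hence the diffeomorphism.
  -- Since `p` depends only on `μ`, up to null sets, the same diffeomorphism serves almost every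
  -- map, and by closedness the whole support.
  obtain ⟨f, hf⟩ := hae.exists
  obtain ⟨b, p, hp, hρp⟩ :=
    (isStationarySRB_dirac hr h.absolutelyContinuous hf).exists_logLipDensity hr
  have hfp := f.deriv_mul_eq_of_ae hr hf hρp hp.continuous
  obtain ⟨E, hE, hE1, hEr, hEr'⟩ := exists_homeomorph_primitive hr hp.continuous hp.pos hp.integral
    fun k hk => f.contDiff_log_of_deriv_mul_eq hr hp.continuous hp.pos hfp hk
  obtain ⟨H, h1, h2⟩ := exists_crDiffeo_of_lift E hE1 hEr hEr'
  refine ⟨H, fun g hg => ?_⟩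
  have hcl : IsClosed {g : Expanding r | ConjugatesToAffine H g.1} :=
    (isClosed_conjugatesToAffine hr H).preimage continuous_subtype_val
  have hfull : ∀ᵐ g : Expanding r ∂ν, ConjugatesToAffine H g.1 := by
    filter_upwards [hae] with g hg
    exact g.conjugatesToAffine_of_deriv_mul_eq hr
      (g.deriv_mul_eq_of_ae hr hg hρp hp.continuous) hE h1 h2
  exact Measure.support_subset_of_isClosed hcl hfull hg

namespace CrDiffeo

/-- The underlying `C^r` map of a diffeomorphism. -/
def toCrMap (h : CrDiffeo r) : CrMap r := ⟨h.toHomeomorph, h.isCr⟩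

theorem iterDeriv_one_ne_zero (hr : 2 ≤ r) (h : CrDiffeo r) (x : UnitAddCircle) :
    h.toCrMap.iterDeriv 1 x ≠ 0 := fun h0 => by
  let g : CrMap r := ⟨h.toHomeomorph.symm, h.isCr_symm⟩
  have hid : g.comp h.toCrMap = CrMap.id r :=
    CrMap.ext (funext fun x => h.toHomeomorph.symm_apply_apply x)
  have h1 := CrMap.iterDeriv_one_comp hr g h.toCrMap x
  rw [hid, CrMap.iterDeriv_one_id hr, h0, mul_zero] at h1
  exact one_ne_zero h1

end CrDiffeo

/-- The chain rule applied to `h ∘ f = A ∘ h`, where the affine map `A` has constant derivative `deg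
f`. -/
theorem ConjugatesToAffine.deriv_mul_eq (hr : 2 ≤ r) {h : CrDiffeo r} {f : CrMap r}
    (hf : ConjugatesToAffine h f) (x : UnitAddCircle) :
    h.toCrMap.iterDeriv 1 (f x) * f.iterDeriv 1 x = f.degree * h.toCrMap.iterDeriv 1 x := by
  obtain ⟨ρ, hρ⟩ := hf
  obtain ⟨c, -, rfl⟩ := exists_coe_eq ρ
  have hlift : ∀ y : ℝ, ((f.degree * y + c : ℝ) : UnitAddCircle) =
      f.degree • (y : UnitAddCircle) + (c : UnitAddCircle) := fun y => by
    rw [AddCircle.coe_add, ← AddCircle.coe_zsmul, zsmul_eq_mul]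
  let A : CrMap r := ⟨fun x => f.degree • x + (c : UnitAddCircle), fun y => f.degree * y + c,
    (contDiff_const.mul contDiff_id).add contDiff_const, hlift⟩
  have hA : ∀ y, A.iterDeriv 1 y = f.degree := fun y => by
    obtain ⟨z, -, rfl⟩ := exists_coe_eq y
    have h1 := A.hasDerivAt_of_lift hr (F := fun y => f.degree * y + c) (by fun_prop) hlift z
    have h2 := ((hasDerivAt_id z).const_mul (f.degree : ℝ)).add_const c
    rw [mul_one] at h2
    exact h1.unique h2
  have hcomp : h.toCrMap.comp f = A.comp h.toCrMap := CrMap.ext (funext fun y => by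
    have h1 := hρ (h.toHomeomorph y)
    rw [h.toHomeomorph.symm_apply_apply] at h1
    exact h1)
  rw [← CrMap.iterDeriv_one_comp hr, hcomp, CrMap.iterDeriv_one_comp hr, hA]

/-- A simultaneous conjugacy to affine maps forces equality. -/
theorem IsStationarySRB.lyapunov_eq (hr : 2 ≤ r)
    (hν : Integrable (fun f : Expanding r => Real.log f.1.c2Norm) ν) (h : IsStationarySRB ν μ)
    (hconj : ∃ h : CrDiffeo r, ∀ f ∈ ν.support, ConjugatesToAffine h f.1) :
    lyapunov ν μ = ∫ f : Expanding r, Real.log |(f.1.degree : ℝ)| ∂ν := by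
  have := h.isProbabilityMeasure
  obtain ⟨H, hH⟩ := hconj
  -- `h'` is continuous and nowhere zero, so `u = log|h'|` is bounded, and `log|f'|` differs from
  -- `log|deg f|` by the coboundary of `u`, which has mean zero.
  set u : UnitAddCircle → ℝ := fun x => Real.log (H.toCrMap.iterDeriv 1 x) with hu
  have huc : Continuous u :=
    (H.toCrMap.continuous_iterDeriv le_rfl
      (le_trans (by norm_num) hr)).log (H.iterDeriv_one_ne_zero hr)
  obtain ⟨B, hB⟩ : ∃ B, ∀ x, |u x| ≤ B := by
    obtain ⟨B, hB⟩ := (isCompact_range huc).isBounded.exists_norm_le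
    exact ⟨B, fun x => hB _ ⟨x, rfl⟩⟩
  obtain ⟨hi, h0⟩ := h.toIsStationary.integral_coboundary_eq_zero huc.measurable
    (integrable_const (2 * B)) (ae_of_all _ fun p => by
      have h1 := (abs_le.1 (hB (p.1.1 p.2))).2
      have h2 := (abs_le.1 (hB p.2)).1
      linarith)
  have hdeg' : Integrable (fun p : Expanding r × UnitAddCircle => Real.log |(p.1.1.degree : ℝ)|)
    (ν.prod μ) := (Expanding.integrable_log_abs_degree hr hν).comp_fst μ
  have hsupp : ∀ᵐ f ∂ν, f ∈ ν.support := Measure.support_mem_ae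
  have hae : (fun p : Expanding r × UnitAddCircle => Real.log |p.1.1.iterDeriv 1 p.2|) =ᵐ[ν.prod μ]
      fun p => Real.log |(p.1.1.degree : ℝ)| - (u (p.1.1 p.2) - u p.2) := by
    filter_upwards [Measure.quasiMeasurePreserving_fst.ae hsupp] with p hp
    have h1 := congrArg Real.log ((hH p.1 hp).deriv_mul_eq hr p.2)
    rw [Real.log_mul (H.iterDeriv_one_ne_zero hr _) (p.1.deriv_ne_zero _),
      Real.log_mul (p.1.degree_ne_zero hr) (H.iterDeriv_one_ne_zero hr _)] at h1
    rw [Real.log_abs, Real.log_abs]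
    simp only [hu]
    linarith
  rw [lyapunov, integral_congr_ae hae, integral_sub hdeg' hi, h0, sub_zero,
    integral_fun_fst (μ := ν) (ν := μ) fun f : Expanding r => Real.log |(f.1.degree : ℝ)|]
  simp

end RandomCircle

end

theorem theorem3p1 (r : ℕ∞) (hr : 2 ≤ r) (ν : Measure (Expanding r)) [IsProbabilityMeasure ν]
    (hν : Integrable (fun f : Expanding r => Real.log f.1.c2Norm) ν) :
    (∃! μ : Measure UnitAddCircle, IsStationarySRB ν μ) ∧
    Integrable (fun f : Expanding r => Real.log |(f.1.degree : ℝ)|) ν ∧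
    ∀ μ : Measure UnitAddCircle, IsStationarySRB ν μ →
      ∃ l : ℝ, IsLyapunovExponent ν μ l ∧
        l ≤ ∫ f : Expanding r, Real.log |(f.1.degree : ℝ)| ∂ν ∧
        (l = ∫ f : Expanding r, Real.log |(f.1.degree : ℝ)| ∂ν ↔
          ∃ h : CrDiffeo r, ∀ f ∈ ν.support, ConjugatesToAffine h f.1) := by
  refine ⟨?_, Expanding.integrable_log_abs_degree hr hν, fun μ h => ⟨lyapunov ν μ,
    isLyapunovExponent_lyapunov hr hν h, h.lyapunov_le hr hν,
    h.exists_conjugatesToAffine hr hν, h.lyapunov_eq hr hν⟩⟩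
  obtain ⟨μ, hμ⟩ := exists_isStationarySRB hr hν
  exact ⟨μ, hμ, fun μ' hμ' => hμ'.unique hr hν hμ⟩
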